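/- **Diagrams.** An *oriented virtual doodle diagram* is a generic smooth immersion of a disjoint union of finitely many oriented circles in the plane whose only multiple points are finitely many transverse double points, each marked as a *real* or a *virtual* crossing. A *closed virtual twin diagram* of degree $n$ is an oriented virtual doodle diagram contained in $\{z\in\mathbb R^2 : |z|\ge 1\}$ such that the radial projection $z\mapsto z/|z|$ restricts to an $n$-fold smooth covering of the unit circle by the underlying circles that is compatible with the counterclockwise orientation, and such that distinct crossings lie on distinct rays from the origin. **Gauss data.** At every real crossing $c$ of an oriented diagram $K$ the two incoming and the two outgoing ends are labelled $c^1,\dots,c^4$ by a fixed rule (left incoming, right incoming, left outgoing, right outgoing, seen in the direction of the strands). Let $X(K)$ be the set of pairs $(a,b)$ of such ends for which an arc of $K$ leaves along $a$ and arrives along $b$ without meeting a real crossing in between. Two diagrams $K,K'$ have the *same Gauss data* if there is a bijection $\sigma$ from the real crossings of $K$ to those of $K'$ such that $(c^i,d^j)\in X(K)$ implies $(\sigma(c)^i,\sigma(d)^j)\in X(K')$. A closed virtual twin diagram *represents* an oriented virtual doodle diagram $D$ if it has the same Gauss data and the same number of components as $D$. **Moves.** For $n\ge 0$ let $VT_n$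 be the group with generators $s_1,\dots,s_{n-1},\rho_1,\dots,\rho_{n-1}$ and relations $s_i^2=\rho_i^2=1$; $s_is_j=s_js_i$, $\rho_i\rho_j=\rho_j\rho_i$, $\rho_is_j=s_j\rho_i$ for $|i-j|\ge 2$; $\rho_i\rho_{i+1}\rho_i=\rho_{i+1}\rho_i\rho_{i+1}$ and $\rho_i\rho_{i+1}s_i=s_{i+1}\rho_i\rho_{i+1}$. Cutting a closed virtual twin diagram of degree $n$ along a ray from the origin that meets no crossing, and reading its crossings counterclockwise, gives a word in these generators ($s_i$ for a real and $\rho_i$ for a virtual crossing of the $i$-th and $(i+1)$-st strands, counted from the outside towards the origin); the diagram is then called a closure of the element of $VT_n$ that the word represents. The move $M0$ replaces a closure of $\beta\in VT_n$ by any closure of the same $\beta$ (use of the defining relations). The move $M2$ (right stabilization of real or virtual type) replaces a closure of $\beta\in VT_n$, $n\ge1$, by a closure of $\beta s_n$ or of $\beta\rho_n$ in $VT_{n+1}$, or conversely. **Statement.** Let $D$ be an oriented virtual doodle diagram. Any two closed virtual twin diagrams that represent $D$ are related by a finite sequence of $M0$ and $M2$ moves. (Taking $D$ to be one of the two: any two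 closed virtual twin diagrams with the same Gauss data and the same number of components are so related.) -/

import Mathlib

open scoped ContDiff

/-! ## Oriented virtual doodle diagrams in the plane -/

/-- `planeDet v w` is the determinant of the pair of plane vectors `v, w`, where `ℂ` is the
plane `ℝ²`. It is positive iff `w` points to the left of `v`. -/
def planeDet (v w : ℂ) : ℝ := v.re * w.im - v.im * w.re

/-- The velocity at `x` of a map from a disjoint union of oriented circles to the plane. -/
noncomputable def circleVelocity {m : ℕ} (k : Fin m × AddCircle (1 : ℝ) → ℂ)
    (x : Fin m × AddCircle (1 : ℝ)) : ℂ :=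
  deriv (fun s : ℝ => k (x.1, x.2 + (s : AddCircle (1 : ℝ)))) 0

/-- The crossings of a map to the plane: the points with at least two preimages. -/
def crossingSet {X : Type*} (k : X → ℂ) : Set ℂ :=
  {c | ∃ x y, x ≠ y ∧ k x = c ∧ k y = c}

/-- An oriented virtual doodle diagram: a generic smooth immersion of a disjoint union of
finitely many oriented circles in the plane, whose only multiple points are finitely many
transverse double points, each of which is marked as real or as virtual. The circles carry the
orientation of `ℝ / ℤ`. -/
structure VirtualDoodleDiagram where
  /-- The number of components. -/
  numComponents : ℕ
  /-- The underlying immersion. -/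
  map : Fin numComponents × AddCircle (1 : ℝ) → ℂ
  smooth : ∀ j, ContDiff ℝ ∞ (fun t : ℝ => map (j, (t : AddCircle (1 : ℝ))))
  immersion : ∀ x, circleVelocity map x ≠ 0
  transverse : ∀ x y, x ≠ y → map x = map y →
    planeDet (circleVelocity map x) (circleVelocity map y) ≠ 0
  noTriple : ∀ x y z, x ≠ y → y ≠ z → x ≠ z → ¬ (map x = map y ∧ map y = map z)
  finite_crossings : (crossingSet map).Finite
  /-- The set of real crossings; the other crossings are virtual. -/
  real : Set ℂ
  real_subset : real ⊆ crossingSet map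

/-! ## Gauss data -/

/-- The four ends of an oriented crossing, seen in the direction of the two strands: they come
in from the left and from the right, and go out to the left and to the right. -/
inductive CrossingEnd
  | inLeft
  | inRight
  | outLeft
  | outRight

namespace VirtualDoodleDiagram

variable (K : VirtualDoodleDiagram)

/-- The set `V_R(K)` of real crossings, as a type. -/
def RealCrossing : Type := {c : ℂ // c ∈ K.real}

/-- The set `V_∂(K)` of ends of real crossings. -/
def Boundary : Type := K.RealCrossing × CrossingEnd

/-- `x` is the preimage of `c` on the strand that crosses from left to right, that is, the other
strand through `c` points to the left of it. -/
def IsLeftToRight (c : ℂ) (x : Fin K.numComponents × AddCircle (1 : ℝ)) : Prop :=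
  K.map x = c ∧ ∃ y, y ≠ x ∧ K.map y = c ∧
    0 < planeDet (circleVelocity K.map x) (circleVelocity K.map y)

/-- `x` is the preimage of `c` on the strand that crosses from right to left. -/
def IsRightToLeft (c : ℂ) (x : Fin K.numComponents × AddCircle (1 : ℝ)) : Prop :=
  K.map x = c ∧ ∃ y, y ≠ x ∧ K.map y = c ∧
    planeDet (circleVelocity K.map x) (circleVelocity K.map y) < 0

/-- An arc of the diagram cut at its real crossings starts at the end `a`, and it does so on the
strand that passes through the real crossing at the parameter `x`. -/
def StartsAt (a : K.Boundary) (x : Fin K.numComponents × AddCircle (1 : ℝ)) : Prop :=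
  (a.2 = CrossingEnd.outRight ∧ K.IsLeftToRight a.1.1 x) ∨
    (a.2 = CrossingEnd.outLeft ∧ K.IsRightToLeft a.1.1 x)

/-- An arc of the diagram cut at its real crossings ends at the end `b`, and it does so on the
strand that passes through the real crossing at the parameter `y`. -/
def EndsAt (b : K.Boundary) (y : Fin K.numComponents × AddCircle (1 : ℝ)) : Prop :=
  (b.2 = CrossingEnd.inLeft ∧ K.IsLeftToRight b.1.1 y) ∨
    (b.2 = CrossingEnd.inRight ∧ K.IsRightToLeft b.1.1 y)

/-- The set `X(K)` of pairs `(a, b)` such that an arc of `K` runs from the end `a` of a real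
crossing to the end `b` of a real crossing (possibly the same one), along the orientation, through
no real crossing in between. -/
def gaussArcs : Set (K.Boundary × K.Boundary) :=
  {ab | ∃ (j : Fin K.numComponents) (x : AddCircle (1 : ℝ)) (s : ℝ), 0 < s ∧ s ≤ 1 ∧
    K.StartsAt ab.1 (j, x) ∧ K.EndsAt ab.2 (j, x + (s : AddCircle (1 : ℝ))) ∧
    ∀ u : ℝ, 0 < u → u < s → K.map (j, x + (u : AddCircle (1 : ℝ))) ∉ K.real}

/-- `K` and `K'` have the same Gauss data: some bijection of their real crossings, extended to
the ends of the crossings, carries the arcs of `K` to arcs of `K'`. -/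
def SameGaussData (K K' : VirtualDoodleDiagram) : Prop :=
  ∃ σ : K.RealCrossing ≃ K'.RealCrossing, ∀ a b : K.Boundary, (a, b) ∈ K.gaussArcs →
    (((σ a.1, a.2) : K'.Boundary), ((σ b.1, b.2) : K'.Boundary)) ∈ K'.gaussArcs

end VirtualDoodleDiagram

/-! ## Closed virtual twin diagrams -/

/-- The radial projection `z ↦ z / |z|` from the punctured plane to the unit circle. -/
noncomputable def radialProj (z : ℂ) : Circle := Circle.exp (Complex.arg z)

/-- A closed virtual twin diagram: an oriented virtual doodle diagram outside the open unit disk,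
such that the radial projection of the underlying immersion is a finite covering of the unit
circle, compatible with the counterclockwise orientation (the angular velocity is positive), and
such that different crossings lie on different rays from the origin. -/
structure ClosedVirtualTwinDiagram extends VirtualDoodleDiagram where
  /-- The number of strands. -/
  degree : ℕ
  outside : ∀ x, 1 ≤ ‖map x‖
  covering : IsCoveringMap (fun x => radialProj (map x))
  fold : ∀ p : Circle, {x | radialProj (map x) = p}.encard = degree
  oriented : ∀ x, 0 < planeDet (map x) (circleVelocity map x)
  crossings_injOn : Set.InjOn radialProj (crossingSet map)

/-! ## Virtual twin groups -/

/-- The generators of the virtual twin group on `n` strands, with indices shifted by one: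
`s i` and `ρ i` involve the strands `i + 1` and `i + 2` of `1, …, n`. -/
inductive VTGen (n : ℕ)
  | s (i : Fin (n - 1))
  | ρ (i : Fin (n - 1))

namespace VTGen

/-- The generator `s i` in the free group. -/
def fs {n : ℕ} (i : Fin (n - 1)) : FreeGroup (VTGen n) := FreeGroup.of (VTGen.s i)

/-- The generator `ρ i` in the free group. -/
def fρ {n : ℕ} (i : Fin (n - 1)) : FreeGroup (VTGen n) := FreeGroup.of (VTGen.ρ i)

end VTGen

open VTGen in
/-- The defining relators of the virtual twin group; a relation `a = b` is the relator
`a * b⁻¹`. -/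
inductive VTRel (n : ℕ) : FreeGroup (VTGen n) → Prop
  | s_sq (i : Fin (n - 1)) : VTRel n (fs i * fs i)
  | s_comm (i j : Fin (n - 1)) (h : i.1 + 2 ≤ j.1 ∨ j.1 + 2 ≤ i.1) :
      VTRel n (fs i * fs j * (fs j * fs i)⁻¹)
  | ρ_sq (i : Fin (n - 1)) : VTRel n (fρ i * fρ i)
  | ρ_comm (i j : Fin (n - 1)) (h : i.1 + 2 ≤ j.1 ∨ j.1 + 2 ≤ i.1) :
      VTRel n (fρ i * fρ j * (fρ j * fρ i)⁻¹)
  | ρ_braid (i j : Fin (n - 1)) (h : j.1 = i.1 + 1) :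
      VTRel n (fρ i * fρ j * fρ i * (fρ j * fρ i * fρ j)⁻¹)
  | ρs_comm (i j : Fin (n - 1)) (h : i.1 + 2 ≤ j.1 ∨ j.1 + 2 ≤ i.1) :
      VTRel n (fρ i * fs j * (fs j * fρ i)⁻¹)
  | mixed (i j : Fin (n - 1)) (h : j.1 = i.1 + 1) :
      VTRel n (fρ i * fρ j * fs i * (fs j * fρ i * fρ j)⁻¹)

/-- The virtual twin group on `n` strands. -/
abbrev VT (n : ℕ) : Type := PresentedGroup {r | VTRel n r}

namespace VTGen

/-- A generator on `n` strands as a generator on `n + 1` strands, with a strand added on the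
right. -/
def addStrand {n : ℕ} : VTGen n → VTGen (n + 1)
  | s i => s ⟨i.1, by omega⟩
  | ρ i => ρ ⟨i.1, by omega⟩

end VTGen

namespace VT

/-- The inclusion of virtual twins on `n` strands in those on `n + 1` strands, which adds a
trivial strand on the right. -/
def addStrand (n : ℕ) : VT n →* VT (n + 1) :=
  PresentedGroup.toGroup (f := fun g => PresentedGroup.of g.addStrand) (by
    intro r hr
    have key : FreeGroup.lift (fun g : VTGen n => (PresentedGroup.of g.addStrand : VT (n + 1))) r
        = PresentedGroup.mk _ (FreeGroup.map VTGen.addStrand r) := by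
      rw [← MonoidHom.comp_apply]
      congr 1
      ext g
      simp [PresentedGroup.of]
    rw [key, PresentedGroup.one_of_mem]
    cases hr with
    | s_sq i => exact VTRel.s_sq _
    | s_comm i j h => exact VTRel.s_comm ⟨i.1, by omega⟩ ⟨j.1, by omega⟩ h
    | ρ_sq i => exact VTRel.ρ_sq _
    | ρ_comm i j h => exact VTRel.ρ_comm ⟨i.1, by omega⟩ ⟨j.1, by omega⟩ h
    | ρ_braid i j h => exact VTRel.ρ_braid ⟨i.1, by omega⟩ ⟨j.1, by omega⟩ h
    | ρs_comm i j h => exact VTRel.ρs_comm ⟨i.1, by omega⟩ ⟨j.1, by omega⟩ h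
    | mixed i j h => exact VTRel.mixed ⟨i.1, by omega⟩ ⟨j.1, by omega⟩ h)

/-- The real crossing of the last two of `n + 1` strands. -/
def sLast (n : ℕ) (hn : 1 ≤ n) : VT (n + 1) :=
  PresentedGroup.of (VTGen.s ⟨n - 1, by omega⟩)

/-- The virtual crossing of the last two of `n + 1` strands. -/
def ρLast (n : ℕ) (hn : 1 ≤ n) : VT (n + 1) :=
  PresentedGroup.of (VTGen.ρ ⟨n - 1, by omega⟩)

end VT

/-! ## Cutting closed diagrams, and the moves -/

/-- The counterclockwise angle in `[0, 2π)` from the ray through `p` to the ray through `c`. -/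
noncomputable def angleFrom (p : Circle) (c : ℂ) : ℝ :=
  toIcoMod Real.two_pi_pos 0 (Complex.arg (c / p))

namespace ClosedVirtualTwinDiagram

variable (K : ClosedVirtualTwinDiagram)

/-- The number of strands that pass the ray of the crossing `c` on the left of `c`. Strands run
counterclockwise and are drawn downwards, so the left of the picture is the outer side of `c`, and
the last strand is the one closest to the origin. -/
noncomputable def position (c : ℂ) : ℕ :=
  {x | radialProj (K.map x) = radialProj c ∧ ‖c‖ < ‖K.map x‖}.ncard

/-- The generator that the crossing `c` contributes. -/
def IsLetter {n : ℕ} (c : ℂ) : VTGen n → Prop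
  | VTGen.s i => c ∈ K.real ∧ K.position c = i.1
  | VTGen.ρ i => c ∉ K.real ∧ K.position c = i.1

/-- `K` is a closure of the virtual twin `β` on `n` strands: `K` has degree `n`, and cutting it
along some ray that meets no crossing and reading its crossings in the order in which they occur
gives a word that represents `β`. -/
def IsClosureOf (n : ℕ) (β : VT n) : Prop :=
  K.degree = n ∧ ∃ (p : Circle) (L : List ℂ) (w : List (VTGen n)),
    p ∉ radialProj '' crossingSet K.map ∧
    (∀ c, c ∈ L ↔ c ∈ crossingSet K.map) ∧
    L.Pairwise (fun c d => angleFrom p c < angleFrom p d) ∧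
    List.Forall₂ K.IsLetter L w ∧
    (w.map PresentedGroup.of).prod = β

/-- The move `M0`: the diagrams are closures of words that are equal in a virtual twin group by
its defining relations. -/
def M0 (K K' : ClosedVirtualTwinDiagram) : Prop :=
  ∃ (n : ℕ) (β : VT n), K.IsClosureOf n β ∧ K'.IsClosureOf n β

/-- The move `M2`, right stabilization of real or virtual type: `K` and `K'` are closures of `β`
and of `β sₙ` or `β ρₙ`, where `β` is a virtual twin on `n` strands. -/
def M2 (K K' : ClosedVirtualTwinDiagram) : Prop :=
  ∃ (n : ℕ) (hn : 1 ≤ n) (β : VT n), K.IsClosureOf n β ∧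
    (K'.IsClosureOf (n + 1) (VT.addStrand n β * VT.sLast n hn) ∨
      K'.IsClosureOf (n + 1) (VT.addStrand n β * VT.ρLast n hn))

/-- `K` and `K'` are related by a finite sequence of moves `M0` and `M2`, in both directions. -/
def RelatedByM0M2 (K K' : ClosedVirtualTwinDiagram) : Prop :=
  Relation.EqvGen (fun A B => M0 A B ∨ M2 A B) K K'

/-- `K` is a closed virtual twin diagram for the oriented virtual doodle diagram `D`: it has the
same Gauss data and the same number of components. -/
def IsFor (K : ClosedVirtualTwinDiagram) (D : VirtualDoodleDiagram) : Prop :=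
  D.SameGaussData K.toVirtualDoodleDiagram ∧ D.numComponents = K.numComponents

end ClosedVirtualTwinDiagram

/-!
Two closed virtual twin diagrams for the same diagram `D` are compared through an invariant of
virtual twins. The *Markov class* of `β ∈ VT n` is its class under conjugation and virtual right
stabilization.

*Diagrams from words.* Every word in the generators is realized by a closed diagram, and cutting
that diagram along another ray rotates the word. Therefore closures of virtual twins with equal
Markov classes are related by `M0` and `M2` (`relatedByM0M2_of_markovClass_eq`). Real
stabilizations are not needed.

*Strand systems.* The virtual generators of `VT n` generate a copy of the symmetric group, so there
is a well defined real crossing `VT.cross n a b` of two arbitrary strands, and every virtual twin is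
a product of such crossings followed by a permutation. Therefore a finite set `X` of strands, a list
of crossings in `X × X` and a permutation `φ` of `X`, which says by which strand a strand is
continued, have a Markov class (`strandClass`), which does not depend on the order of the strands.
Virtual stabilization inserts or deletes a strand without crossings (`strandClass_insertAfter`), and
it moves the last crossing of the list to two new strands and then to the front
(`strandClass_detach`). In a system in which no two crossings share a strand, delete the strands
without crossings, except one in each component without any crossing. What is left is determined, up
to a bijection, by the Gauss data and the number of components (`HasGaussData.strandClass_eq`).
Crossings without a common strand commute, so that their order does not matter either
(`strandClass_perm`).

*Reading a closed diagram.* The polar angle is a parameter along every component, which gives a flow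
on the underlying circles. The strands that start at the points on a ray are ordered by their
distance to the origin. This order changes at the crossings only, where two neighbours are swapped;
so the word of the diagram is the strand twin of its real crossings and of the permutation by one
full turn (`IsClosureOf.exists_strandClass`). Detaching all real crossings, from the last to the
first, corresponds to adding their preimages to the points on the ray as new cutting points
(`IsFlowSection.exists_detached`). The arcs of the resulting strand system are the arcs between the
real crossings of the diagram (`IsFlowSection.hasGaussData`).
-/

open Equiv

/-! ### The symmetric group inside the virtual twin group -/

namespace VT

/-- The virtual generator `ρ i` of `VT n`, indexed by natural numbers; it is `1` out of range. -/
def rho (n i : ℕ) : VT n :=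
  if h : i < n - 1 then PresentedGroup.of (VTGen.ρ ⟨i, h⟩) else 1

/-- The real generator `s i` of `VT n`, indexed by natural numbers; it is `1` out of range. -/
def sig (n i : ℕ) : VT n :=
  if h : i < n - 1 then PresentedGroup.of (VTGen.s ⟨i, h⟩) else 1

theorem mk_eq_of_rel {n : ℕ} {a b : FreeGroup (VTGen n)} (h : VTRel n (a * b⁻¹)) :
    (PresentedGroup.mk {r | VTRel n r} a) = PresentedGroup.mk _ b := by
  have := PresentedGroup.one_of_mem (rels := {r | VTRel n r}) h
  rwa [map_mul, map_inv, mul_inv_eq_one] at this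

theorem rho_mul_self (n i : ℕ) : rho n i * rho n i = 1 := by
  unfold rho
  split_ifs with h
  · exact PresentedGroup.one_of_mem (rels := {r | VTRel n r}) (VTRel.ρ_sq ⟨i, h⟩)
  · simp

theorem rho_comm (n i j : ℕ) (h : i + 2 ≤ j ∨ j + 2 ≤ i) :
    rho n i * rho n j = rho n j * rho n i := by
  unfold rho
  split_ifs with h1 h2
  · exact mk_eq_of_rel (VTRel.ρ_comm ⟨i, h1⟩ ⟨j, h2⟩ h)
  all_goals simp

theorem sig_comm (n i j : ℕ) (h : i + 2 ≤ j ∨ j + 2 ≤ i) :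
    sig n i * sig n j = sig n j * sig n i := by
  unfold sig
  split_ifs with h1 h2
  · exact mk_eq_of_rel (VTRel.s_comm ⟨i, h1⟩ ⟨j, h2⟩ h)
  all_goals simp

theorem rho_sig_comm (n i j : ℕ) (h : i + 2 ≤ j ∨ j + 2 ≤ i) :
    rho n i * sig n j = sig n j * rho n i := by
  unfold rho sig
  split_ifs with h1 h2
  · exact mk_eq_of_rel (VTRel.ρs_comm ⟨i, h1⟩ ⟨j, h2⟩ h)
  all_goals simp

theorem rho_braid (n i : ℕ) (h : i + 2 < n) :
    rho n i * rho n (i + 1) * rho n i = rho n (i + 1) * rho n i * rho n (i + 1) := by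
  unfold rho
  rw [dif_pos (by omega : i < n - 1), dif_pos (by omega : i + 1 < n - 1)]
  exact mk_eq_of_rel (VTRel.ρ_braid ⟨i, by omega⟩ ⟨i + 1, by omega⟩ rfl)

theorem rho_rho_sig (n i : ℕ) (h : i + 2 < n) :
    rho n i * rho n (i + 1) * sig n i = sig n (i + 1) * rho n i * rho n (i + 1) := by
  unfold rho sig
  simp only [dif_pos (by omega : i < n - 1), dif_pos (by omega : i + 1 < n - 1)]
  exact mk_eq_of_rel (VTRel.mixed ⟨i, by omega⟩ ⟨i + 1, by omega⟩ rfl)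

theorem addStrand_rho (n i : ℕ) (h : i + 1 < n) : addStrand n (rho n i) = rho (n + 1) i := by
  unfold rho addStrand
  rw [dif_pos (by omega : i < n - 1), dif_pos (by omega : i < n + 1 - 1),
    PresentedGroup.toGroup.of]
  rfl

theorem addStrand_sig (n i : ℕ) (h : i + 1 < n) : addStrand n (sig n i) = sig (n + 1) i := by
  unfold sig addStrand
  rw [dif_pos (by omega : i < n - 1), dif_pos (by omega : i < n + 1 - 1),
    PresentedGroup.toGroup.of]
  rfl

theorem ρLast_eq_rho (n : ℕ) (hn : 1 ≤ n) : ρLast n hn = rho (n + 1) (n - 1) := by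
  unfold rho ρLast
  rw [dif_pos (by omega : n - 1 < n + 1 - 1)]

end VT

/-- The transposition of `i` and `i + 1` in `Fin n`; it is `1` out of range. -/
def adjSwap (n i : ℕ) : Perm (Fin n) :=
  if h : i + 1 < n then swap ⟨i, by omega⟩ ⟨i + 1, h⟩ else 1

/-- A permutation of `Fin n` as a permutation of `Fin (n + 1)` that fixes the last element. -/
def extendLast (n : ℕ) : Perm (Fin n) →* Perm (Fin (n + 1)) where
  toFun g := (finSuccEquivLast.trans (optionCongr g)).trans finSuccEquivLast.symm
  map_one' := by ext i; simp
  map_mul' g h := by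
    ext i
    cases i using Fin.lastCases <;> simp

@[simp] theorem extendLast_castSucc {n : ℕ} (g : Perm (Fin n)) (i : Fin n) :
    extendLast n g i.castSucc = (g i).castSucc := by
  simp [extendLast]

@[simp] theorem extendLast_last {n : ℕ} (g : Perm (Fin n)) :
    extendLast n g (Fin.last n) = Fin.last n := by
  simp [extendLast]

theorem extendLast_swap {n : ℕ} (i j : Fin n) :
    extendLast n (swap i j) = swap i.castSucc j.castSucc := by
  ext k
  cases k using Fin.lastCases with
  | last => rw [extendLast_last, swap_apply_of_ne_of_ne (Fin.castSucc_lt_last _).ne'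
      (Fin.castSucc_lt_last _).ne']
  | cast k =>
    simp only [extendLast_castSucc, swap_apply_def, Fin.castSucc_inj]
    split_ifs <;> rfl

theorem extendLast_adjSwap (n i : ℕ) (h : i + 1 < n) :
    extendLast n (adjSwap n i) = adjSwap (n + 1) i := by
  unfold adjSwap
  rw [dif_pos h, dif_pos (by omega), extendLast_swap]
  rfl

theorem adjSwap_mul_self (n i : ℕ) : adjSwap n i * adjSwap n i = 1 := by
  unfold adjSwap; split_ifs <;> simp

theorem adjSwap_comm (n i j : ℕ) (h : i + 2 ≤ j ∨ j + 2 ≤ i) :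
    adjSwap n i * adjSwap n j = adjSwap n j * adjSwap n i := by
  unfold adjSwap
  split_ifs with h1 h2
  · refine (Perm.Disjoint.commute ?_).eq
    rw [Perm.disjoint_iff_disjoint_support, Perm.support_swap (by simp),
      Perm.support_swap (by simp)]
    simp; omega
  all_goals simp

theorem adjSwap_braid (n i : ℕ) (h : i + 2 < n) :
    adjSwap n i * adjSwap n (i + 1) * adjSwap n i =
      adjSwap n (i + 1) * adjSwap n i * adjSwap n (i + 1) := by
  unfold adjSwap
  rw [dif_pos (by omega), dif_pos (by omega)]
  set a : Fin n := ⟨i, by omega⟩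
  set b : Fin n := ⟨i + 1, by omega⟩
  set c : Fin n := ⟨i + 1 + 1, by omega⟩
  have h1 := swap_mul_swap_mul_swap (x := c) (y := b) (z := a) (by simp [c, b])
    (by simp [c, a]; omega)
  have h2 := swap_mul_swap_mul_swap (x := a) (y := b) (z := c) (by simp [a, b])
    (by simp [c, a]; omega)
  rw [h2, swap_comm a b, swap_comm b c, h1, swap_comm]

theorem adjSwap_apply (n i : ℕ) (j : Fin n) :
    adjSwap n i j = if h : i + 1 < n then
      (if j.1 = i then ⟨i + 1, h⟩ else if j.1 = i + 1 then ⟨i, by omega⟩ else j) else j := by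
  unfold adjSwap
  split_ifs with h <;> simp_all [swap_apply_def, Fin.ext_iff]

theorem adjSwap_left (n i : ℕ) (h : i + 1 < n) :
    adjSwap n i ⟨i, by omega⟩ = ⟨i + 1, h⟩ := by
  rw [adjSwap, dif_pos h, swap_apply_left]

theorem adjSwap_of_ne (n i : ℕ) (j : Fin n) (h1 : j.1 ≠ i) (h2 : j.1 ≠ i + 1) :
    adjSwap n i j = j := by
  rw [adjSwap_apply]; split_ifs <;> rfl

namespace VT

/-- The permutation that underlies a virtual twin; every crossing swaps its two strands. -/
def toPerm (n : ℕ) : VT n →* Perm (Fin n) :=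
  PresentedGroup.toGroup (f := fun g => match g with
    | VTGen.s i => adjSwap n i
    | VTGen.ρ i => adjSwap n i) (by
    intro r hr
    cases hr with
    | s_sq i => simp [VTGen.fs, adjSwap_mul_self]
    | s_comm i j h => simp [VTGen.fs, adjSwap_comm n i j h]
    | ρ_sq i => simp [VTGen.fρ, adjSwap_mul_self]
    | ρ_comm i j h => simp [VTGen.fρ, adjSwap_comm n i j h]
    | ρ_braid i j h =>
      have := adjSwap_braid n i (by omega)
      simp only [VTGen.fρ, map_mul, map_inv, FreeGroup.lift_apply_of, h]
      rw [this, mul_inv_cancel]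
    | ρs_comm i j h => simp [VTGen.fs, VTGen.fρ, adjSwap_comm n i j h]
    | mixed i j h =>
      have := adjSwap_braid n i (by omega)
      simp only [VTGen.fs, VTGen.fρ, map_mul, map_inv, FreeGroup.lift_apply_of, h]
      rw [this, mul_inv_cancel])

theorem toPerm_rho (n i : ℕ) : toPerm n (rho n i) = adjSwap n i := by
  unfold rho
  split_ifs with h
  · simp [toPerm]
  · rw [map_one, adjSwap, dif_neg (by omega)]

/-- The subgroup of virtual twins without real crossings. -/
def rhoSubgroup (n : ℕ) : Subgroup (VT n) := Subgroup.closure (Set.range (rho n))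

theorem rho_mem (n i : ℕ) : rho n i ∈ rhoSubgroup n := Subgroup.subset_closure ⟨i, rfl⟩

/-- The generators `ρ i` are involutions, so that no inverses are needed to generate the
subgroup. -/
theorem rhoSubgroup_induction {n : ℕ} {p : VT n → Prop} (one : p 1)
    (mul : ∀ i g, p g → p (rho n i * g)) {g : VT n} (hg : g ∈ rhoSubgroup n) : p g := by
  induction hg using Subgroup.closure_induction_left with
  | one => exact one
  | mul_left x hx y _ hy => obtain ⟨i, rfl⟩ := hx; exact mul i y hy
  | inv_mul_cancel x hx y _ hy =>
    obtain ⟨i, rfl⟩ := hx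
    rw [inv_eq_of_mul_eq_one_left (rho_mul_self n i)]
    exact mul i y hy

/-- `rhoCycle n k` is `ρ_{n-k} ⋯ ρ_{n-1}` in `VT (n + 1)`. It moves the last of the
`n + 1` strands `k` places to the left. -/
def rhoCycle (n : ℕ) : ℕ → VT (n + 1)
  | 0 => 1
  | k + 1 => rho (n + 1) (n - (k + 1)) * rhoCycle n k

theorem rho_mul_rhoCycle_of_lt (n i k : ℕ) (hk : k ≤ n) (h : i + 1 < n - k) :
    rho (n + 1) i * rhoCycle n k = rhoCycle n k * rho (n + 1) i := by
  induction k with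
  | zero => simp [rhoCycle]
  | succ k ih =>
    rw [rhoCycle, ← mul_assoc, rho_comm _ _ _ (by omega), mul_assoc, ih (by omega) (by omega),
      mul_assoc]

theorem rho_mul_rhoCycle_of_gt (n i k : ℕ) (hk : k ≤ n) (h : n - k ≤ i) (hi : i + 1 < n) :
    rho (n + 1) (i + 1) * rhoCycle n k = rhoCycle n k * rho (n + 1) i := by
  induction k with
  | zero => omega
  | succ k ih =>
    rcases Nat.lt_or_ge i (n - k) with h2 | h2
    · obtain rfl : i = n - (k + 1) := by omega
      cases k with
      | zero => omega
      | succ k =>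
        have e : n - (k + 1) = n - (k + 1 + 1) + 1 := by omega
        have b := rho_braid (n + 1) (n - (k + 1 + 1)) (by omega)
        have c := rho_mul_rhoCycle_of_lt n (n - (k + 1 + 1)) k (by omega) (by omega)
        simp only [rhoCycle, e]
        rw [← mul_assoc, ← mul_assoc, ← b, mul_assoc, c]
        simp only [mul_assoc]
    · rw [rhoCycle, ← mul_assoc, rho_comm _ _ _ (by omega), mul_assoc, ih (by omega) h2, mul_assoc]

theorem addStrand_mem {n : ℕ} {g : VT n} (hg : g ∈ rhoSubgroup n) :
    addStrand n g ∈ rhoSubgroup (n + 1) := by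
  refine rhoSubgroup_induction (p := fun g => addStrand n g ∈ rhoSubgroup (n + 1)) ?_ ?_ hg
  · simp [one_mem]
  · intro i g hg
    rw [map_mul]
    refine mul_mem ?_ hg
    by_cases h : i + 1 < n
    · rw [addStrand_rho n i h]; exact rho_mem _ _
    · rw [rho, dif_neg (by omega), map_one]; exact one_mem _

/-- Coset decomposition of the `ρ`-subgroup along the last strand. -/
theorem exists_rhoCycle_mul {n : ℕ} {g : VT (n + 1)} (hg : g ∈ rhoSubgroup (n + 1)) :
    ∃ k ≤ n, ∃ h ∈ rhoSubgroup n, g = rhoCycle n k * addStrand n h := by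
  refine rhoSubgroup_induction (p := fun g => ∃ k ≤ n, ∃ h ∈ rhoSubgroup n,
    g = rhoCycle n k * addStrand n h) ⟨0, by omega, 1, one_mem _, by simp [rhoCycle]⟩ ?_ hg
  rintro i _ ⟨k, hk, h, hh, rfl⟩
  by_cases hi : i < n
  swap
  · exact ⟨k, hk, h, hh, by rw [rho, dif_neg (by omega), one_mul]⟩
  rcases lt_trichotomy (i + 1) (n - k) with h1 | h1 | h1
  · refine ⟨k, hk, rho n i * h, mul_mem (rho_mem _ _) hh, ?_⟩
    rw [← mul_assoc, rho_mul_rhoCycle_of_lt n i k hk h1, map_mul, addStrand_rho n i (by omega),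
      mul_assoc]
  · refine ⟨k + 1, by omega, h, hh, ?_⟩
    rw [rhoCycle, ← mul_assoc, show n - (k + 1) = i by omega]
  · rcases Nat.lt_or_ge i (n - k + 1) with h2 | h2
    · obtain _ | k := k
      · omega
      refine ⟨k, by omega, h, hh, ?_⟩
      rw [rhoCycle, ← mul_assoc, ← mul_assoc, show n - (k + 1) = i by omega, rho_mul_self, one_mul]
    · obtain _ | i := i
      · omega
      refine ⟨k, hk, rho n i * h, mul_mem (rho_mem _ _) hh, ?_⟩
      rw [← mul_assoc, rho_mul_rhoCycle_of_gt n i k hk (by omega) (by omega), map_mul,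
        addStrand_rho n i (by omega), mul_assoc]

theorem toPerm_addStrand (n : ℕ) {g : VT n} (hg : g ∈ rhoSubgroup n) :
    toPerm (n + 1) (addStrand n g) = extendLast n (toPerm n g) := by
  refine rhoSubgroup_induction
    (p := fun g => toPerm (n + 1) (addStrand n g) = extendLast n (toPerm n g)) (by simp) ?_ hg
  intro i g hg
  by_cases h : i + 1 < n
  · rw [map_mul, map_mul, map_mul, map_mul, hg, addStrand_rho n i h, toPerm_rho, toPerm_rho,
      extendLast_adjSwap n i h]
  · rw [rho, dif_neg (by omega), one_mul, hg]

theorem toPerm_rhoCycle_last (n k : ℕ) (hk : k ≤ n) :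
    (toPerm (n + 1) (rhoCycle n k) (Fin.last n)).1 = n - k := by
  induction k with
  | zero => simp [rhoCycle]
  | succ k ih =>
    have ih := ih (by omega)
    rw [rhoCycle, map_mul, toPerm_rho, Perm.mul_apply, adjSwap_apply]
    split_ifs <;> (try simp) <;> omega

/-- The `ρ`-subgroup embeds in the symmetric group, because the relations between the `ρ i` are
a Coxeter presentation of it. -/
theorem eq_one_of_toPerm_eq_one {n : ℕ} {g : VT n} (hg : g ∈ rhoSubgroup n)
    (h : toPerm n g = 1) : g = 1 := by
  induction n with
  | zero =>
    refine rhoSubgroup_induction (p := fun g => g = 1) rfl ?_ hg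
    rintro i _ rfl
    simp [rho]
  | succ n ih =>
    obtain ⟨k, hk, g, hg', rfl⟩ := exists_rhoCycle_mul hg
    clear hg
    -- the last strand ends in the place `n - k`
    have h0 : k = 0 := by
      have := congrArg (fun σ => (σ (Fin.last n)).1) h
      simp only [map_mul, Perm.mul_apply, toPerm_addStrand n hg', extendLast_last,
        toPerm_rhoCycle_last n k hk, Perm.one_apply, Fin.val_last] at this
      omega
    subst h0
    rw [rhoCycle, one_mul, toPerm_addStrand n hg'] at h
    rw [ih hg', rhoCycle, map_one, one_mul]
    ext i
    have := congrArg (fun σ => (σ i.castSucc).1) h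
    simpa using this

theorem exists_toPerm_eq (n : ℕ) (σ : Perm (Fin n)) : ∃ g ∈ rhoSubgroup n, toPerm n g = σ := by
  cases n with
  | zero => exact ⟨1, one_mem _, Subsingleton.elim _ _⟩
  | succ n =>
    have hσ : σ ∈ Submonoid.closure (Set.range fun i : Fin n => swap i.castSucc i.succ) := by
      rw [Perm.mclosure_swap_castSucc_succ]; trivial
    induction hσ using Submonoid.closure_induction with
    | mem x hx =>
      obtain ⟨i, rfl⟩ := hx
      refine ⟨rho (n + 1) i, rho_mem _ _, ?_⟩
      rw [toPerm_rho, adjSwap, dif_pos (by omega)]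
      rfl
    | one => exact ⟨1, one_mem _, map_one _⟩
    | mul x y _ _ hx hy =>
      obtain ⟨g, hg, rfl⟩ := hx
      obtain ⟨h, hh, rfl⟩ := hy
      exact ⟨g * h, mul_mem hg hh, map_mul _ _ _⟩

theorem eq_of_toPerm_eq {n : ℕ} {g h : VT n} (hg : g ∈ rhoSubgroup n) (hh : h ∈ rhoSubgroup n)
    (e : toPerm n g = toPerm n h) : g = h := by
  rw [← mul_inv_eq_one]
  exact eq_one_of_toPerm_eq_one (mul_mem hg (inv_mem hh))
    (by rw [map_mul, map_inv, e, mul_inv_cancel])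

/-- The virtual twin without real crossings that has a given underlying permutation. -/
noncomputable def perm (n : ℕ) : Perm (Fin n) →* VT n where
  toFun σ := (exists_toPerm_eq n σ).choose
  map_one' := eq_of_toPerm_eq (exists_toPerm_eq n 1).choose_spec.1 (one_mem _)
    (by rw [(exists_toPerm_eq n 1).choose_spec.2, map_one])
  map_mul' σ τ := eq_of_toPerm_eq (exists_toPerm_eq n _).choose_spec.1
    (mul_mem (exists_toPerm_eq n _).choose_spec.1 (exists_toPerm_eq n _).choose_spec.1)
    (by rw [(exists_toPerm_eq n _).choose_spec.2, map_mul, (exists_toPerm_eq n _).choose_spec.2,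
      (exists_toPerm_eq n _).choose_spec.2])

theorem perm_mem {n : ℕ} (σ : Perm (Fin n)) : perm n σ ∈ rhoSubgroup n :=
  (exists_toPerm_eq n σ).choose_spec.1

theorem toPerm_perm {n : ℕ} (σ : Perm (Fin n)) : toPerm n (perm n σ) = σ :=
  (exists_toPerm_eq n σ).choose_spec.2

theorem perm_adjSwap (n i : ℕ) : perm n (adjSwap n i) = rho n i :=
  eq_of_toPerm_eq (perm_mem _) (rho_mem _ _) (by rw [toPerm_perm, toPerm_rho])

theorem addStrand_perm {n : ℕ} (σ : Perm (Fin n)) :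
    addStrand n (perm n σ) = perm (n + 1) (extendLast n σ) :=
  eq_of_toPerm_eq (addStrand_mem (perm_mem _)) (perm_mem _)
    (by rw [toPerm_perm, toPerm_addStrand n (perm_mem _), toPerm_perm])

end VT

/-! ### Crossings between two arbitrary strands -/

namespace VT

theorem toPerm_rhoCycle_of_lt (n k : ℕ) (hk : k ≤ n) (j : Fin (n + 1)) (hj : j.1 < n - k) :
    toPerm (n + 1) (rhoCycle n k) j = j := by
  induction k with
  | zero => simp [rhoCycle]
  | succ k ih =>
    rw [rhoCycle, map_mul, toPerm_rho, Perm.mul_apply, ih (by omega) (by omega), adjSwap_apply]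
    split_ifs <;> first | rfl | omega

theorem rhoCycle_mul_sig (n i k : ℕ) (hk : k ≤ n) (h : i + 1 < n - k) :
    rhoCycle n k * sig (n + 1) i = sig (n + 1) i * rhoCycle n k := by
  induction k with
  | zero => simp [rhoCycle]
  | succ k ih =>
    rw [rhoCycle, mul_assoc, ih (by omega) (by omega), ← mul_assoc, rho_sig_comm _ _ _ (by omega),
      mul_assoc]

/-- A virtual twin without real crossings that fixes the first two strands commutes with the
crossings of these strands. -/
theorem commute_of_fix {n : ℕ} {g : VT n} (hg : g ∈ rhoSubgroup n) (h1 : 1 < n)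
    (h : ∀ j : Fin n, j.1 < 2 → toPerm n g j = j) : Commute g (sig n 0 * rho n 0) := by
  induction n, h1 using Nat.le_induction with
  | base =>
    rw [eq_one_of_toPerm_eq_one hg (Equiv.ext fun j => h j j.2)]
    exact Commute.one_left _
  | succ n hn ih =>
    obtain ⟨k, hk, g, hg', rfl⟩ := exists_rhoCycle_mul hg
    have hlast : toPerm (n + 1) (rhoCycle n k * addStrand n g) (Fin.last n) =
        toPerm (n + 1) (rhoCycle n k) (Fin.last n) := by
      rw [map_mul, Perm.mul_apply, toPerm_addStrand n hg', extendLast_last]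
    -- the image `n - k` of the last strand is not one of the two fixed strands
    have hk2 : 2 ≤ n - k := by
      by_contra hlt
      have h2 := toPerm_rhoCycle_last n k hk
      have h3 := h _ (by rw [h2]; omega : (toPerm (n + 1) (rhoCycle n k) (Fin.last n)).1 < 2)
      rw [← hlast] at h3
      have h4 := (toPerm (n + 1) (rhoCycle n k * addStrand n g)).injective h3
      rw [hlast] at h4
      rw [h4, Fin.val_last] at h2
      omega
    have e : addStrand n (sig n 0 * rho n 0) = sig (n + 1) 0 * rho (n + 1) 0 := by
      rw [map_mul, addStrand_sig n 0 (by omega), addStrand_rho n 0 (by omega)]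
    refine Commute.mul_left ?_ ?_
    · exact Commute.mul_right (rhoCycle_mul_sig n 0 k hk (by omega))
        (rho_mul_rhoCycle_of_lt n 0 k hk (by omega)).symm
    · rw [← e]
      refine (ih hg' fun j hj => ?_).map (addStrand n)
      have h3 := h j.castSucc (by simpa using hj)
      rw [map_mul, Perm.mul_apply, toPerm_addStrand n hg', extendLast_castSucc] at h3
      have h4 := toPerm_rhoCycle_of_lt n k hk j.castSucc (by simp; omega)
      rw [← h4] at h3
      simpa using (toPerm (n + 1) (rhoCycle n k)).injective h3

/-- There is a permutation that carries one ordered pair of points to another and moves no points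
other than these four. -/
theorem exists_perm_pair {X : Type*} {x y a b : X} (hxy : x ≠ y) (hab : a ≠ b) :
    ∃ g : Perm X, g x = a ∧ g y = b ∧ ∀ z, z ≠ x → z ≠ y → z ≠ a → z ≠ b → g z = z := by
  classical
  refine ⟨swap (swap x a y) b * swap x a, ?_, ?_, ?_⟩
  · rw [Perm.mul_apply, swap_apply_left, swap_apply_of_ne_of_ne _ hab]
    intro h
    have := (swap x a).injective ((swap_apply_left x a).trans h)
    exact hxy this
  · rw [Perm.mul_apply, swap_apply_left]
  · intro z hx hy ha hb
    rw [Perm.mul_apply, swap_apply_of_ne_of_ne hx ha, swap_apply_of_ne_of_ne _ hb]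
    rw [swap_apply_def]
    split_ifs <;> assumption

open Classical in
/-- The virtual twin in which the strands `a` and `b` have a real crossing, `a` coming from the
left, and are the only strands that deviate; the strands then return to their places through
virtual crossings. It is `1` if `a = b`. -/
noncomputable def cross (n : ℕ) (a b : Fin n) : VT n :=
  if h : ∃ (g : Perm (Fin n)) (h1 : 1 < n), g ⟨0, by omega⟩ = a ∧ g ⟨1, h1⟩ = b then
    perm n h.choose * (sig n 0 * rho n 0) * (perm n h.choose)⁻¹
  else 1

/-- The choice of the permutation in the definition of `cross` does not matter. -/
theorem cross_eq {n : ℕ} (h1 : 1 < n) (g : Perm (Fin n)) :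
    cross n (g ⟨0, by omega⟩) (g ⟨1, h1⟩) = perm n g * (sig n 0 * rho n 0) * (perm n g)⁻¹ := by
  have h : ∃ (g' : Perm (Fin n)) (h1 : 1 < n), g' ⟨0, by omega⟩ = g ⟨0, by omega⟩ ∧
      g' ⟨1, h1⟩ = g ⟨1, h1⟩ := ⟨g, h1, rfl, rfl⟩
  rw [cross, dif_pos h]
  obtain ⟨_, e0, e1⟩ := h.choose_spec
  have hc : Commute (perm n (g⁻¹ * h.choose)) (sig n 0 * rho n 0) := by
    refine commute_of_fix (perm_mem _) h1 fun j hj => ?_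
    rw [toPerm_perm, Perm.mul_apply, Perm.inv_eq_iff_eq]
    rcases (by omega : j.1 = 0 ∨ j.1 = 1) with h0 | h0
    · rw [show j = ⟨0, by omega⟩ from Fin.ext h0]; exact e0
    · rw [show j = ⟨1, by omega⟩ from Fin.ext h0]; exact e1
  rw [map_mul, map_inv] at hc
  have hc := hc.eq
  set x := sig n 0 * rho n 0
  set u := perm n g
  set v := perm n h.choose
  have : v * x = u * x * (u⁻¹ * v) := by rw [mul_assoc u, ← hc]; group
  rw [this]
  group

theorem cross_self {n : ℕ} (a : Fin n) : cross n a a = 1 := by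
  rw [cross, dif_neg]
  rintro ⟨g, h1, e0, e1⟩
  have := g.injective (e0.trans e1.symm)
  simp at this

theorem one_lt_of_ne {n : ℕ} {a b : Fin n} (h : a ≠ b) : 1 < n := by
  by_contra h1
  exact h (Fin.ext (by omega))

theorem perm_mul_cross {n : ℕ} (g : Perm (Fin n)) (a b : Fin n) :
    perm n g * cross n a b = cross n (g a) (g b) * perm n g := by
  rcases eq_or_ne a b with rfl | hab
  · rw [cross_self, cross_self, mul_one, one_mul]
  have h1 := one_lt_of_ne hab
  obtain ⟨h, ha, hb, -⟩ := exists_perm_pair (x := (⟨0, by omega⟩ : Fin n)) (y := ⟨1, h1⟩)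
    (by simp) hab
  rw [← ha, ← hb, cross_eq h1, ← Perm.mul_apply, ← Perm.mul_apply, cross_eq h1, map_mul]
  group

/-- For neighbouring strands, `cross` is the real generator followed by the virtual one, which
returns the two strands to their places. -/
theorem cross_adj (n p : ℕ) (hp : p + 1 < n) :
    cross n ⟨p, by omega⟩ ⟨p + 1, hp⟩ = sig n p * rho n p := by
  induction p with
  | zero => simpa using cross_eq hp 1
  | succ p ih =>
    have ih := ih (by omega)
    -- conjugation by `ρ_p ρ_{p+1}` moves the strands `p, p + 1` one place to the right
    have h := perm_mul_cross (adjSwap n p * adjSwap n (p + 1)) ⟨p, by omega⟩ ⟨p + 1, by omega⟩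
    have e0 : (adjSwap n p * adjSwap n (p + 1)) ⟨p, by omega⟩ = ⟨p + 1, by omega⟩ := by
      rw [Perm.mul_apply, adjSwap_of_ne n (p + 1) _ (by simp) (by simp; omega),
        adjSwap_left n p (by omega)]
    have e1 : (adjSwap n p * adjSwap n (p + 1)) ⟨p + 1, by omega⟩ = ⟨p + 1 + 1, by omega⟩ := by
      rw [Perm.mul_apply, adjSwap_left n (p + 1) hp, adjSwap_of_ne n p _ (by simp; omega) (by simp)]
    rw [e0, e1, map_mul, perm_adjSwap, perm_adjSwap, ih, ← mul_assoc, rho_rho_sig n p hp,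
      mul_assoc (sig n (p + 1)), mul_assoc (sig n (p + 1)), rho_braid n p hp, ← mul_assoc,
      ← mul_assoc, ← mul_assoc] at h
    exact (mul_right_cancel (mul_right_cancel h)).symm

theorem addStrand_cross {n : ℕ} (a b : Fin n) :
    addStrand n (cross n a b) = cross (n + 1) a.castSucc b.castSucc := by
  rcases eq_or_ne a b with rfl | hab
  · rw [cross_self, cross_self, map_one]
  have h1 := one_lt_of_ne hab
  obtain ⟨h, ha, hb, -⟩ := exists_perm_pair (x := (⟨0, by omega⟩ : Fin n)) (y := ⟨1, h1⟩)
    (by simp) hab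
  have e := cross_eq (by omega : 1 < n + 1) (extendLast n h)
  have e0 : extendLast n h ⟨0, by omega⟩ = a.castSucc := by
    rw [← ha, ← extendLast_castSucc]; rfl
  have e1 : extendLast n h ⟨1, by omega⟩ = b.castSucc := by
    rw [← hb, ← extendLast_castSucc]; rfl
  rw [e0, e1] at e
  rw [e, ← ha, ← hb, cross_eq h1, map_mul, map_mul, map_inv, addStrand_perm, map_mul,
    addStrand_sig n 0 h1, addStrand_rho n 0 h1]

/-- The pairs are moved to `0, 1` and `2, 3`, where the far commutation relations apply. -/
theorem cross_commute {n : ℕ} {a b c d : Fin n} (hac : a ≠ c) (had : a ≠ d) (hbc : b ≠ c)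
    (hbd : b ≠ d) : Commute (cross n a b) (cross n c d) := by
  rcases eq_or_ne a b with rfl | hab
  · rw [cross_self]; exact Commute.one_left _
  rcases eq_or_ne c d with rfl | hcd
  · rw [cross_self]; exact Commute.one_right _
  have h1 := one_lt_of_ne hab
  obtain ⟨g, rfl, rfl, -⟩ := exists_perm_pair (x := (⟨0, by omega⟩ : Fin n)) (y := ⟨1, h1⟩)
    (by simp) hab
  obtain ⟨c, rfl⟩ := g.surjective c
  obtain ⟨d, rfl⟩ := g.surjective d
  simp only [ne_eq, EmbeddingLike.apply_eq_iff_eq, Fin.ext_iff] at hac had hbc hbd hcd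
  have h3 : 3 < n := by omega
  obtain ⟨h, rfl, rfl, hfix⟩ := exists_perm_pair (x := (⟨2, by omega⟩ : Fin n)) (y := ⟨3, h3⟩)
    (a := c) (b := d) (by simp) (by simpa [Fin.ext_iff] using hcd)
  have key : Commute (cross n ⟨0, by omega⟩ ⟨1, h1⟩) (cross n (h ⟨2, by omega⟩) (h ⟨3, h3⟩)) := by
    have e0 : h ⟨0, by omega⟩ = ⟨0, by omega⟩ :=
      hfix _ (by simp) (by simp) (by simpa [Fin.ext_iff] using hac)
        (by simpa [Fin.ext_iff] using had)
    have e1 : h ⟨1, by omega⟩ = ⟨1, by omega⟩ :=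
      hfix _ (by simp) (by simp) (by simpa [Fin.ext_iff] using hbc)
        (by simpa [Fin.ext_iff] using hbd)
    rw [show cross n ⟨0, by omega⟩ ⟨1, h1⟩ = cross n (h ⟨0, by omega⟩) (h ⟨1, h1⟩) by rw [e0, e1]]
    have hx := perm_mul_cross h ⟨0, by omega⟩ ⟨1, h1⟩
    have hy := perm_mul_cross h ⟨2, by omega⟩ ⟨3, h3⟩
    rw [← mul_inv_eq_iff_eq_mul] at hx hy
    rw [← hx, ← hy, Commute.conj_iff, cross_adj n 0 h1, cross_adj n 2 h3]
    exact Commute.mul_left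
      (Commute.mul_right (sig_comm _ _ _ (by omega)) (rho_sig_comm _ _ _ (by omega)).symm)
      (Commute.mul_right (rho_sig_comm _ _ _ (by omega)) (rho_comm _ _ _ (by omega)))
  have hx := perm_mul_cross g ⟨0, by omega⟩ ⟨1, h1⟩
  have hy := perm_mul_cross g (h ⟨2, by omega⟩) (h ⟨3, h3⟩)
  rw [← mul_inv_eq_iff_eq_mul] at hx hy
  rw [← hx, ← hy, Commute.conj_iff]
  exact key

end VT

/-! ### Markov classes of virtual twins -/

/-- The elementary moves between virtual twins: conjugation, and right stabilization of virtual
type. -/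
inductive MarkovStep : (Σ n, VT n) → (Σ n, VT n) → Prop
  | conj (n : ℕ) (u v : VT n) : MarkovStep ⟨n, u * v⟩ ⟨n, v * u⟩
  | stab (n : ℕ) (hn : 1 ≤ n) (β : VT n) :
      MarkovStep ⟨n, β⟩ ⟨n + 1, VT.addStrand n β * VT.ρLast n hn⟩

/-- The class of a virtual twin up to conjugation and right stabilization of virtual type. -/
def markovClass (n : ℕ) (β : VT n) : Quot MarkovStep := Quot.mk _ ⟨n, β⟩

theorem markovClass_mul_comm {n : ℕ} (u v : VT n) :
    markovClass n (u * v) = markovClass n (v * u) :=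
  Quot.sound (MarkovStep.conj n u v)

theorem markovClass_conj {n : ℕ} (g β : VT n) : markovClass n (g * β * g⁻¹) = markovClass n β := by
  rw [markovClass_mul_comm, inv_mul_cancel_left]

open VT in
/-- Stabilization at an arbitrary strand. -/
theorem markovClass_stab {n : ℕ} (β : VT n) (i : Fin n) :
    markovClass (n + 1) (addStrand n β * perm (n + 1) (swap i.castSucc (Fin.last n))) =
      markovClass n β := by
  have hn : 1 ≤ n := i.pos
  set j : Fin n := ⟨n - 1, by omega⟩
  -- conjugation moves the strand `i` to the last place `j`
  set g := perm n (swap j i)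
  have h1 : markovClass n β = markovClass n (g * β * g⁻¹) := (markovClass_conj g β).symm
  have h2 : markovClass n (g * β * g⁻¹) = markovClass (n + 1) _ :=
    Quot.sound (MarkovStep.stab n hn _)
  rw [h1, h2, ← markovClass_conj (addStrand n g)⁻¹ (addStrand n (g * β * g⁻¹) * ρLast n hn)]
  congr 1
  have h3 : ρLast n hn = perm (n + 1) (swap j.castSucc (Fin.last n)) := by
    rw [ρLast_eq_rho, ← perm_adjSwap, adjSwap, dif_pos (by omega)]
    congr 2
    simp [Fin.ext_iff]; omega
  have h4 : perm (n + 1) (swap i.castSucc (Fin.last n)) =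
      (addStrand n g)⁻¹ * perm (n + 1) (swap j.castSucc (Fin.last n)) * addStrand n g := by
    rw [addStrand_perm, ← map_inv, ← map_mul, ← map_mul]
    congr 1
    have := swap_apply_apply (extendLast n (swap j i))⁻¹ j.castSucc (Fin.last n)
    rw [inv_inv] at this
    rw [← this]
    congr 1
    · rw [eq_comm, Perm.inv_eq_iff_eq]; simp
    · rw [eq_comm, Perm.inv_eq_iff_eq]; simp
  rw [h4, h3, map_mul, map_mul, map_inv]
  group

/-! ### Strand systems -/

/-- The virtual twin given by a list of crossings between strands that are indexed by `X`, followed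
by the virtual crossings that realize the permutation `φ`: the strand `x` is continued by the
strand `φ x`. The strands are placed in the order given by `e`. -/
noncomputable def strandTwin {X : Type*} {n : ℕ} (e : X ≃ Fin n) (l : List (X × X)) (φ : Perm X) :
    VT n :=
  (l.map fun p => VT.cross n (e p.1) (e p.2)).prod * VT.perm n (e.permCongr φ⁻¹)

/-- Moving a permutation to the other side of a product of crossings relabels the strands. -/
theorem VT.perm_mul_prod_cross {X : Type*} {n : ℕ} (g : Perm (Fin n)) (e : X → Fin n)
    (l : List (X × X)) :
    VT.perm n g * (l.map fun p => VT.cross n (e p.1) (e p.2)).prod =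
      (l.map fun p => VT.cross n (g (e p.1)) (g (e p.2))).prod * VT.perm n g := by
  induction l with
  | nil => simp
  | cons p l ih =>
    simp only [List.map_cons, List.prod_cons]
    rw [← mul_assoc, VT.perm_mul_cross, mul_assoc, ih, mul_assoc]

theorem strandTwin_trans {X : Type*} {n : ℕ} (e : X ≃ Fin n) (g : Perm (Fin n)) (l : List (X × X))
    (φ : Perm X) :
    strandTwin (e.trans g) l φ = VT.perm n g * strandTwin e l φ * (VT.perm n g)⁻¹ := by
  have h := VT.perm_mul_prod_cross g e l
  have h2 : (e.trans g).permCongr φ⁻¹ = g * e.permCongr φ⁻¹ * g⁻¹ := by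
    ext i; simp
  rw [strandTwin, strandTwin, ← mul_assoc, h, h2, map_mul (VT.perm n), map_mul (VT.perm n),
    map_inv (VT.perm n) g]
  simp only [coe_trans, Function.comp_apply, mul_assoc]

/-- The Markov class of `strandTwin e l φ`, for any order `e` of the strands. -/
noncomputable def strandClass (X : Type*) [Finite X] (l : List (X × X)) (φ : Perm X) :
    Quot MarkovStep :=
  markovClass (Nat.card X) (strandTwin (Finite.equivFin X) l φ)

theorem markovClass_strandTwin {X : Type*} [Finite X] {n : ℕ} (e : X ≃ Fin n) (l : List (X × X))
    (φ : Perm X) : markovClass n (strandTwin e l φ) = strandClass X l φ := by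
  obtain rfl : n = Nat.card X := by simpa using (Nat.card_congr e).symm
  have h : e = (Finite.equivFin X).trans ((Finite.equivFin X).symm.trans e) := by
    ext x; simp
  rw [strandClass, h, strandTwin_trans, markovClass_conj]

theorem strandClass_congr {X Y : Type*} [Finite X] [Finite Y] (u : X ≃ Y) (l : List (X × X))
    (φ : Perm X) :
    strandClass Y (l.map (Prod.map u u)) (u.permCongr φ) = strandClass X l φ := by
  rw [← markovClass_strandTwin (u.trans (Finite.equivFin Y)),
    ← markovClass_strandTwin (Finite.equivFin Y)]
  congr 1
  simp only [strandTwin, List.map_map]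
  congr 2

/-- Two crossings without a common strand commute, so the order of a list of such crossings does
not matter. -/
theorem strandClass_perm {X : Type*} [Finite X] {l l' : List (X × X)} (φ : Perm X) (h : l.Perm l')
    (hl : l.Pairwise fun p q => p.1 ≠ q.1 ∧ p.1 ≠ q.2 ∧ p.2 ≠ q.1 ∧ p.2 ≠ q.2) :
    strandClass X l φ = strandClass X l' φ := by
  rw [strandClass, strandClass, strandTwin, strandTwin]
  congr 2
  refine (h.map _).prod_eq' ?_
  rw [List.pairwise_map]
  refine hl.imp fun ⟨h1, h2, h3, h4⟩ => VT.cross_commute ?_ ?_ ?_ ?_ <;> simpa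

/-- The permutation `φ` of `X` with a new point inserted between `a` and `φ a`. -/
noncomputable def insertAfter {X : Type*} (φ : Perm X) (a : X) : Perm (Option X) :=
  open Classical in optionCongr φ * swap (some a) none

section

variable {X : Type*} (φ : Perm X) (a : X)

@[simp] theorem insertAfter_self : insertAfter φ a (some a) = none := by
  simp [insertAfter]

@[simp] theorem insertAfter_none : insertAfter φ a none = some (φ a) := by
  simp [insertAfter]

theorem insertAfter_of_ne {x : X} (h : x ≠ a) : insertAfter φ a (some x) = some (φ x) := by
  classical
  rw [insertAfter, Perm.mul_apply, swap_apply_of_ne_of_ne (by simpa) (by simp)]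
  simp

/-- The order of `Option X` that places the new strand last. -/
def extendOrder {n : ℕ} (e : X ≃ Fin n) : Option X ≃ Fin (n + 1) :=
  (optionCongr e).trans finSuccEquivLast.symm

@[simp] theorem extendOrder_some {n : ℕ} (e : X ≃ Fin n) (x : X) :
    extendOrder e (some x) = (e x).castSucc := by simp [extendOrder]

@[simp] theorem extendOrder_none {n : ℕ} (e : X ≃ Fin n) :
    extendOrder e none = Fin.last n := by simp [extendOrder]

/-- Inserting a strand in a permutation adds one virtual stabilization. -/
theorem perm_insertAfter {n : ℕ} (e : X ≃ Fin n) :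
    VT.perm (n + 1) ((extendOrder e).permCongr (insertAfter φ a)⁻¹) =
      VT.perm (n + 1) (swap (e a).castSucc (Fin.last n)) *
        VT.addStrand n (VT.perm n (e.permCongr φ⁻¹)) := by
  classical
  rw [VT.addStrand_perm, ← map_mul]
  congr 1
  have h1 : (insertAfter φ a)⁻¹ = swap (some a) none * optionCongr φ⁻¹ := by
    rw [insertAfter, mul_inv_rev, swap_inv]; rfl
  rw [h1]
  ext i
  obtain ⟨x, rfl⟩ := (extendOrder e).surjective i
  rw [permCongr_apply, symm_apply_apply, Perm.mul_apply, Perm.mul_apply]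
  cases x with
  | none => simp
  | some x =>
    simp only [optionCongr_apply, Option.map_some, extendOrder_some, extendLast_castSucc,
      permCongr_apply, symm_apply_apply, swap_apply_def]
    split_ifs <;> simp_all

theorem prod_cross_some {n : ℕ} (e : X ≃ Fin n) (l : List (X × X)) :
    ((l.map (Prod.map some some)).map fun p : Option X × Option X =>
      VT.cross (n + 1) (extendOrder e p.1) (extendOrder e p.2)).prod =
      VT.addStrand n (l.map fun p => VT.cross n (e p.1) (e p.2)).prod := by
  rw [map_list_prod, List.map_map, List.map_map]
  congr 2
  ext p
  simp [VT.addStrand_cross]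

variable [Finite X]

/-- A strand without crossings can be inserted or deleted, unless it is a component. -/
theorem strandClass_insertAfter (l : List (X × X)) :
    strandClass (Option X) (l.map (Prod.map some some)) (insertAfter φ a) = strandClass X l φ := by
  set e := Finite.equivFin X
  rw [← markovClass_strandTwin (extendOrder e), ← markovClass_strandTwin e, strandTwin,
    perm_insertAfter, prod_cross_some, ← mul_assoc, markovClass_mul_comm, ← mul_assoc, ← map_mul,
    markovClass_stab, markovClass_mul_comm, strandTwin]

/-- A factor `y` is moved past the stabilizing transposition, where it becomes a virtual twin `x` on
the old strands; then the stabilization can be undone. -/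
theorem markovClass_slide {n : ℕ} (i : Fin n) (u x v : VT n) (y : VT (n + 1))
    (h : VT.perm (n + 1) (swap i.castSucc (Fin.last n)) * VT.addStrand n x =
      y * VT.perm (n + 1) (swap i.castSucc (Fin.last n))) :
    markovClass (n + 1) (VT.addStrand n u * y *
      (VT.perm (n + 1) (swap i.castSucc (Fin.last n)) * VT.addStrand n v)) =
      markovClass n (u * x * v) := by
  rw [mul_assoc, ← mul_assoc y, ← h, ← mul_assoc, mul_assoc, mul_assoc, ← map_mul, ← mul_assoc,
    markovClass_mul_comm, ← mul_assoc, ← map_mul, markovClass_stab, markovClass_mul_comm,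
    mul_assoc]

/-- The left end of the last crossing can be moved to a new strand. -/
theorem strandClass_slide_left (l : List (X × X)) {b : X} (hab : a ≠ b) :
    strandClass (Option X) (l.map (Prod.map some some) ++ [(none, some b)]) (insertAfter φ a) =
      strandClass X (l ++ [(a, b)]) φ := by
  set e := Finite.equivFin X
  rw [← markovClass_strandTwin (extendOrder e), ← markovClass_strandTwin e, strandTwin, strandTwin,
    perm_insertAfter, List.map_append, List.map_append, List.prod_append, List.prod_append,
    prod_cross_some, List.map_singleton, List.map_singleton, List.prod_singleton,
    List.prod_singleton]
  simp only [extendOrder_none, extendOrder_some]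
  refine markovClass_slide _ _ _ _ _ ?_
  rw [VT.addStrand_cross, VT.perm_mul_cross, swap_apply_left,
    swap_apply_of_ne_of_ne (by simpa using hab.symm) (Fin.castSucc_lt_last _).ne]

/-- The right end of the last crossing can be moved to a new strand. -/
theorem strandClass_slide_right (l : List (X × X)) {b : X} (hab : a ≠ b) :
    strandClass (Option X) (l.map (Prod.map some some) ++ [(some b, none)]) (insertAfter φ a) =
      strandClass X (l ++ [(b, a)]) φ := by
  set e := Finite.equivFin X
  rw [← markovClass_strandTwin (extendOrder e), ← markovClass_strandTwin e, strandTwin, strandTwin,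
    perm_insertAfter, List.map_append, List.map_append, List.prod_append, List.prod_append,
    prod_cross_some, List.map_singleton, List.map_singleton, List.prod_singleton,
    List.prod_singleton]
  simp only [extendOrder_none, extendOrder_some]
  refine markovClass_slide _ _ _ _ _ ?_
  rw [VT.addStrand_cross, VT.perm_mul_cross, swap_apply_left,
    swap_apply_of_ne_of_ne (by simpa using hab.symm) (Fin.castSucc_lt_last _).ne]

/-- A crossing without a strand in common with the others can be moved to the front. -/
theorem strandClass_rotate (l : List (X × X)) {x y : X}
    (h : ∀ p ∈ l, p.1 ≠ x ∧ p.1 ≠ y ∧ p.2 ≠ x ∧ p.2 ≠ y) :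
    strandClass X (l ++ [(x, y)]) φ = strandClass X ((x, y) :: l) φ := by
  rw [strandClass, strandClass, strandTwin, strandTwin]
  congr 2
  set e := Finite.equivFin X
  simp only [List.map_append, List.prod_append, List.map_cons, List.prod_cons, List.map_nil,
    List.prod_nil, mul_one]
  refine (Commute.list_prod_left _ _ fun z hz => ?_).eq
  obtain ⟨p, hp, rfl⟩ := List.mem_map.1 hz
  obtain ⟨h1, h2, h3, h4⟩ := h p hp
  exact VT.cross_commute (by simpa) (by simpa) (by simpa) (by simpa)

/-- The last crossing of a list can be moved to two new strands, which are inserted after its old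
strands, and then to the front. -/
theorem strandClass_detach (l : List (X × X)) {b : X} (hab : a ≠ b) :
    strandClass (Option (Option X))
      ((some none, none) :: l.map (Prod.map (some ∘ some) (some ∘ some)))
      (insertAfter (insertAfter φ a) (some b)) = strandClass X (l ++ [(a, b)]) φ := by
  rw [← strandClass_slide_left φ a l hab, ← strandClass_slide_right _ _ _ (by simp),
    ← strandClass_rotate]
  · simp [Prod.map_comp_map]
  · intro p hp
    obtain ⟨q, -, rfl⟩ := List.mem_map.1 hp
    simp

end

/-! ### Strand systems with the same Gauss data -/

/-- `Arc φ A x y` says that `y` is the first point of `A` that the orbit of `x` under `φ` reaches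
after leaving `x`. -/
inductive Arc {X : Type*} (φ : X → X) (A : Set X) : X → X → Prop
  | last (x : X) (h : φ x ∈ A) : Arc φ A x (φ x)
  | step (x y : X) (h : φ x ∉ A) (t : Arc φ A (φ x) y) : Arc φ A x y

/-- A strand system `φ` on `X` has Gauss data `g` and `m` components: the ends of the crossings are
points of `X`, given by `c`; going along the orbits of `φ` leads from the end `a` to the end `g a`;
and the cycles of `φ` are the fibres of `comp`. -/
structure HasGaussData {X C : Type*} (g : C → C) (m : ℕ) (φ : Perm X) (c : C → X)
    (comp : X → Fin m) : Prop where
  injective : Function.Injective c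
  arc : ∀ a, Arc φ (Set.range c) (c a) (c (g a))
  surjective : Function.Surjective comp
  comp_eq_iff : ∀ x y, comp x = comp y ↔ φ.SameCycle x y

theorem Equiv.Perm.SameCycle.map_of_forall {X Y : Type*} {ψ : Perm X} {φ : Perm Y} (f : X → Y)
    (hf : ∀ z, φ.SameCycle (f z) (f (ψ z))) {x y : X} (h : ψ.SameCycle x y) :
    φ.SameCycle (f x) (f y) := by
  obtain ⟨i, rfl⟩ := h
  induction i with
  | zero => exact Perm.SameCycle.refl _ _
  | succ i ih =>
    refine ih.trans ?_
    rw [add_comm, zpow_add, zpow_one, Perm.mul_apply]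
    exact hf _
  | pred i ih =>
    refine ih.trans ?_
    have := hf ((ψ ^ (-(i : ℤ) - 1)) x)
    rw [← Perm.mul_apply, ← zpow_one_add, add_sub_cancel] at this
    exact this.symm

/-- The new point belongs to the cycle of the point `a` after which it is inserted. -/
theorem sameCycle_insertAfter {X : Type*} (φ : Perm X) (a : X) (z w : Option X) :
    (insertAfter φ a).SameCycle z w ↔ φ.SameCycle (z.getD a) (w.getD a) := by
  have hn : (insertAfter φ a).SameCycle (some a) none := ⟨1, by simp⟩
  have hz : ∀ z : Option X, (insertAfter φ a).SameCycle z (some (z.getD a)) := by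
    rintro (_ | x)
    · exact hn.symm
    · exact Perm.SameCycle.refl _ _
  constructor
  · refine Perm.SameCycle.map_of_forall (fun z : Option X => z.getD a) fun z => ?_
    rcases z with _ | x
    · exact ⟨1, by simp⟩
    · rcases eq_or_ne x a with rfl | h
      · simpa using Perm.SameCycle.refl _ _
      · rw [insertAfter_of_ne φ a h]
        exact ⟨1, by simp⟩
  · intro h
    refine (hz z).trans (Perm.SameCycle.trans ?_ (hz w).symm)
    refine Perm.SameCycle.map_of_forall some (fun x => ?_) h
    rcases eq_or_ne x a with rfl | h
    · exact ⟨2, by simp [pow_two, zpow_ofNat]⟩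
    · exact ⟨1, by simp [insertAfter_of_ne φ a h]⟩

/-- Arcs that end at old points survive the deletion of the new point. -/
theorem Arc.of_insertAfter {X : Type*} {φ : Perm X} {a : X} {A : Set (Option X)}
    {z : Option X} {w : Option X} (h : Arc (insertAfter φ a) A z w) {y : X} (hy : w = some y) :
    Arc φ (some ⁻¹' A) (z.getD a) y := by
  induction h with
  | last z h =>
    rcases z with _ | x
    · simp only [insertAfter_none, Option.some.injEq] at hy h
      subst hy
      exact Arc.last _ h
    · rcases eq_or_ne x a with rfl | hx
      · simp at hy
      · simp only [insertAfter_of_ne φ a hx, Option.some.injEq] at hy h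
        subst hy
        exact Arc.last _ h
  | step z w h t ih =>
    have ih := ih hy
    rcases z with _ | x
    · simp only [insertAfter_none] at h ih
      exact Arc.step _ _ h ih
    · rcases eq_or_ne x a with rfl | hx
      · simpa using ih
      · simp only [insertAfter_of_ne φ a hx] at h ih
        exact Arc.step _ _ h ih

/-- A permutation of `Option X` arises by inserting `none`, unless `none` is a fixed point. -/
theorem exists_eq_insertAfter {X : Type*} {ψ : Perm (Option X)} (h : ψ none ≠ none) :
    ∃ (φ : Perm X) (a : X), ψ = insertAfter φ a := by
  obtain ⟨a, ha⟩ : ∃ a, ψ⁻¹ none = some a := by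
    rw [← Option.ne_none_iff_exists']
    intro h2
    rw [Perm.inv_eq_iff_eq] at h2
    exact h h2.symm
  have ha' : ψ (some a) = none := (Perm.inv_eq_iff_eq.1 ha).symm
  refine ⟨removeNone ψ, a, ?_⟩
  ext1 z
  rcases z with _ | x
  · rw [insertAfter_none]
    rw [removeNone_none ψ ha']
  · rcases eq_or_ne x a with rfl | hx
    · simpa
    · rw [insertAfter_of_ne _ _ hx]
      refine (removeNone_some ψ ?_).symm
      rw [← Option.ne_none_iff_exists']
      intro h2
      exact hx (Option.some_injective _ (ψ.injective (h2.trans ha'.symm)))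

theorem Arc.map_equiv {X Y : Type*} {φ : Perm X} {A : Set X} (u : X ≃ Y) {x y : X}
    (h : Arc φ A x y) : Arc (u.permCongr φ) (u '' A) (u x) (u y) := by
  induction h with
  | last x h =>
    have := Arc.last (φ := u.permCongr φ) (A := u '' A) (u x) (by simpa using h)
    simpa using this
  | step x y h t ih =>
    refine Arc.step _ _ (by simpa using h) ?_
    simpa using ih

theorem HasGaussData.map_equiv {X Y C : Type*} {g : C → C} {m : ℕ} {φ : Perm X} {c : C → X}
    {comp : X → Fin m} (h : HasGaussData g m φ c comp) (u : X ≃ Y) :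
    HasGaussData g m (u.permCongr φ) (u ∘ c) (comp ∘ u.symm) where
  injective := u.injective.comp h.injective
  arc a := by
    have := (h.arc a).map_equiv u
    rwa [← Set.range_comp] at this
  surjective := h.surjective.comp u.symm.surjective
  comp_eq_iff x y := by
    rw [Function.comp_apply, Function.comp_apply, h.comp_eq_iff]
    constructor
    · intro h
      have := Perm.SameCycle.map_of_forall (φ := u.permCongr φ) u (fun z => ⟨1, by simp⟩) h
      simpa using this
    · exact Perm.SameCycle.map_of_forall u.symm (fun z => ⟨1, by simp⟩)

theorem HasGaussData.of_insertAfter {X C : Type*} {g : C → C} {m : ℕ} {φ : Perm X} {a : X}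
    {c : C → X} {comp : Option X → Fin m}
    (h : HasGaussData g m (insertAfter φ a) (some ∘ c) comp) :
    HasGaussData g m φ c (comp ∘ some) where
  injective := h.injective.of_comp
  arc b := by
    have := (h.arc b).of_insertAfter rfl
    rwa [← Set.image_univ, Set.image_comp, Set.preimage_image_eq _ (Option.some_injective _),
      Set.image_univ] at this
  surjective j := by
    obtain ⟨_ | x, rfl⟩ := h.surjective j
    · exact ⟨a, (h.comp_eq_iff _ _).2 ⟨1, by simp⟩⟩
    · exact ⟨x, rfl⟩
  comp_eq_iff x y := by
    rw [Function.comp_apply, Function.comp_apply, h.comp_eq_iff, sameCycle_insertAfter]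
    rfl

/-- The list of the crossings `r ∈ L`, as pairs of ends. -/
def endPairs {X C : Type*} (c : C × Bool → X) (L : List C) : List (X × X) :=
  L.map fun r => (c (r, false), c (r, true))

/-- Deleting strands, every strand without ends of crossings can be made a component of its own. -/
theorem HasGaussData.exists_reduced {C : Type*} {g : C × Bool → C × Bool} {m : ℕ} (L : List C)
    {X : Type} [Finite X] {φ : Perm X} {c : C × Bool → X} {comp : X → Fin m}
    (h : HasGaussData g m φ c comp) :
    ∃ (Y : Type) (_ : Finite Y) (φ' : Perm Y) (c' : C × Bool → Y) (comp' : Y → Fin m),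
      HasGaussData g m φ' c' comp' ∧ (∀ y ∉ Set.range c', φ' y = y) ∧
      strandClass Y (endPairs c' L) φ' = strandClass X (endPairs c L) φ := by
  classical
  induction hN : Nat.card X generalizing X with
  | zero =>
    have : IsEmpty X := (Nat.card_eq_zero.1 hN).resolve_right (by simpa using ‹Finite X›)
    exact ⟨X, ‹_›, φ, c, comp, h, fun y => this.elim y, rfl⟩
  | succ N ih =>
    by_cases hf : ∀ y ∉ Set.range c, φ y = y
    · exact ⟨X, ‹_›, φ, c, comp, h, hf, rfl⟩
    push Not at hf
    obtain ⟨x, hx, hne⟩ := hf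
    -- the strand `x` has no ends of crossings and is not a component of its own: delete it
    set u := (optionSubtypeNe x).symm
    have hux : u x = none := optionSubtypeNe_symm_self x
    have hnone : u.permCongr φ none ≠ none := by
      rw [permCongr_apply, ← hux, symm_apply_apply]
      exact fun h2 => hne (u.injective h2)
    obtain ⟨φ', a, hφ'⟩ := exists_eq_insertAfter hnone
    have h2 := h.map_equiv u
    have hc : ∀ r, ∃ y, u (c r) = some y := fun r => by
      rw [← Option.ne_none_iff_exists', ← hux]
      exact fun h3 => hx ⟨r, u.injective h3⟩
    choose c' hc' using hc
    have hcomp : u ∘ c = some ∘ c' := funext hc'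
    rw [hφ', hcomp] at h2
    have h3 := h2.of_insertAfter
    have hcard : Nat.card {y // y ≠ x} = N := by
      have := Nat.card_congr u
      rw [hN, Finite.card_option] at this
      omega
    obtain ⟨Y, hY, φ'', c'', comp'', h4, h5, h6⟩ := ih h3 hcard
    refine ⟨Y, hY, φ'', c'', comp'', h4, h5, h6.trans ?_⟩
    rw [← strandClass_insertAfter φ' a, ← hφ', ← strandClass_congr u]
    congr 1
    simp only [endPairs, List.map_map]
    congr 1
    ext r : 1
    simp [hc']

theorem Arc.eq_of_fixed {X : Type*} {φ : Perm X} {A : Set X} (hA : ∀ x ∉ A, φ x = x) {x y : X}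
    (h : Arc φ A x y) (hx : x ∈ A) : φ x = y := by
  cases h with
  | last _ h => rfl
  | step _ _ h t => rw [φ.injective (hA _ h)] at h; exact absurd hx h

theorem card_range_eq_of_forall {A B : Type*} {f f' : A → B} (h : ∀ a b, f a = f b ↔ f' a = f' b) :
    Nat.card (Set.range f) = Nat.card (Set.range f') := by
  refine Nat.card_congr ((Setoid.quotientKerEquivRange f).symm.trans
    (Equiv.trans (Quotient.congrRight fun a b => ?_) (Setoid.quotientKerEquivRange f')))
  exact h a b

/-- Strand systems with the same Gauss data and the same number of components have the same
Markov class. -/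
theorem HasGaussData.strandClass_eq {C : Type*} [Finite C] {g : C × Bool → C × Bool} {m : ℕ}
    (L : List C)
    {X : Type} [Finite X] {φ : Perm X} {c : C × Bool → X} {comp : X → Fin m}
    (h : HasGaussData g m φ c comp)
    {X' : Type} [Finite X'] {φ' : Perm X'} {c' : C × Bool → X'} {comp' : X' → Fin m}
    (h' : HasGaussData g m φ' c' comp') :
    strandClass X (endPairs c L) φ = strandClass X' (endPairs c' L) φ' := by
  classical
  obtain ⟨Y, _, ψ, d, q, hd, hf, e⟩ := h.exists_reduced L
  obtain ⟨Y', _, ψ', d', q', hd', hf', e'⟩ := h'.exists_reduced L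
  rw [← e, ← e']
  have hψ : ∀ a, ψ (d a) = d (g a) := fun a => (hd.arc a).eq_of_fixed hf ⟨a, rfl⟩
  have hψ' : ∀ a, ψ' (d' a) = d' (g a) := fun a => (hd'.arc a).eq_of_fixed hf' ⟨a, rfl⟩
  have hpow : ∀ (i : ℕ) a, (ψ ^ i) (d a) = d (g^[i] a) := fun i => by
    induction i with
    | zero => simp
    | succ i ih => intro a; rw [pow_succ, Perm.mul_apply, hψ, ih]; rfl
  have hpow' : ∀ (i : ℕ) a, (ψ' ^ i) (d' a) = d' (g^[i] a) := fun i => by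
    induction i with
    | zero => simp
    | succ i ih => intro a; rw [pow_succ, Perm.mul_apply, hψ', ih]; rfl
  have hiff : ∀ a b, q (d a) = q (d b) ↔ q' (d' a) = q' (d' b) := by
    intro a b
    rw [hd.comp_eq_iff, hd'.comp_eq_iff]
    constructor
    · intro hs
      obtain ⟨i, hi⟩ := hs.exists_nat_pow_eq
      rw [hpow] at hi
      exact ⟨i, by rw [zpow_natCast, hpow', hd.injective hi]⟩
    · intro hs
      obtain ⟨i, hi⟩ := hs.exists_nat_pow_eq
      rw [hpow'] at hi
      exact ⟨i, by rw [zpow_natCast, hpow, hd'.injective hi]⟩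
  -- the strands without ends correspond to the components without crossings, so their number is
  -- determined by `m` and the Gauss data
  have key : ∀ {Y : Type} [Finite Y] {ψ : Perm Y} {d : C × Bool → Y} {q : Y → Fin m},
      HasGaussData g m ψ d q → (∀ y ∉ Set.range d, ψ y = y) →
      Nat.card ↥(Set.range d)ᶜ + Nat.card (Set.range fun a => q (d a)) = m := by
    intro Y _ ψ d q hd hf
    have hfix : ∀ x y, x ∉ Set.range d → q x = q y → x = y := fun x y hx hxy =>
      ((hd.comp_eq_iff _ _).1 hxy).eq_of_left (hf x hx)
    have e1 : ↥(Set.range d)ᶜ ≃ ↥(Set.range fun a => q (d a))ᶜ :=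
      Equiv.ofBijective (fun y => ⟨q y.1, by
          rintro ⟨a, ha⟩
          exact y.2 ⟨a, (hfix _ _ y.2 ha.symm).symm⟩⟩) (by
        constructor
        · intro x y hxy
          exact Subtype.ext (hfix _ _ x.2 (congrArg Subtype.val hxy))
        · rintro ⟨j, hj⟩
          obtain ⟨y, rfl⟩ := hd.surjective j
          refine ⟨⟨y, ?_⟩, rfl⟩
          rintro ⟨a, rfl⟩
          exact hj ⟨a, rfl⟩)
    rw [Nat.card_congr e1, ← Nat.card_sum, Nat.card_congr
      ((Equiv.sumComm _ _).trans (Equiv.Set.sumCompl _)), Nat.card_eq_fintype_card,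
      Fintype.card_fin]
  have hcard : Nat.card ↥(Set.range d)ᶜ = Nat.card ↥(Set.range d')ᶜ := by
    have h1 := key hd hf
    have h2 := key hd' hf'
    rw [card_range_eq_of_forall hiff] at h1
    omega
  set e1 : Set.range d ≃ Set.range d' :=
    (Equiv.ofInjective d hd.injective).symm.trans (Equiv.ofInjective d' hd'.injective)
  set e2 : ↥(Set.range d)ᶜ ≃ ↥(Set.range d')ᶜ := (Finite.card_eq.1 hcard).some
  set u : Y ≃ Y' := (Equiv.Set.sumCompl (Set.range d)).symm.trans
    ((Equiv.sumCongr e1 e2).trans (Equiv.Set.sumCompl (Set.range d')))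
  have hu : ∀ a, u (d a) = d' a := fun a => by
    simp only [u, Equiv.trans_apply, Equiv.Set.sumCompl_symm_apply_of_mem
      (show d a ∈ Set.range d from ⟨a, rfl⟩)]
    simp [e1]
  have hu' : ∀ y ∉ Set.range d, u y ∉ Set.range d' := fun y hy => by
    simp only [u, Equiv.trans_apply, Equiv.Set.sumCompl_symm_apply_of_notMem hy]
    exact (e2 ⟨y, hy⟩).2
  rw [← strandClass_congr u]
  congr 1
  · simp [endPairs, hu]
  · ext1 y'
    obtain ⟨y, rfl⟩ := u.surjective y'
    rw [permCongr_apply, symm_apply_apply]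
    by_cases hy : y ∈ Set.range d
    · obtain ⟨a, rfl⟩ := hy
      rw [hψ, hu, hu, hψ']
    · rw [hf y hy, hf' _ (hu' y hy)]

/-! ### Polar coordinates -/

theorem planeDet_eq_im (v w : ℂ) : planeDet v w = (starRingEnd ℂ v * w).im := by
  simp [planeDet]; ring

theorem planeDet_swap (v w : ℂ) : planeDet v w = -planeDet w v := by
  simp only [planeDet]; ring

theorem planeDet_mul_circle (v w : ℂ) (u : Circle) : planeDet (v * u) (w * u) = planeDet v w := by
  have h : starRingEnd ℂ (u : ℂ) * u = 1 := by
    rw [← Complex.normSq_eq_conj_mul_self]; simp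
  rw [planeDet_eq_im, planeDet_eq_im, map_mul, mul_mul_mul_comm, h, mul_one]

theorem planeDet_real_smul (a b : ℝ) (v w : ℂ) :
    planeDet (a * v) (b * w) = a * b * planeDet v w := by
  simp [planeDet]; ring

theorem norm_mul_radialProj (z : ℂ) : (‖z‖ : ℂ) * radialProj z = z := by
  rw [radialProj, Circle.coe_exp, Complex.norm_mul_exp_arg_mul_I]

theorem eq_of_radialProj_eq {z w : ℂ} (h : radialProj z = radialProj w) (hn : ‖z‖ = ‖w‖) :
    z = w := by
  rw [← norm_mul_radialProj z, ← norm_mul_radialProj w, h, hn]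

theorem radialProj_mul_circle {r : ℝ} (hr : 0 < r) (u : Circle) : radialProj (r * u) = u := by
  have h1 := norm_mul_radialProj (r * u : ℂ)
  rw [norm_mul, Circle.norm_coe, mul_one, Complex.norm_real, Real.norm_of_nonneg hr.le] at h1
  exact Circle.ext (mul_left_cancel₀ (by exact_mod_cast hr.ne') h1)

theorem Circle.exp_eq_exp_iff_of_lt {a b : ℝ} (h : |a - b| < 2 * Real.pi)
    (e : Circle.exp a = Circle.exp b) : a = b := by
  rw [Circle.exp_eq_exp] at e
  obtain ⟨m, hm⟩ := e
  have hpi := Real.two_pi_pos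
  rw [hm, add_sub_cancel_left, abs_mul, abs_of_pos hpi] at h
  have h1 : |(m : ℝ)| < 1 := by
    by_contra h2
    push Not at h2
    nlinarith
  have h2 : m = 0 := by
    rw [← Int.abs_lt_one_iff]
    exact_mod_cast h1
  rw [hm, h2]; simp

theorem angleFrom_mem (p : Circle) (c : ℂ) : angleFrom p c ∈ Set.Ico 0 (2 * Real.pi) := by
  have := toIcoMod_mem_Ico Real.two_pi_pos 0 (Complex.arg (c / p))
  rwa [zero_add] at this

theorem radialProj_eq_mul_exp_angleFrom (p : Circle) {c : ℂ} (hc : c ≠ 0) :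
    radialProj c = p * Circle.exp (angleFrom p c) := by
  have h1 : radialProj (c / p) = radialProj c * p⁻¹ := by
    conv_lhs => rw [← norm_mul_radialProj c, mul_div_assoc, ← Circle.coe_div]
    rw [radialProj_mul_circle (norm_pos_iff.2 hc), div_eq_mul_inv]
  have h2 : Circle.exp (angleFrom p c) = radialProj (c / p) := by
    rw [radialProj, Circle.exp_eq_exp]
    refine ⟨-toIcoDiv Real.two_pi_pos 0 (Complex.arg (c / p)), ?_⟩
    rw [angleFrom, toIcoMod, zsmul_eq_mul]
    push_cast
    ring
  rw [h2, h1, mul_comm, inv_mul_cancel_right]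

theorem angleFrom_eq {p : Circle} {c : ℂ} (hc : c ≠ 0) {θ : ℝ}
    (hθ : θ ∈ Set.Ico 0 (2 * Real.pi)) (h : radialProj c = p * Circle.exp θ) :
    angleFrom p c = θ := by
  rw [radialProj_eq_mul_exp_angleFrom p hc] at h
  have h1 := angleFrom_mem p c
  refine Circle.exp_eq_exp_iff_of_lt ?_ (mul_left_cancel h)
  rw [abs_lt]
  constructor <;> linarith [h1.1, h1.2, hθ.1, hθ.2]

/-! ### The strands of a sequence of crossings -/

/-- The position of the strands after the first `k` crossings, where the crossing with index `k`
swaps the positions `p k` and `p k + 1`. -/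
def strandPos (n : ℕ) (p : ℕ → ℕ) : ℕ → Perm (Fin n)
  | 0 => 1
  | k + 1 => adjSwap n (p k) * strandPos n p k

/-- The position at the time `t ∈ [0, 1]` of the strand that starts at the position `i`. It moves
from one integral position to the next during the `N` time slots between multiples of `1 / N`. -/
noncomputable def strandDepth (n N : ℕ) (p : ℕ → ℕ) (i : Fin n) (t : ℝ) : ℝ :=
  (i : ℝ) + ∑ k ∈ Finset.range N, ((strandPos n p (k + 1) i : ℝ) - (strandPos n p k i : ℝ)) *
    Real.smoothTransition (N * t - k)

section

variable {n N : ℕ} {p : ℕ → ℕ}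

theorem strandDepth_sum_of_le (i : Fin n) (s : ℝ) (M : ℕ) (h : (M : ℝ) ≤ s) :
    (i : ℝ) + ∑ k ∈ Finset.range M, ((strandPos n p (k + 1) i : ℝ) - (strandPos n p k i : ℝ)) *
      Real.smoothTransition (s - k) = strandPos n p M i := by
  induction M with
  | zero => simp [strandPos]
  | succ M ih =>
    push_cast at h
    rw [Finset.sum_range_succ, ← add_assoc, ih (by linarith),
      Real.smoothTransition.one_of_one_le (by linarith)]
    ring

theorem strandDepth_of_mem (i : Fin n) {t : ℝ} {m : ℕ} (hm : m < N) (h1 : (m : ℝ) ≤ N * t)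
    (h2 : N * t ≤ m + 1) :
    strandDepth n N p i t = strandPos n p m i +
      ((strandPos n p (m + 1) i : ℝ) - (strandPos n p m i : ℝ)) *
        Real.smoothTransition (N * t - m) := by
  rw [strandDepth, Finset.eventually_constant_sum (N := m + 1) _ (by omega), Finset.sum_range_succ,
    ← add_assoc, strandDepth_sum_of_le i _ m h1]
  intro k hk
  have : (m : ℝ) + 1 ≤ k := by exact_mod_cast hk
  rw [Real.smoothTransition.zero_of_nonpos (by linarith), mul_zero]

theorem strandDepth_of_nonpos (i : Fin n) {t : ℝ} (h : t ≤ 0) : strandDepth n N p i t = i := by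
  rw [strandDepth, Finset.sum_eq_zero, add_zero]
  intro k _
  rw [Real.smoothTransition.zero_of_nonpos, mul_zero]
  have : (0 : ℝ) ≤ k := by positivity
  have : (0 : ℝ) ≤ N := by positivity
  nlinarith

theorem strandDepth_of_one_le (i : Fin n) {t : ℝ} (h : 1 ≤ t) :
    strandDepth n N p i t = strandPos n p N i := by
  rw [strandDepth, strandDepth_sum_of_le]
  have : (0 : ℝ) ≤ N := by positivity
  nlinarith

theorem exists_slot {t : ℝ} (h0 : 0 < N) (h1 : 0 ≤ t) (h2 : t < 1) :
    ∃ m < N, (m : ℝ) ≤ N * t ∧ N * t < m + 1 := by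
  have hN : (0 : ℝ) < N := by exact_mod_cast h0
  refine ⟨⌊N * t⌋₊, ?_, Nat.floor_le (by positivity), Nat.lt_floor_add_one _⟩
  rw [Nat.floor_lt (by positivity)]
  nlinarith

/-- The depth is a convex combination of two positions in each time slot. -/
theorem strandDepth_le (i : Fin n) (h0 : 0 < N) (t : ℝ) : strandDepth n N p i t ≤ n - 1 := by
  have hb : ∀ j : Fin n, (j : ℝ) ≤ n - 1 := fun j => by
    have : (j.1 : ℝ) + 1 ≤ n := by exact_mod_cast j.2
    linarith
  rcases le_or_gt t 0 with h | h
  · rw [strandDepth_of_nonpos i h]; exact hb i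
  rcases le_or_gt 1 t with h' | h'
  · rw [strandDepth_of_one_le i h']; exact hb _
  obtain ⟨m, hm, h1, h2⟩ := exists_slot h0 h.le h'
  rw [strandDepth_of_mem i hm h1 h2.le]
  have h3 := hb (strandPos n p m i)
  have h4 := hb (strandPos n p (m + 1) i)
  have h5 := Real.smoothTransition.nonneg (N * t - m)
  have h6 := Real.smoothTransition.le_one (N * t - m)
  nlinarith

theorem contDiff_strandDepth (i : Fin n) : ContDiff ℝ ∞ (strandDepth n N p i) := by
  unfold strandDepth
  refine contDiff_const.add (ContDiff.sum fun k _ => contDiff_const.mul ?_)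
  exact Real.smoothTransition.contDiff.comp ((contDiff_const.mul contDiff_id).sub contDiff_const)

end

/-! ### The smooth transition function at its midpoint -/

theorem Real.smoothTransition_eq_half_iff {x : ℝ} :
    Real.smoothTransition x = 1 / 2 ↔ x = 1 / 2 := by
  have hd := Real.smoothTransition.pos_denom x
  rw [Real.smoothTransition, div_eq_iff hd.ne']
  constructor
  · intro h
    have h1 : expNegInvGlue x = expNegInvGlue (1 - x) := by linarith
    have h2 : 0 < expNegInvGlue x := by linarith
    have hx : 0 < x := by
      by_contra h3
      rw [expNegInvGlue.zero_of_nonpos (not_lt.1 h3)] at h2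
      exact lt_irrefl _ h2
    have hx' : 0 < 1 - x := by
      by_contra h3
      rw [h1, expNegInvGlue.zero_of_nonpos (not_lt.1 h3)] at h2
      exact lt_irrefl _ h2
    rw [expNegInvGlue, if_neg (not_le.2 hx), expNegInvGlue, if_neg (not_le.2 hx'),
      Real.exp_eq_exp, neg_inj, inv_inj] at h1
    linarith
  · rintro rfl
    norm_num
    ring

theorem Real.deriv_smoothTransition_half : 0 < deriv Real.smoothTransition (1 / 2) := by
  have hf : HasDerivAt expNegInvGlue (4 * Real.exp (-2)) (1 / 2) := by
    have h : HasDerivAt (fun x : ℝ => Real.exp (-x⁻¹)) (Real.exp (-(1 / 2 : ℝ)⁻¹) *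
        -(-((1 / 2 : ℝ) ^ 2)⁻¹)) (1 / 2) := ((hasDerivAt_inv (by norm_num)).neg).exp
    have e : expNegInvGlue =ᶠ[nhds (1 / 2)] fun x : ℝ => Real.exp (-x⁻¹) := by
      filter_upwards [lt_mem_nhds (by norm_num : (0 : ℝ) < 1 / 2)] with x hx
      rw [expNegInvGlue, if_neg (not_le.2 hx)]
    refine (h.congr_of_eventuallyEq e).congr_deriv ?_
    norm_num
    ring
  have hf' : HasDerivAt (fun x => expNegInvGlue (1 - x)) (-(4 * Real.exp (-2))) (1 / 2) := by
    have : HasDerivAt expNegInvGlue (4 * Real.exp (-2)) (1 - 1 / 2) := by norm_num; simpa using hf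
    simpa using this.comp_const_sub 1 (1 / 2)
  have hv : expNegInvGlue (1 / 2) = Real.exp (-2) := by
    rw [expNegInvGlue, if_neg (by norm_num)]; norm_num
  have hv' : expNegInvGlue (1 - 1 / 2) = Real.exp (-2) := by
    rw [← hv]; norm_num
  have h := hf.div (hf.add hf') (Real.smoothTransition.pos_denom _).ne'
  have h2 : HasDerivAt Real.smoothTransition _ (1 / 2) := h
  rw [h2.deriv]
  simp only [Pi.add_apply, hv, hv']
  have := Real.exp_pos (-2)
  apply div_pos _ (by positivity)
  nlinarith [mul_pos this this]

section

variable {n N : ℕ} {p : ℕ → ℕ}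

/-- Two strands meet only in the middle of a time slot in which they swap their positions. -/
theorem strandDepth_eq_imp (h0 : 0 < N) {i j : Fin n} (hij : i ≠ j) {t : ℝ} (ht0 : 0 ≤ t)
    (ht1 : t < 1) (h : strandDepth n N p i t = strandDepth n N p j t) :
    ∃ m < N, p m + 1 < n ∧ N * t = m + 1 / 2 ∧
      (((strandPos n p m i : ℕ) = p m ∧ (strandPos n p m j : ℕ) = p m + 1) ∨
        ((strandPos n p m j : ℕ) = p m ∧ (strandPos n p m i : ℕ) = p m + 1)) := by
  obtain ⟨m, hm, h1, h2⟩ := exists_slot h0 ht0 ht1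
  refine ⟨m, hm, ?_⟩
  rw [strandDepth_of_mem i hm h1 h2.le, strandDepth_of_mem j hm h1 h2.le] at h
  simp only [strandPos, Perm.mul_apply] at h
  set a := strandPos n p m i
  set b := strandPos n p m j
  have hab : a ≠ b := fun e => hij ((strandPos n p m).injective e)
  have h3 := Real.smoothTransition.nonneg (N * t - m)
  have h4 := Real.smoothTransition.lt_one_of_lt_one (by linarith : N * t - m < 1)
  have hhalf := Real.smoothTransition_eq_half_iff (x := N * t - m)
  set s := Real.smoothTransition (N * t - m)
  -- in the slot `m` a strand moves by `1`, `-1` or `0`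
  have hval : ∀ c : Fin n, ((adjSwap n (p m) c : ℕ) : ℝ) - (c : ℝ) =
      if p m + 1 < n then (if c.1 = p m then 1 else if c.1 = p m + 1 then -1 else 0) else 0 := by
    intro c
    rw [adjSwap_apply]
    split_ifs <;> simp_all
  rw [hval, hval] at h
  have hne : (a : ℕ) ≠ (b : ℕ) := fun e => hab (Fin.ext e)
  by_cases hp : p m + 1 < n
  swap
  · simp only [hp, if_false, zero_mul, add_zero] at h
    exact absurd (by exact_mod_cast h) hne
  refine ⟨hp, ?_⟩
  simp only [hp, if_true] at h
  have hs : s = 1 / 2 → N * t = m + 1 / 2 := fun e => by linarith [hhalf.1 e]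
  have hlt : ∀ c d : ℕ, c < d → (c : ℝ) + 1 ≤ d := fun c d h => by exact_mod_cast h
  have hlt2 : ∀ c d : ℕ, c ≠ d → (c : ℝ) + 1 ≤ d ∨ (d : ℝ) + 1 ≤ c := fun c d h => by
    rcases Nat.lt_or_gt_of_ne h with h | h
    exacts [Or.inl (hlt _ _ h), Or.inr (hlt _ _ h)]
  by_cases ha : (a : ℕ) = p m <;> by_cases hb : (b : ℕ) = p m
  · omega
  · by_cases hb' : (b : ℕ) = p m + 1
    · refine ⟨hs ?_, Or.inl ⟨ha, hb'⟩⟩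
      simp [ha, hb'] at h
      linarith
    · exfalso
      simp [ha, hb, hb'] at h
      rcases hlt2 _ _ hb with h5 | h5
      · linarith
      · have h6 := hlt (p m + 1) b (by have : p m < b := by exact_mod_cast h5
                                       omega)
        push_cast at h6
        linarith
  · by_cases ha' : (a : ℕ) = p m + 1
    · refine ⟨hs ?_, Or.inr ⟨hb, ha'⟩⟩
      simp [hb, ha'] at h
      linarith
    · exfalso
      simp [ha, hb, ha'] at h
      rcases hlt2 _ _ ha with h5 | h5
      · linarith
      · have h6 := hlt (p m + 1) a (by have : p m < a := by exact_mod_cast h5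
                                       omega)
        push_cast at h6
        linarith
  · exfalso
    by_cases ha' : (a : ℕ) = p m + 1 <;> by_cases hb' : (b : ℕ) = p m + 1
    · omega
    · simp [hb, ha', hb'] at h
      rcases hlt2 _ _ hb with h5 | h5
      · linarith
      · have h6 := hlt (p m + 1) b (by have : p m < b := by exact_mod_cast h5
                                       omega)
        push_cast at h6
        linarith
    · simp [ha, ha', hb'] at h
      rcases hlt2 _ _ ha with h5 | h5
      · linarith
      · have h6 := hlt (p m + 1) a (by have : p m < a := by exact_mod_cast h5
                                       omega)
        push_cast at h6
        linarith
    · simp [ha, hb, ha', hb'] at h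
      exact hab (Fin.ext h)

theorem hasDerivAt_strandDepth (i : Fin n) {m : ℕ} (hm : m < N) {t : ℝ}
    (ht : N * t = m + 1 / 2) :
    HasDerivAt (strandDepth n N p i)
      (((strandPos n p (m + 1) i : ℝ) - (strandPos n p m i : ℝ)) *
        (deriv Real.smoothTransition (1 / 2) * N)) t := by
  have e : strandDepth n N p i =ᶠ[nhds t] fun t => strandPos n p m i +
      ((strandPos n p (m + 1) i : ℝ) - (strandPos n p m i : ℝ)) *
        Real.smoothTransition (N * t - m) := by
    have hc : Continuous fun t : ℝ => N * t := by fun_prop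
    have h1 : ∀ᶠ t in nhds t, (m : ℝ) < N * t :=
      hc.continuousAt.eventually (lt_mem_nhds (by linarith))
    have h2 : ∀ᶠ t in nhds t, N * t < (m : ℝ) + 1 :=
      hc.continuousAt.eventually (gt_mem_nhds (by linarith))
    filter_upwards [h1, h2] with t h1 h2
    exact strandDepth_of_mem i hm h1.le h2.le
  have hl : HasDerivAt (fun t : ℝ => N * t - m) N t := by
    simpa using ((hasDerivAt_id t).const_mul (N : ℝ)).sub_const (m : ℝ)
  have hφ : HasDerivAt Real.smoothTransition (deriv Real.smoothTransition (1 / 2)) (N * t - m) := by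
    rw [show N * t - m = 1 / 2 by linarith]
    exact ((Real.smoothTransition.contDiff (n := 1)).differentiable (by simp) _).hasDerivAt
  exact (((hφ.comp t hl).const_mul _).const_add _).congr_of_eventuallyEq e

end

/-! ### The closed curves of a sequence of crossings -/

/-- The distance to the origin, at the time `t ∈ ℝ`, of the closed curve that starts at the
position `i` and makes one turn around the origin in each time unit. -/
noncomputable def curveRadius (n N : ℕ) (p : ℕ → ℕ) (i : Fin n) (t : ℝ) : ℝ :=
  n - strandDepth n N p ((strandPos n p N ^ ⌊t⌋) i) (Int.fract t)

/-- The closed curve that starts at the position `i`. -/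
noncomputable def curve (n N : ℕ) (p : ℕ → ℕ) (i : Fin n) (t : ℝ) : ℂ :=
  curveRadius n N p i t * Circle.exp (2 * Real.pi * t)

section

variable {n N : ℕ} {p : ℕ → ℕ}

theorem curveRadius_of_mem (i : Fin n) {t : ℝ} (h0 : 0 ≤ t) (h1 : t < 1) :
    curveRadius n N p i t = n - strandDepth n N p i t := by
  have h : ⌊t⌋ = 0 := Int.floor_eq_zero_iff.2 ⟨h0, h1⟩
  rw [curveRadius, h, Int.fract_eq_self.2 ⟨h0, h1⟩]
  simp

theorem one_le_curveRadius (h0 : 0 < N) (i : Fin n) (t : ℝ) : 1 ≤ curveRadius n N p i t := by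
  have := strandDepth_le (p := p) ((strandPos n p N ^ ⌊t⌋) i) h0 (Int.fract t)
  rw [curveRadius]
  linarith

theorem curveRadius_add_intCast (i : Fin n) (t : ℝ) (q : ℤ) :
    curveRadius n N p i (q + t) = curveRadius n N p ((strandPos n p N ^ q) i) t := by
  rw [curveRadius, curveRadius, Int.floor_intCast_add, Int.fract_intCast_add, add_comm q, zpow_add,
    Perm.mul_apply]

theorem curve_add_intCast (i : Fin n) (t : ℝ) (q : ℤ) :
    curve n N p i (q + t) = curve n N p ((strandPos n p N ^ q) i) t := by
  have h : Circle.exp (2 * Real.pi * (q + t)) = Circle.exp (2 * Real.pi * t) :=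
    Circle.exp_eq_exp.2 ⟨q, by ring⟩
  rw [curve, curve, curveRadius_add_intCast, h]

theorem contDiff_curveRadius (i : Fin n) : ContDiff ℝ ∞ (curveRadius n N p i) := by
  rw [contDiff_iff_contDiffAt]
  intro t
  set q := ⌊t⌋ with hq
  have hsub : ∀ a : ℤ, ∀ j : Fin n, ContDiff ℝ ∞ fun t : ℝ => strandDepth n N p j (t - a) :=
    fun a j => (contDiff_strandDepth j).comp (contDiff_id.sub contDiff_const)
  have hs : ContDiff ℝ ∞ fun t : ℝ => (n : ℝ) -
      (strandDepth n N p ((strandPos n p N ^ (q - 1)) i) (t - (q - 1 : ℤ)) +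
        strandDepth n N p ((strandPos n p N ^ q) i) (t - q) -
          ((strandPos n p N ^ q) i : ℝ)) :=
    contDiff_const.sub (((hsub _ _).add (hsub _ _)).sub contDiff_const)
  -- near `t`, the first or the second strand depth is constant and equals the third term
  refine hs.contDiffAt.congr_of_eventuallyEq ?_
  have h1 : ∀ᶠ s in nhds t, (q : ℝ) - 1 < s :=
    lt_mem_nhds (by have := Int.floor_le t; linarith)
  have h2 : ∀ᶠ s in nhds t, s < (q : ℝ) + 1 := gt_mem_nhds (Int.lt_floor_add_one t)
  filter_upwards [h1, h2] with s h1 h2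
  rw [curveRadius]
  congr 1
  rcases lt_or_ge s q with h | h
  · have hf : ⌊s⌋ = q - 1 := by
      rw [Int.floor_eq_iff]; push_cast; constructor <;> linarith
    rw [strandDepth_of_nonpos _ (by linarith : s - q ≤ 0), add_sub_cancel_right, hf,
      Int.fract, hf]
  · have hf : ⌊s⌋ = q := by
      rw [Int.floor_eq_iff]; constructor <;> linarith
    rw [strandDepth_of_one_le _ (by push_cast; linarith : 1 ≤ s - (q - 1 : ℤ)), ← Perm.mul_apply,
      ← zpow_one_add, add_sub_cancel, add_sub_cancel_left, hf, Int.fract, hf]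

theorem hasDerivAt_circleExp (t : ℝ) :
    HasDerivAt (fun t : ℝ => (Circle.exp (2 * Real.pi * t) : ℂ))
      (2 * Real.pi * Complex.I * Circle.exp (2 * Real.pi * t)) t := by
  have h : HasDerivAt (fun t : ℝ => ((2 * Real.pi * t : ℝ) : ℂ) * Complex.I)
      (2 * Real.pi * Complex.I) t := by
    have := ((hasDerivAt_id t).const_mul (2 * Real.pi)).ofReal_comp.mul_const Complex.I
    simpa using this
  simp only [Circle.coe_exp]
  rw [mul_comm (2 * (Real.pi : ℂ) * Complex.I)]
  exact h.cexp

theorem contDiff_curve (i : Fin n) : ContDiff ℝ ∞ (curve n N p i) := by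
  unfold curve
  refine (Complex.ofRealCLM.contDiff.comp (contDiff_curveRadius i)).mul ?_
  simp only [Circle.coe_exp]
  exact ((Complex.ofRealCLM.contDiff.comp (contDiff_const.mul contDiff_id)).mul
    contDiff_const).cexp

theorem hasDerivAt_curve (i : Fin n) (t : ℝ) :
    HasDerivAt (curve n N p i)
      (((deriv (curveRadius n N p i) t : ℝ) +
        (2 * Real.pi * curveRadius n N p i t : ℝ) * Complex.I) *
          Circle.exp (2 * Real.pi * t)) t := by
  have h1 := (((contDiff_curveRadius (N := N) (p := p) i).differentiable (by simp)) t).hasDerivAt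
  refine (h1.ofReal_comp.mul (hasDerivAt_circleExp t)).congr_deriv ?_
  push_cast
  ring

theorem radialProj_curve (h0 : 0 < N) (i : Fin n) (t : ℝ) :
    radialProj (curve n N p i t) = Circle.exp (2 * Real.pi * t) :=
  radialProj_mul_circle (by linarith [one_le_curveRadius (p := p) h0 i t]) _

theorem norm_curve (h0 : 0 < N) (i : Fin n) (t : ℝ) :
    ‖curve n N p i t‖ = curveRadius n N p i t := by
  rw [curve, norm_mul, Circle.norm_coe, mul_one, Complex.norm_real, Real.norm_of_nonneg]
  linarith [one_le_curveRadius (p := p) h0 i t]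

end

/-! ### Cycles of a permutation as circles -/

section Cycles

variable {n : ℕ} (σ : Perm (Fin n))

/-- The number of cycles of a permutation, fixed points included. -/
noncomputable def numCycles : ℕ := Nat.card (Quotient (Perm.SameCycle.setoid σ))

/-- The cycle that contains `i`. -/
noncomputable def cycleIndex (i : Fin n) : Fin (numCycles σ) :=
  Finite.equivFin (Quotient (Perm.SameCycle.setoid σ)) (Quotient.mk _ i)

/-- A chosen element of the cycle with the index `j`. -/
noncomputable def cycleBase (j : Fin (numCycles σ)) : Fin n :=
  ((Finite.equivFin (Quotient (Perm.SameCycle.setoid σ))).symm j).out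

/-- The length of the cycle with the index `j`. -/
noncomputable def cycleLength (j : Fin (numCycles σ)) : ℕ := MulAction.period σ (cycleBase σ j)

theorem cycleLength_pos (j : Fin (numCycles σ)) : 0 < cycleLength σ j :=
  MulAction.period_pos_of_orderOf_pos (orderOf_pos σ) _

theorem cycleIndex_cycleBase (j : Fin (numCycles σ)) : cycleIndex σ (cycleBase σ j) = j := by
  rw [cycleIndex, cycleBase, Quotient.out_eq]
  exact apply_symm_apply _ _

theorem cycleIndex_eq_iff (i j : Fin n) : cycleIndex σ i = cycleIndex σ j ↔ σ.SameCycle i j :=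
  (Finite.equivFin (Quotient (Perm.SameCycle.setoid σ))).injective.eq_iff.trans Quotient.eq

theorem zpow_cycleBase_eq_iff (j : Fin (numCycles σ)) (a b : ℤ) :
    (σ ^ a) (cycleBase σ j) = (σ ^ b) (cycleBase σ j) ↔ (cycleLength σ j : ℤ) ∣ a - b := by
  rw [cycleLength, ← MulAction.zpow_smul_eq_iff_period_dvd, sub_eq_neg_add, zpow_add, mul_smul,
    zpow_neg, inv_smul_eq_iff]
  rfl

theorem exists_zpow_cycleBase (i : Fin n) :
    ∃ q : ℤ, (σ ^ q) (cycleBase σ (cycleIndex σ i)) = i := by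
  obtain ⟨q, hq⟩ := (cycleIndex_eq_iff σ _ _).1 (cycleIndex_cycleBase σ (cycleIndex σ i))
  exact ⟨q, hq⟩

theorem cycleIndex_zpow_cycleBase (j : Fin (numCycles σ)) (q : ℤ) :
    cycleIndex σ ((σ ^ q) (cycleBase σ j)) = j := by
  conv_rhs => rw [← cycleIndex_cycleBase σ j]
  rw [cycleIndex_eq_iff]
  exact Perm.sameCycle_zpow_left.2 (Perm.SameCycle.refl σ _)

/-- The number of steps from the chosen element of the cycle of `i` to `i`. -/
noncomputable def cycleOffset (i : Fin n) : ℤ := (exists_zpow_cycleBase σ i).choose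

theorem zpow_cycleOffset (i : Fin n) :
    (σ ^ cycleOffset σ i) (cycleBase σ (cycleIndex σ i)) = i :=
  (exists_zpow_cycleBase σ i).choose_spec

/-- The point on the circles that belong to the cycles of `σ` that is reached from `i` after the
time `t`; the circle of a cycle is run through in a time that equals the length of the cycle. -/
noncomputable def cyclePoint (i : Fin n) (t : ℝ) : Fin (numCycles σ) × AddCircle (1 : ℝ) :=
  (cycleIndex σ i,
    (((cycleOffset σ i + t) / cycleLength σ (cycleIndex σ i) : ℝ) : AddCircle (1 : ℝ)))

theorem addCircle_coe_eq_iff (a b : ℝ) :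
    (a : AddCircle (1 : ℝ)) = b ↔ ∃ z : ℤ, a - b = z := by
  rw [QuotientAddGroup.eq_iff_sub_mem, AddSubgroup.mem_zmultiples_iff]
  simp [eq_comm]

theorem exists_cyclePoint_eq (x : Fin (numCycles σ) × AddCircle (1 : ℝ)) :
    ∃ (i : Fin n) (t : ℝ), 0 ≤ t ∧ t < 1 ∧ x = cyclePoint σ i t := by
  obtain ⟨j, a⟩ := x
  obtain ⟨s, rfl⟩ := QuotientAddGroup.mk_surjective a
  set d := cycleLength σ j
  have hd : (d : ℝ) ≠ 0 := by exact_mod_cast (cycleLength_pos σ j).ne'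
  have hj := cycleIndex_zpow_cycleBase σ j ⌊d * s⌋
  have hq := zpow_cycleOffset σ ((σ ^ ⌊d * s⌋) (cycleBase σ j))
  rw [hj, zpow_cycleBase_eq_iff] at hq
  obtain ⟨z, hz⟩ := hq
  refine ⟨(σ ^ ⌊d * s⌋) (cycleBase σ j), Int.fract (d * s), Int.fract_nonneg _,
    Int.fract_lt_one _, ?_⟩
  rw [cyclePoint, hj]
  congr 1
  refine (addCircle_coe_eq_iff _ _).2 ⟨-z, ?_⟩
  rw [eq_comm, eq_sub_iff_add_eq, ← eq_sub_iff_add_eq', div_eq_iff hd]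
  have hz' : ((cycleOffset σ ((σ ^ ⌊d * s⌋) (cycleBase σ j)) : ℝ)) = ⌊d * s⌋ + d * z := by
    rw [← sub_eq_iff_eq_add']; exact_mod_cast hz
  rw [hz', Int.fract]
  push_cast
  ring

theorem cyclePoint_injective (t : ℝ) : Function.Injective fun i => cyclePoint σ i t := by
  intro i i' h
  simp only [cyclePoint, Prod.mk.injEq] at h
  obtain ⟨h1, h2⟩ := h
  rw [← zpow_cycleOffset σ i, ← zpow_cycleOffset σ i', ← h1, zpow_cycleBase_eq_iff]
  rw [← h1] at h2
  set d := cycleLength σ (cycleIndex σ i)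
  have hd : (d : ℝ) ≠ 0 := by exact_mod_cast (cycleLength_pos σ _).ne'
  obtain ⟨z, hz⟩ := (addCircle_coe_eq_iff _ _).1 h2
  rw [← sub_div, div_eq_iff hd] at hz
  refine ⟨z, ?_⟩
  have : (cycleOffset σ i : ℝ) - cycleOffset σ i' = d * z := by linarith
  exact_mod_cast this

end Cycles

/-! ### The closed diagram of a sequence of crossings -/

section

variable (n N : ℕ) (p : ℕ → ℕ)

theorem periodic_curve (j : Fin (numCycles (strandPos n p N))) :
    Function.Periodic (fun t : ℝ => curve n N p (cycleBase (strandPos n p N) j)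
      (cycleLength (strandPos n p N) j * t)) 1 := by
  intro t
  have h : (strandPos n p N ^ (cycleLength (strandPos n p N) j : ℤ))
      (cycleBase (strandPos n p N) j) = cycleBase (strandPos n p N) j := by
    have := (zpow_cycleBase_eq_iff (strandPos n p N) j (cycleLength (strandPos n p N) j) 0).2
      (by simp)
    simpa using this
  have h2 := curve_add_intCast (N := N) (p := p) (cycleBase (strandPos n p N) j)
    (cycleLength (strandPos n p N) j * t) (cycleLength (strandPos n p N) j : ℤ)
  rw [h] at h2
  refine Eq.trans ?_ h2
  change curve _ _ _ _ _ = _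
  congr 1
  push_cast
  ring

/-- The closed curves of a sequence of crossings, one for each cycle of its permutation. -/
noncomputable def curveMap (x : Fin (numCycles (strandPos n p N)) × AddCircle (1 : ℝ)) : ℂ :=
  (periodic_curve n N p x.1).lift x.2

theorem curveMap_coe (j : Fin (numCycles (strandPos n p N))) (t : ℝ) :
    curveMap n N p (j, (t : AddCircle (1 : ℝ))) =
      curve n N p (cycleBase (strandPos n p N) j) (cycleLength (strandPos n p N) j * t) :=
  rfl

theorem curveMap_cyclePoint (i : Fin n) (t : ℝ) :
    curveMap n N p (cyclePoint (strandPos n p N) i t) = curve n N p i t := by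
  have hd : (cycleLength (strandPos n p N) (cycleIndex (strandPos n p N) i) : ℝ) ≠ 0 := by
    exact_mod_cast (cycleLength_pos _ _).ne'
  rw [cyclePoint, curveMap_coe, mul_div_cancel₀ _ hd, curve_add_intCast, zpow_cycleOffset]

theorem circleVelocity_curveMap (i : Fin n) (t : ℝ) :
    circleVelocity (curveMap n N p) (cyclePoint (strandPos n p N) i t) =
      (cycleLength (strandPos n p N) (cycleIndex (strandPos n p N) i) : ℝ) *
        deriv (curve n N p i) t := by
  obtain ⟨d, hd'⟩ : ∃ d : ℝ, d = cycleLength (strandPos n p N) (cycleIndex (strandPos n p N) i) :=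
    ⟨_, rfl⟩
  rw [← hd']
  have hd : d ≠ 0 := by rw [hd']; exact_mod_cast (cycleLength_pos _ _).ne'
  have h : (fun s : ℝ => curveMap n N p ((cyclePoint (strandPos n p N) i t).1,
      (cyclePoint (strandPos n p N) i t).2 + (s : AddCircle (1 : ℝ)))) =
      fun s => curve n N p i (t + d * s) := by
    funext s
    rw [cyclePoint, ← AddCircle.coe_add, curveMap_coe, ← hd', mul_add, mul_div_cancel₀ _ hd,
      add_assoc, curve_add_intCast, zpow_cycleOffset]
  rw [circleVelocity, h]
  have h1 : HasDerivAt (fun s : ℝ => t + d * s) d 0 := by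
    simpa using ((hasDerivAt_id (0 : ℝ)).const_mul d).const_add t
  have h2 := (hasDerivAt_curve (N := N) (p := p) i t).differentiableAt.hasDerivAt
  have h3 : HasDerivAt (curve n N p i) (deriv (curve n N p i) t) (t + d * 0) := by simpa using h2
  refine (h3.scomp (0 : ℝ) h1).deriv.trans ?_
  rw [Complex.real_smul]

/-- The crossing in the time slot `m`. -/
noncomputable def slotCrossing (m : ℕ) : ℂ :=
  ((n - p m - 1 / 2 : ℝ) : ℂ) * Circle.exp (2 * Real.pi * ((m + 1 / 2) / N))

variable {n N p}

theorem planeDet_curve_deriv (h0 : 0 < N) (i : Fin n) (t : ℝ) :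
    0 < planeDet (curve n N p i t) (deriv (curve n N p i) t) := by
  have h := one_le_curveRadius (p := p) h0 i t
  rw [(hasDerivAt_curve i t).deriv, curve, planeDet_mul_circle]
  simp only [planeDet, Complex.ofReal_re, Complex.ofReal_im, Complex.add_im, Complex.mul_im,
    Complex.I_re, Complex.I_im]
  have := Real.pi_pos
  norm_num
  positivity

theorem planeDet_deriv_curve (i i' : Fin n) (t : ℝ)
    (h : curveRadius n N p i t = curveRadius n N p i' t) :
    planeDet (deriv (curve n N p i) t) (deriv (curve n N p i') t) =
      2 * Real.pi * curveRadius n N p i t *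
        (deriv (curveRadius n N p i) t - deriv (curveRadius n N p i') t) := by
  rw [(hasDerivAt_curve i t).deriv, (hasDerivAt_curve i' t).deriv, planeDet_mul_circle, ← h]
  simp only [planeDet, Complex.add_re, Complex.ofReal_re, Complex.ofReal_im, Complex.add_im,
    Complex.mul_im, Complex.mul_re, Complex.I_re, Complex.I_im]
  ring

theorem deriv_curveRadius (i : Fin n) {m : ℕ} (hm : m < N) {t : ℝ} (ht0 : 0 < t) (ht1 : t < 1)
    (ht : N * t = m + 1 / 2) :
    deriv (curveRadius n N p i) t = -(((strandPos n p (m + 1) i : ℝ) - (strandPos n p m i : ℝ)) *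
        (deriv Real.smoothTransition (1 / 2) * N)) := by
  have e : curveRadius n N p i =ᶠ[nhds t] fun t => n - strandDepth n N p i t := by
    filter_upwards [lt_mem_nhds ht0, gt_mem_nhds ht1] with s h0 h1
    exact curveRadius_of_mem i h0.le h1
  exact (((hasDerivAt_strandDepth i hm ht).const_sub _).congr_of_eventuallyEq e).deriv

theorem eq_of_curve_eq (h0 : 0 < N) {i i' : Fin n} {t t' : ℝ} (ht : t ∈ Set.Ico (0 : ℝ) 1)
    (ht' : t' ∈ Set.Ico (0 : ℝ) 1)
    (h : radialProj (curve n N p i t) = radialProj (curve n N p i' t')) : t = t' := by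
  rw [radialProj_curve h0, radialProj_curve h0] at h
  have hpi := Real.two_pi_pos
  have := Circle.exp_eq_exp_iff_of_lt (by
    rw [← mul_sub, abs_mul, abs_of_pos hpi]
    have : |t - t'| < 1 := by rw [abs_lt]; constructor <;> linarith [ht.1, ht.2, ht'.1, ht'.2]
    nlinarith) h
  exact mul_left_cancel₀ hpi.ne' this

/-- Two different points of the curves that coincide in the plane lie on strands that swap their
positions in some time slot. -/
theorem exists_slot_of_curveMap_eq (h0 : 0 < N)
    {x y : Fin (numCycles (strandPos n p N)) × AddCircle (1 : ℝ)} (hxy : x ≠ y)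
    (h : curveMap n N p x = curveMap n N p y) :
    ∃ m < N, p m + 1 < n ∧ ∃ (i i' : Fin n) (t : ℝ), t ∈ Set.Ioo (0 : ℝ) 1 ∧ N * t = m + 1 / 2 ∧
      x = cyclePoint (strandPos n p N) i t ∧ y = cyclePoint (strandPos n p N) i' t ∧
      (((strandPos n p m i : ℕ) = p m ∧ (strandPos n p m i' : ℕ) = p m + 1) ∨
        ((strandPos n p m i' : ℕ) = p m ∧ (strandPos n p m i : ℕ) = p m + 1)) := by
  obtain ⟨i, t, ht0, ht1, rfl⟩ := exists_cyclePoint_eq _ x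
  obtain ⟨i', t', ht0', ht1', rfl⟩ := exists_cyclePoint_eq _ y
  rw [curveMap_cyclePoint, curveMap_cyclePoint] at h
  obtain rfl := eq_of_curve_eq h0 ⟨ht0, ht1⟩ ⟨ht0', ht1'⟩ (congrArg radialProj h)
  have hii : i ≠ i' := by rintro rfl; exact hxy rfl
  have h2 := congrArg norm h
  rw [norm_curve h0, norm_curve h0, curveRadius_of_mem _ ht0 ht1, curveRadius_of_mem _ ht0 ht1,
    sub_right_inj] at h2
  obtain ⟨m, hm, hp, hNt, hor⟩ := strandDepth_eq_imp h0 hii ht0 ht1 h2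
  refine ⟨m, hm, hp, i, i', t, ⟨?_, ht1⟩, hNt, rfl, rfl, hor⟩
  have hN : (0 : ℝ) < N := by exact_mod_cast h0
  have hm0 : (0 : ℝ) ≤ m := by positivity
  by_contra hneg
  nlinarith

theorem slot_time (hN : 0 < N) {m : ℕ} {t : ℝ} (h : N * t = m + 1 / 2) :
    t = (m + 1 / 2) / N := by
  rw [eq_div_iff (by exact_mod_cast hN.ne'), mul_comm, h]

theorem curveRadius_slot {i : Fin n} {m : ℕ} (hm : m < N) (hp : p m + 1 < n) {t : ℝ}
    (ht0 : 0 ≤ t) (ht1 : t < 1) (hNt : N * t = m + 1 / 2) :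
    curveRadius n N p i t = n - (strandPos n p m i : ℝ) -
      if (strandPos n p m i : ℕ) = p m then 1 / 2 else
        if (strandPos n p m i : ℕ) = p m + 1 then - 1 / 2 else 0 := by
  rw [curveRadius_of_mem _ ht0 ht1, strandDepth_of_mem i hm (by linarith) (by linarith),
    show N * t - m = 1 / 2 by linarith, Real.smoothTransition_eq_half_iff.2 rfl, strandPos,
    Perm.mul_apply, adjSwap_apply, dif_pos hp]
  split_ifs with h1 h2
  · rw [h1]; push_cast; ring
  · rw [h2]; push_cast; ring
  · ring

end

section

variable {n N : ℕ} {p : ℕ → ℕ}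

theorem curve_slot {i : Fin n} {m : ℕ} (hm : m < N) (hp : p m + 1 < n) {t : ℝ}
    (ht : t ∈ Set.Ioo (0 : ℝ) 1) (hNt : N * t = m + 1 / 2)
    (hi : (strandPos n p m i : ℕ) = p m ∨ (strandPos n p m i : ℕ) = p m + 1) :
    curve n N p i t = slotCrossing n N p m := by
  have e : curveRadius n N p i t = n - p m - 1 / 2 := by
    rw [curveRadius_slot hm hp ht.1.le ht.2 hNt]
    rcases hi with hi | hi
    · simp [hi]
    · simp [hi]; ring
  rw [curve, slotCrossing, ← slot_time (by omega) hNt, e]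

theorem slot_time_mem {m : ℕ} (hm : m < N) :
    ((m + 1 / 2 : ℝ) / N) ∈ Set.Ioo (0 : ℝ) 1 ∧ (N : ℝ) * ((m + 1 / 2) / N) = m + 1 / 2 := by
  have hN : (0 : ℝ) < N := by exact_mod_cast (by omega : 0 < N)
  have hm' : (m : ℝ) + 1 ≤ N := by exact_mod_cast hm
  refine ⟨⟨by positivity, ?_⟩, mul_div_cancel₀ _ hN.ne'⟩
  rw [div_lt_one hN]
  linarith

theorem mem_crossingSet_curveMap (h0 : 0 < N) (c : ℂ) :
    c ∈ crossingSet (curveMap n N p) ↔ ∃ m < N, p m + 1 < n ∧ c = slotCrossing n N p m := by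
  constructor
  · rintro ⟨x, y, hxy, rfl, h⟩
    obtain ⟨m, hm, hp, i, i', t, ht, hNt, rfl, -, hor⟩ := exists_slot_of_curveMap_eq h0 hxy h.symm
    refine ⟨m, hm, hp, ?_⟩
    rw [curveMap_cyclePoint, curve_slot hm hp ht hNt (by tauto)]
  · rintro ⟨m, hm, hp, rfl⟩
    obtain ⟨ht, hNt⟩ := slot_time_mem hm
    refine ⟨cyclePoint _ ((strandPos n p m).symm ⟨p m, by omega⟩) ((m + 1 / 2) / N),
      cyclePoint _ ((strandPos n p m).symm ⟨p m + 1, hp⟩) ((m + 1 / 2) / N), ?_, ?_, ?_⟩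
    · intro h
      have := (strandPos n p m).symm.injective (cyclePoint_injective _ _ h)
      simp at this
    · rw [curveMap_cyclePoint, curve_slot hm hp ht hNt (by simp)]
    · rw [curveMap_cyclePoint, curve_slot hm hp ht hNt (by simp)]

theorem slotCrossing_radius_pos {m : ℕ} (hp : p m + 1 < n) : (0 : ℝ) < n - p m - 1 / 2 := by
  have : (p m : ℝ) + 1 + 1 ≤ n := by exact_mod_cast hp
  linarith

theorem radialProj_slotCrossing {m : ℕ} (hp : p m + 1 < n) :
    radialProj (slotCrossing n N p m) = Circle.exp (2 * Real.pi * ((m + 1 / 2) / N)) :=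
  radialProj_mul_circle (slotCrossing_radius_pos hp) _

theorem eq_of_radialProj_slotCrossing {m m' : ℕ} (hm : m < N) (hm' : m' < N) (hp : p m + 1 < n)
    (hp' : p m' + 1 < n)
    (h : radialProj (slotCrossing n N p m) = radialProj (slotCrossing n N p m')) : m = m' := by
  rw [radialProj_slotCrossing hp, radialProj_slotCrossing hp'] at h
  obtain ⟨h1, h2⟩ := slot_time_mem hm
  obtain ⟨h1', h2'⟩ := slot_time_mem hm'
  have hpi := Real.two_pi_pos
  have h3 := Circle.exp_eq_exp_iff_of_lt (by
    rw [← mul_sub, abs_mul, abs_of_pos hpi]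
    refine mul_lt_of_lt_one_right hpi ?_
    rw [abs_lt]; constructor <;> linarith [h1.1, h1.2, h1'.1, h1'.2]) h
  have h4 := mul_left_cancel₀ hpi.ne' h3
  rw [h4, h2'] at h2
  have : (m : ℝ) = m' := by linarith
  exact_mod_cast this

theorem isCoveringMap_curveMap (h0 : 0 < N) :
    IsCoveringMap fun x => radialProj (curveMap n N p x) := by
  rw [← isLocalHomeomorph_iff_isCoveringMap, isLocalHomeomorph_iff_isLocalHomeomorphOn_univ]
  have key : ∀ j, IsLocalHomeomorph fun x : AddCircle (1 : ℝ) =>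
      radialProj (curveMap n N p (j, x)) := by
    intro j
    set d := cycleLength (strandPos n p N) j
    have hd : NeZero d := ⟨(cycleLength_pos _ j).ne'⟩
    have e : (fun x : AddCircle (1 : ℝ) => radialProj (curveMap n N p (j, x))) =
        (AddCircle.homeomorphCircle one_ne_zero) ∘ fun x : AddCircle (1 : ℝ) => d • x := by
      funext x
      obtain ⟨t, rfl⟩ := QuotientAddGroup.mk_surjective x
      rw [Function.comp_apply, AddCircle.homeomorphCircle_apply, AddCircle.toCircle_nsmul]
      rw [AddCircle.toCircle_apply_mk, curveMap_coe, radialProj_curve h0, ← Circle.exp_nsmul]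
      congr 1
      simp only [nsmul_eq_mul]
      ring
    rw [e]
    exact (Homeomorph.isLocalHomeomorph _).comp
      (AddCircle.isAddQuotientCoveringMap_nsmul_of_ne_zero
        (𝕜 := ℝ) 1 d).isCoveringMap.isLocalHomeomorph
  intro x _
  have hemb : Topology.IsOpenEmbedding fun a : AddCircle (1 : ℝ) => (x.1, a) := by
    refine ⟨isEmbedding_prodMkRight x.1, ?_⟩
    have : Set.range (fun a : AddCircle (1 : ℝ) => (x.1, a)) = {x.1} ×ˢ Set.univ := by
      ext y; simp [Prod.ext_iff, eq_comm]
    rw [this]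
    exact (isOpen_discrete _).prod isOpen_univ
  have h1 : IsLocalHomeomorphOn ((fun y => radialProj (curveMap n N p y)) ∘
      fun a : AddCircle (1 : ℝ) => (x.1, a)) Set.univ := (key x.1).isLocalHomeomorphOn
  exact h1.of_comp_right hemb.isLocalHomeomorph.isLocalHomeomorphOn x ⟨x.2, trivial, rfl⟩

theorem setOf_radialProj_curveMap (h0 : 0 < N) {t : ℝ} (ht : t ∈ Set.Ico (0 : ℝ) 1) :
    {x | radialProj (curveMap n N p x) = Circle.exp (2 * Real.pi * t)} =
      Set.range fun i => cyclePoint (strandPos n p N) i t := by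
  ext x
  constructor
  · intro h
    obtain ⟨i, t', h1, h2, rfl⟩ := exists_cyclePoint_eq _ x
    have h3 : radialProj (curveMap n N p (cyclePoint (strandPos n p N) i t')) =
      Circle.exp (2 * Real.pi * t) := h
    rw [curveMap_cyclePoint, ← radialProj_curve (p := p) h0 i] at h3
    obtain rfl := eq_of_curve_eq h0 ⟨h1, h2⟩ ht h3
    exact ⟨i, rfl⟩
  · rintro ⟨i, rfl⟩
    change radialProj _ = _
    rw [curveMap_cyclePoint, radialProj_curve h0]

theorem exists_circle_exp_eq (u : Circle) :
    ∃ t ∈ Set.Ico (0 : ℝ) 1, Circle.exp (2 * Real.pi * t) = u := by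
  have hpi := Real.two_pi_pos
  have h := angleFrom_mem 1 u
  refine ⟨angleFrom 1 u / (2 * Real.pi), ⟨div_nonneg h.1 hpi.le, (div_lt_one hpi).2 h.2⟩, ?_⟩
  rw [mul_div_cancel₀ _ hpi.ne', ← one_mul (Circle.exp _),
    ← radialProj_eq_mul_exp_angleFrom 1 (Circle.coe_ne_zero u)]
  have := radialProj_mul_circle one_pos u
  rwa [Complex.ofReal_one, one_mul] at this

theorem circleVelocity_curveMap_ne_zero (h0 : 0 < N)
    (x : Fin (numCycles (strandPos n p N)) × AddCircle (1 : ℝ)) :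
    circleVelocity (curveMap n N p) x ≠ 0 := by
  intro hx
  obtain ⟨i, t, -, -, rfl⟩ := exists_cyclePoint_eq _ x
  have := planeDet_curve_deriv (p := p) h0 i t
  rw [circleVelocity_curveMap] at hx
  rcases mul_eq_zero.1 hx with hx | hx
  · exact (cycleLength_pos (strandPos n p N) _).ne' (by exact_mod_cast hx)
  · rw [hx] at this
    simp [planeDet] at this

theorem planeDet_circleVelocity_curveMap_ne_zero (h0 : 0 < N)
    {x y : Fin (numCycles (strandPos n p N)) × AddCircle (1 : ℝ)} (hxy : x ≠ y)
    (h : curveMap n N p x = curveMap n N p y) :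
    planeDet (circleVelocity (curveMap n N p) x) (circleVelocity (curveMap n N p) y) ≠ 0 := by
  obtain ⟨m, hm, hp, i, i', t, ht, hNt, rfl, rfl, hor⟩ := exists_slot_of_curveMap_eq h0 hxy h
  rw [curveMap_cyclePoint, curveMap_cyclePoint] at h
  have h2 := congrArg norm h
  rw [norm_curve h0, norm_curve h0] at h2
  rw [circleVelocity_curveMap, circleVelocity_curveMap, planeDet_real_smul,
    planeDet_deriv_curve i i' t h2, deriv_curveRadius i hm ht.1 ht.2 hNt,
    deriv_curveRadius i' hm ht.1 ht.2 hNt]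
  have hd : ∀ j, (cycleLength (strandPos n p N) j : ℝ) ≠ 0 := fun j => by
    exact_mod_cast (cycleLength_pos _ j).ne'
  have hφ := Real.deriv_smoothTransition_half.ne'
  generalize deriv Real.smoothTransition (1 / 2) = D at hφ ⊢
  have hR := one_le_curveRadius (p := p) h0 i t
  refine mul_ne_zero (mul_ne_zero (hd _) (hd _)) (mul_ne_zero (by positivity) ?_)
  simp only [strandPos, Perm.mul_apply, adjSwap_apply, dif_pos hp]
  rcases hor with ⟨h3, h4⟩ | ⟨h3, h4⟩ <;> simp only [h3, h4] <;> simp <;> ring_nf <;>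
    simp [hφ, h0.ne']

theorem curveMap_noTriple (h0 : 0 < N)
    {x y z : Fin (numCycles (strandPos n p N)) × AddCircle (1 : ℝ)} (hxy : x ≠ y) (hyz : y ≠ z)
    (hxz : x ≠ z) : ¬ (curveMap n N p x = curveMap n N p y ∧
      curveMap n N p y = curveMap n N p z) := by
  intro h
  obtain ⟨m, hm, hp, i, i', t, ht, hNt, rfl, rfl, hor⟩ := exists_slot_of_curveMap_eq h0 hxy h.1
  obtain ⟨m', hm', hp', j, j', t', ht', hNt', h1, rfl, hor'⟩ :=
    exists_slot_of_curveMap_eq h0 hxz (h.1.trans h.2)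
  have h2 := h.1.trans h.2
  rw [curveMap_cyclePoint, curveMap_cyclePoint] at h2
  obtain rfl := eq_of_curve_eq h0 ⟨ht.1.le, ht.2⟩ ⟨ht'.1.le, ht'.2⟩ (congrArg radialProj h2)
  obtain rfl := cyclePoint_injective _ _ h1
  obtain rfl : m = m' := by
    rw [hNt] at hNt'
    have : (m : ℝ) = m' := by linarith
    exact_mod_cast this
  have h3 : i' ≠ j' := by rintro rfl; exact hyz rfl
  apply h3
  apply (strandPos n p m).injective
  apply Fin.ext
  omega

theorem contDiff_curveMap (j : Fin (numCycles (strandPos n p N))) :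
    ContDiff ℝ ∞ fun t : ℝ => curveMap n N p (j, (t : AddCircle (1 : ℝ))) := by
  simp only [curveMap_coe]
  exact (contDiff_curve _).comp (contDiff_const.mul contDiff_id)

variable (n N p)

/-- The closed virtual twin diagram of degree `n` in which the `m`-th crossing, if `m < N` and
`p m + 1 < n`, is a crossing of the strands at the positions `p m` and `p m + 1`. It is real if
`R m` holds. -/
noncomputable def slotDiagram (h0 : 0 < N) (R : ℕ → Prop) : ClosedVirtualTwinDiagram where
  numComponents := numCycles (strandPos n p N)
  map := curveMap n N p
  smooth := contDiff_curveMap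
  immersion := circleVelocity_curveMap_ne_zero h0
  transverse _ _ := planeDet_circleVelocity_curveMap_ne_zero h0
  noTriple _ _ _ := curveMap_noTriple h0
  finite_crossings := by
    refine ((Finset.range N).finite_toSet.image (slotCrossing n N p)).subset fun c hc => ?_
    obtain ⟨m, hm, -, rfl⟩ := (mem_crossingSet_curveMap h0 c).1 hc
    exact ⟨m, by simpa using hm, rfl⟩
  real := {c | ∃ m < N, p m + 1 < n ∧ R m ∧ c = slotCrossing n N p m}
  real_subset := by
    rintro c ⟨m, hm, hp, -, rfl⟩
    exact (mem_crossingSet_curveMap h0 _).2 ⟨m, hm, hp, rfl⟩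
  degree := n
  outside x := by
    obtain ⟨i, t, -, -, rfl⟩ := exists_cyclePoint_eq _ x
    rw [curveMap_cyclePoint, norm_curve h0]
    exact one_le_curveRadius h0 i t
  covering := isCoveringMap_curveMap h0
  fold u := by
    obtain ⟨t, ht, rfl⟩ := exists_circle_exp_eq u
    rw [setOf_radialProj_curveMap h0 ht, ← Set.image_univ,
      (cyclePoint_injective _ t).injOn.encard_image, Set.encard_univ]
    simp
  oriented x := by
    obtain ⟨i, t, -, -, rfl⟩ := exists_cyclePoint_eq _ x
    rw [curveMap_cyclePoint, circleVelocity_curveMap, ← one_mul (curve n N p i t),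
      ← Complex.ofReal_one, planeDet_real_smul]
    have : (0 : ℝ) < cycleLength (strandPos n p N) (cycleIndex (strandPos n p N) i) := by
      exact_mod_cast cycleLength_pos _ _
    have := planeDet_curve_deriv (p := p) h0 i t
    positivity
  crossings_injOn := by
    intro c hc c' hc' h
    obtain ⟨m, hm, hp, rfl⟩ := (mem_crossingSet_curveMap h0 c).1 hc
    obtain ⟨m', hm', hp', rfl⟩ := (mem_crossingSet_curveMap h0 c').1 hc'
    rw [eq_of_radialProj_slotCrossing hm hm' hp hp' h]

end

/-! ### Closures of words -/

namespace VTGen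

/-- The position of the left strand of a generator. -/
def index {n : ℕ} : VTGen n → ℕ
  | s i => i
  | ρ i => i

theorem index_lt {n : ℕ} (g : VTGen n) : g.index + 1 < n := by
  cases g <;> simp only [index] <;> omega

/-- The generator is a real crossing. -/
def IsReal {n : ℕ} : VTGen n → Prop
  | s _ => True
  | ρ _ => False

end VTGen

/-- The positions of the crossings of a word. After the end of the word the value is `n`, which is
out of range, so that there is no crossing. -/
def wordIndex {n : ℕ} (w : List (VTGen n)) (m : ℕ) : ℕ := (w.map VTGen.index).getD m n

theorem wordIndex_eq {n : ℕ} (w : List (VTGen n)) {m : ℕ} (h : m < w.length) :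
    wordIndex w m = w[m].index := by
  simp [wordIndex, h]

theorem lt_length_of_wordIndex {n : ℕ} {w : List (VTGen n)} {m : ℕ} (h : wordIndex w m + 1 < n) :
    m < w.length := by
  by_contra h2
  rw [wordIndex, List.getD_eq_default _ _ (by simpa using h2)] at h
  omega

/-- A closed diagram whose crossings are read off a word. There is one time slot more than letters,
so that the number of slots is positive for the empty word, too. -/
noncomputable def wordDiagram {n : ℕ} (w : List (VTGen n)) : ClosedVirtualTwinDiagram :=
  slotDiagram n (w.length + 1) (wordIndex w) (Nat.succ_pos _)
    fun m => ∃ g, w[m]? = some g ∧ g.IsReal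

section

variable {n : ℕ} (w : List (VTGen n))

/-- The crossing of `wordDiagram w` that corresponds to the letter with index `m`. -/
noncomputable def wordCrossing (m : ℕ) : ℂ := slotCrossing n (w.length + 1) (wordIndex w) m

variable {w}

theorem wordIndex_lt {m : ℕ} (h : m < w.length) : wordIndex w m + 1 < n := by
  rw [wordIndex_eq w h]; exact VTGen.index_lt _

theorem mem_crossingSet_wordDiagram (c : ℂ) :
    c ∈ crossingSet (wordDiagram w).map ↔ ∃ m < w.length, c = wordCrossing w m := by
  refine (mem_crossingSet_curveMap (Nat.succ_pos _) c).trans ⟨?_, ?_⟩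
  · rintro ⟨m, -, h, rfl⟩
    exact ⟨m, lt_length_of_wordIndex h, rfl⟩
  · rintro ⟨m, h, rfl⟩
    exact ⟨m, by omega, wordIndex_lt h, rfl⟩

theorem wordCrossing_mem_real {m : ℕ} (h : m < w.length) :
    wordCrossing w m ∈ (wordDiagram w).real ↔ w[m].IsReal := by
  constructor
  · rintro ⟨m', hm', hp, ⟨g, hg, hr⟩, e⟩
    obtain rfl := eq_of_radialProj_slotCrossing (by omega) hm' (wordIndex_lt h) hp
      (congrArg radialProj e)
    rw [List.getElem?_eq_getElem h, Option.some_inj] at hg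
    rwa [hg]
  · intro hr
    exact ⟨m, by omega, wordIndex_lt h, ⟨_, List.getElem?_eq_getElem h, hr⟩, rfl⟩

theorem position_wordCrossing {m : ℕ} (h : m < w.length) :
    (wordDiagram w).position (wordCrossing w m) = w[m].index := by
  set N := w.length + 1
  set p := wordIndex w with hpdef
  have hN : 0 < N := Nat.succ_pos _
  have hm : m < N := by omega
  have hp : p m + 1 < n := wordIndex_lt h
  obtain ⟨ht, hNt⟩ := slot_time_mem hm
  set t : ℝ := (m + 1 / 2) / N
  have hnorm : ‖wordCrossing w m‖ = n - p m - 1 / 2 := by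
    rw [wordCrossing, slotCrossing, norm_mul, Circle.norm_coe, mul_one, Complex.norm_real,
      Real.norm_of_nonneg (slotCrossing_radius_pos hp).le]
  have hset : {x | radialProj ((wordDiagram w).map x) = radialProj (wordCrossing w m) ∧
      ‖wordCrossing w m‖ < ‖(wordDiagram w).map x‖} =
      (fun i => cyclePoint (strandPos n p N) i t) ''
        (strandPos n p m ⁻¹' (Set.Iio ⟨p m, by omega⟩)) := by
    have hfib := setOf_radialProj_curveMap (n := n) (p := p) hN (t := t) ⟨ht.1.le, ht.2⟩
    have hlt : ∀ i, ‖wordCrossing w m‖ < ‖curve n N p i t‖ ↔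
        strandPos n p m i < ⟨p m, by omega⟩ := by
      intro i
      rw [hnorm, norm_curve hN, curveRadius_slot hm hp ht.1.le ht.2 hNt, Fin.lt_def]
      split_ifs with h1 h2
      · simp [h1]
      · rw [h2]; push_cast; constructor
        · intro h; linarith
        · intro h; omega
      · constructor
        · intro h
          have h3 : (strandPos n p m i : ℝ) < (p m : ℝ) + 1 := by linarith
          have h4 : (strandPos n p m i : ℕ) < p m + 1 := by exact_mod_cast h3
          simp only; omega
        · intro h
          have h3 : (strandPos n p m i : ℝ) + 1 ≤ (p m : ℝ) := by exact_mod_cast h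
          linarith
    have hrad : radialProj (wordCrossing w m) = Circle.exp (2 * Real.pi * t) :=
      radialProj_slotCrossing hp
    ext x
    rw [hrad]
    constructor
    · rintro ⟨h1, h2⟩
      have h3 : x ∈ {x | radialProj (curveMap n N p x) = Circle.exp (2 * Real.pi * t)} := h1
      rw [hfib] at h3
      obtain ⟨i, rfl⟩ := h3
      refine ⟨i, (hlt i).1 ?_, rfl⟩
      rw [← curveMap_cyclePoint]
      exact h2
    · rintro ⟨i, hi, rfl⟩
      refine ⟨?_, ?_⟩
      · change radialProj (curveMap n N p _) = _
        rw [curveMap_cyclePoint, radialProj_curve hN]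
      · change _ < ‖curveMap n N p _‖
        rw [curveMap_cyclePoint]
        exact (hlt i).2 hi
  rw [ClosedVirtualTwinDiagram.position, hset]
  refine (Set.ncard_image_of_injective _ (cyclePoint_injective (strandPos n p N) t)).trans ?_
  rw [Set.ncard_preimage_of_injective_subset_range (strandPos n p m).injective
      (by rw [(strandPos n p m).surjective.range_eq]; exact Set.subset_univ _),
    ← wordIndex_eq w h, Set.ncard_eq_toFinset_card']
  simp [hpdef]

theorem isLetter_wordCrossing {m : ℕ} (h : m < w.length) :
    (wordDiagram w).IsLetter (wordCrossing w m) w[m] := by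
  have h1 := wordCrossing_mem_real h
  have h2 := position_wordCrossing h
  generalize w[m] = g at h1 h2
  cases g with
  | s i => exact ⟨h1.2 trivial, h2⟩
  | ρ i => exact ⟨h1.1, h2⟩

/-- The angle of a crossing from the ray at the beginning of the slot `a`. -/
theorem angleFrom_wordCrossing {a m : ℕ} (ha : a ≤ w.length) (h : m < w.length) :
    angleFrom (Circle.exp (2 * Real.pi * (a / (w.length + 1 : ℕ)))) (wordCrossing w m) =
      2 * Real.pi * (((m : ℝ) + 1 / 2 - a + if m < a then (w.length + 1 : ℕ) else 0) /
        (w.length + 1 : ℕ)) := by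
  have hp : wordIndex w m + 1 < n := wordIndex_lt h
  have hpi := Real.two_pi_pos
  have hN : (0 : ℝ) < (w.length + 1 : ℕ) := by positivity
  have ha' : (a : ℝ) + 1 ≤ (w.length + 1 : ℕ) := by exact_mod_cast Nat.succ_le_succ ha
  have hm' : (m : ℝ) + 2 ≤ (w.length + 1 : ℕ) := by
    exact_mod_cast (by omega : m + 2 ≤ w.length + 1)
  refine angleFrom_eq ?_ ⟨?_, ?_⟩ ?_
  · rw [wordCrossing, slotCrossing]
    refine mul_ne_zero ?_ (Circle.coe_ne_zero _)
    exact_mod_cast (slotCrossing_radius_pos hp).ne'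
  · refine mul_nonneg hpi.le (div_nonneg ?_ hN.le)
    split_ifs with hlt
    · have : (0 : ℝ) ≤ m := by positivity
      linarith
    · have : (a : ℝ) ≤ m := by exact_mod_cast not_lt.1 hlt
      linarith
  · refine mul_lt_of_lt_one_right hpi ((div_lt_one hN).2 ?_)
    split_ifs with hlt
    · have : (m : ℝ) + 1 ≤ a := by exact_mod_cast hlt
      linarith
    · have : (0 : ℝ) ≤ a := by positivity
      linarith
  · rw [wordCrossing, radialProj_slotCrossing hp, ← Circle.exp_add, Circle.exp_eq_exp]
    split_ifs with hlt
    · refine ⟨-1, ?_⟩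
      field_simp
      push_cast
      ring
    · refine ⟨0, ?_⟩
      field_simp
      push_cast
      ring

/-- The diagram of a word is a closure of each cyclic rotation of the word. -/
theorem isClosureOf_wordDiagram {a : ℕ} (ha : a ≤ w.length) :
    (wordDiagram w).IsClosureOf n ((w.drop a ++ w.take a).map PresentedGroup.of).prod := by
  have hN : (0 : ℝ) < (w.length + 1 : ℕ) := by positivity
  have hpi := Real.two_pi_pos
  refine ⟨rfl, Circle.exp (2 * Real.pi * (a / (w.length + 1 : ℕ))),
    (List.range' a (w.length - a) ++ List.range' 0 a).map (wordCrossing w),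
    w.drop a ++ w.take a, ?_, ?_, ?_, ?_, rfl⟩
  · rintro ⟨c, hc, h⟩
    obtain ⟨m, hm, rfl⟩ := (mem_crossingSet_wordDiagram c).1 hc
    have h1 := radialProj_eq_mul_exp_angleFrom (Circle.exp (2 * Real.pi * (a / (w.length + 1 : ℕ))))
      (c := wordCrossing w m) (by
        rw [wordCrossing, slotCrossing]
        refine mul_ne_zero ?_ (Circle.coe_ne_zero _)
        exact_mod_cast (slotCrossing_radius_pos (wordIndex_lt hm)).ne')
    rw [h, left_eq_mul, ← Circle.exp_zero] at h1
    have h2 := angleFrom_mem (Circle.exp (2 * Real.pi * (a / (w.length + 1 : ℕ))))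
      (wordCrossing w m)
    have h3 := Circle.exp_eq_exp_iff_of_lt (by
      rw [sub_zero, abs_of_nonneg h2.1]; exact h2.2) h1
    rw [angleFrom_wordCrossing ha hm, mul_eq_zero, or_iff_right hpi.ne',
      div_eq_zero_iff, or_iff_left hN.ne'] at h3
    -- twice the angle, measured in slots, is an odd integer
    have h4 : ((2 * (m : ℤ) + 1 - 2 * a + 2 * if m < a then (w.length + 1 : ℕ) else 0 : ℤ) : ℝ)
        = 0 := by
      push_cast
      split_ifs at h3 ⊢ <;> push_cast at h3 ⊢ <;> linarith
    have h5 : 2 * (m : ℤ) + 1 - 2 * a +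
        2 * (if m < a then ((w.length + 1 : ℕ) : ℤ) else 0) = 0 := by
      exact_mod_cast h4
    omega
  · intro c
    rw [mem_crossingSet_wordDiagram, List.mem_map]
    simp only [List.mem_append, List.mem_range'_1]
    constructor
    · rintro ⟨m, h, rfl⟩
      exact ⟨m, by omega, rfl⟩
    · rintro ⟨m, h, rfl⟩
      exact ⟨m, by omega, by tauto⟩
  · rw [List.pairwise_map, List.pairwise_append]
    have key : ∀ m m' : ℕ, m < w.length → m' < w.length →
        ((m : ℝ) + (if m < a then (w.length + 1 : ℕ) else 0 : ℕ) < m' +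
          (if m' < a then (w.length + 1 : ℕ) else 0 : ℕ)) →
        angleFrom (Circle.exp (2 * Real.pi * (a / (w.length + 1 : ℕ)))) (wordCrossing w m) <
          angleFrom (Circle.exp (2 * Real.pi * (a / (w.length + 1 : ℕ)))) (wordCrossing w m') := by
      intro m m' hm hm' h
      rw [angleFrom_wordCrossing ha hm, angleFrom_wordCrossing ha hm']
      refine mul_lt_mul_of_pos_left (div_lt_div_of_pos_right ?_ hN) hpi
      split_ifs at h ⊢ <;> push_cast at h ⊢ <;> linarith
    have key2 : ∀ m m' : ℕ, m < w.length → m' < w.length →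
        (m + (if m < a then (w.length + 1 : ℕ) else 0 : ℕ) < m' +
          (if m' < a then (w.length + 1 : ℕ) else 0 : ℕ)) →
        angleFrom (Circle.exp (2 * Real.pi * (a / (w.length + 1 : ℕ)))) (wordCrossing w m) <
          angleFrom (Circle.exp (2 * Real.pi * (a / (w.length + 1 : ℕ)))) (wordCrossing w m') :=
      fun m m' hm hm' h => key m m' hm hm' (by exact_mod_cast h)
    refine ⟨?_, ?_, ?_⟩
    · refine List.Pairwise.imp_of_mem (fun {m m'} h1 h2 hlt => ?_)
        (List.pairwise_lt_range' 1)
      rw [List.mem_range'_1] at h1 h2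
      refine key2 m m' (by omega) (by omega) ?_
      split_ifs <;> omega
    · refine List.Pairwise.imp_of_mem (fun {m m'} h1 h2 hlt => ?_)
        (List.pairwise_lt_range' 1)
      rw [List.mem_range'_1] at h1 h2
      refine key2 m m' (by omega) (by omega) ?_
      split_ifs <;> omega
    · intro m h1 m' h2
      rw [List.mem_range'_1] at h1 h2
      refine key2 m m' (by omega) (by omega) ?_
      split_ifs <;> omega
  · rw [List.forall₂_map_left_iff]
    refine List.rel_append ?_ ?_
    · rw [List.forall₂_iff_get]
      refine ⟨by simp, fun i h1 h2 => ?_⟩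
      simp only [List.length_drop] at h2
      have := isLetter_wordCrossing (w := w) (m := a + i) (by omega)
      simpa using this
    · rw [List.forall₂_iff_get]
      refine ⟨by simpa using ha, fun i h1 h2 => ?_⟩
      simp only [List.length_take] at h2
      have := isLetter_wordCrossing (w := w) (m := i) (by omega)
      simpa using this

end

/-- The generators are involutions, so every virtual twin is given by a word without inverses. -/
theorem VT.exists_word {n : ℕ} (β : VT n) :
    ∃ w : List (VTGen n), (w.map PresentedGroup.of).prod = β := by
  have hinv : ∀ g : VTGen n, (PresentedGroup.of g : VT n)⁻¹ = PresentedGroup.of g := by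
    intro g
    refine inv_eq_of_mul_eq_one_left ?_
    cases g with
    | s i => exact PresentedGroup.one_of_mem (rels := {r | VTRel n r}) (VTRel.s_sq i)
    | ρ i => exact PresentedGroup.one_of_mem (rels := {r | VTRel n r}) (VTRel.ρ_sq i)
  have hβ : β ∈ Subgroup.closure (Set.range (PresentedGroup.of (rels := {r | VTRel n r}))) := by
    rw [PresentedGroup.closure_range_of]; trivial
  induction hβ using Subgroup.closure_induction_left with
  | one => exact ⟨[], rfl⟩
  | mul_left x hx y _ ih =>
    obtain ⟨g, rfl⟩ := hx
    obtain ⟨w, rfl⟩ := ih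
    exact ⟨g :: w, by simp⟩
  | inv_mul_cancel x hx y _ ih =>
    obtain ⟨g, rfl⟩ := hx
    obtain ⟨w, rfl⟩ := ih
    exact ⟨g :: w, by simp [hinv]⟩

namespace ClosedVirtualTwinDiagram

/-- Every product of two virtual twins has a closure that is also a closure of the product in the
other order. -/
theorem exists_isClosureOf_mul {n : ℕ} (u v : VT n) :
    ∃ K : ClosedVirtualTwinDiagram, K.IsClosureOf n (u * v) ∧ K.IsClosureOf n (v * u) := by
  obtain ⟨a, rfl⟩ := u.exists_word
  obtain ⟨b, rfl⟩ := v.exists_word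
  have h1 := isClosureOf_wordDiagram (w := a ++ b) (Nat.zero_le _)
  have h2 := isClosureOf_wordDiagram (w := a ++ b) (a := a.length) (by simp)
  simp only [List.drop_zero, List.take_zero, List.append_nil, List.drop_left, List.take_left,
    List.map_append, List.prod_append] at h1 h2
  exact ⟨_, h1, h2⟩

theorem exists_isClosureOf {n : ℕ} (β : VT n) : ∃ K : ClosedVirtualTwinDiagram,
    K.IsClosureOf n β := by
  obtain ⟨K, hK, -⟩ := exists_isClosureOf_mul β 1
  exact ⟨K, by simpa using hK⟩

/-- Closures of virtual twins in the same Markov class are related by the moves. -/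
theorem relatedByM0M2_of_markovClass_eq {K K' : ClosedVirtualTwinDiagram} {n n' : ℕ} {β : VT n}
    {β' : VT n'} (hK : K.IsClosureOf n β) (hK' : K'.IsClosureOf n' β')
    (h : markovClass n β = markovClass n' β') : RelatedByM0M2 K K' := by
  have h0 : ∀ {A B : ClosedVirtualTwinDiagram} {n : ℕ} {β : VT n}, A.IsClosureOf n β →
      B.IsClosureOf n β → RelatedByM0M2 A B := fun hA hB =>
    Relation.EqvGen.rel _ _ (Or.inl ⟨_, _, hA, hB⟩)
  suffices H : ∀ x y : Σ n, VT n, Relation.EqvGen MarkovStep x y →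
      ∀ A B : ClosedVirtualTwinDiagram, A.IsClosureOf x.1 x.2 → B.IsClosureOf y.1 y.2 →
        RelatedByM0M2 A B from H _ _ (Quot.eqvGen_exact h) K K' hK hK'
  intro x y hxy
  induction hxy with
  | rel x y hs =>
    intro A B hA hB
    cases hs with
    | conj n u v =>
      obtain ⟨C, h1, h2⟩ := exists_isClosureOf_mul u v
      exact Relation.EqvGen.trans _ _ _ (h0 hA h1) (h0 h2 hB)
    | stab n hn β =>
      exact Relation.EqvGen.rel _ _ (Or.inr ⟨n, hn, β, hA, Or.inr hB⟩)
  | refl x => exact fun A B hA hB => h0 hA hB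
  | symm x y _ ih => exact fun A B hA hB => Relation.EqvGen.symm _ _ (ih B A hB hA)
  | trans x y z _ _ ih1 ih2 =>
    intro A B hA hB
    obtain ⟨C, hC⟩ := exists_isClosureOf y.2
    exact Relation.EqvGen.trans _ _ _ (ih1 A C hA hC) (ih2 C B hC hB)

end ClosedVirtualTwinDiagram

/-! ### The angular flow of a closed virtual twin diagram -/

namespace ClosedVirtualTwinDiagram

variable (K : ClosedVirtualTwinDiagram) (j : Fin K.numComponents)

/-- The component with index `j` as a periodic curve. -/
def component (t : ℝ) : ℂ := K.map (j, (t : AddCircle (1 : ℝ)))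

theorem circleVelocity_coe (t : ℝ) :
    circleVelocity K.map (j, (t : AddCircle (1 : ℝ))) = deriv (K.component j) t := by
  have h : (fun s : ℝ => K.map (j, (t : AddCircle (1 : ℝ)) + (s : AddCircle (1 : ℝ)))) =
      fun s => K.component j (t + s) := by
    funext s; rw [component, AddCircle.coe_add]
  rw [circleVelocity, h, deriv_comp_const_add, add_zero]

theorem component_ne_zero (t : ℝ) : K.component j t ≠ 0 := by
  have := K.outside (j, (t : AddCircle (1 : ℝ)))
  intro h
  rw [component] at h
  rw [h, norm_zero] at this
  norm_num at this

theorem component_add_one (t : ℝ) : K.component j (t + 1) = K.component j t := by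
  rw [component, component, AddCircle.coe_add, AddCircle.coe_period, add_zero]

theorem contDiff_component : ContDiff ℝ ∞ (K.component j) := K.smooth j

theorem hasDerivAt_component (t : ℝ) :
    HasDerivAt (K.component j) (deriv (K.component j) t) t :=
  (((K.contDiff_component j).differentiable (by simp)) t).hasDerivAt

/-- The logarithmic derivative of a component. Its imaginary part is the angular velocity. -/
noncomputable def logVelocity (t : ℝ) : ℂ := deriv (K.component j) t / K.component j t

theorem continuous_logVelocity : Continuous (K.logVelocity j) :=
  ((K.contDiff_component j).continuous_deriv (by simp)).div₀ (K.contDiff_component j).continuous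
    (K.component_ne_zero j)

theorem logVelocity_im_pos (t : ℝ) : 0 < (K.logVelocity j t).im := by
  have h := K.oriented (j, (t : AddCircle (1 : ℝ)))
  rw [circleVelocity_coe, ← component] at h
  have h2 := Complex.normSq_pos.2 (K.component_ne_zero j t)
  have h3 : (K.logVelocity j t).im =
      planeDet (K.component j t) (deriv (K.component j) t) / Complex.normSq (K.component j t) := by
    rw [logVelocity, Complex.div_im, planeDet]
    ring
  rw [h3]
  exact div_pos h h2

/-- A logarithm of a component, up to a constant. -/
noncomputable def logLift (t : ℝ) : ℂ := ∫ s in (0 : ℝ)..t, K.logVelocity j s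

theorem hasDerivAt_logLift (t : ℝ) : HasDerivAt (K.logLift j) (K.logVelocity j t) t :=
  (K.continuous_logVelocity j).integral_hasStrictDerivAt 0 t |>.hasDerivAt

/-- A component is the exponential of its logarithm. -/
theorem component_eq (t : ℝ) :
    K.component j t = K.component j 0 * Complex.exp (K.logLift j t) := by
  have hd : ∀ t, HasDerivAt (fun t => K.component j t * Complex.exp (-K.logLift j t)) 0 t := by
    intro t
    refine ((K.hasDerivAt_component j t).mul (K.hasDerivAt_logLift j t).neg.cexp).congr_deriv ?_
    have := K.component_ne_zero j t
    rw [logVelocity]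
    field_simp
    ring
  have h := is_const_of_deriv_eq_zero (fun t => (hd t).differentiableAt) (fun t => (hd t).deriv) t 0
  have h0 : K.logLift j 0 = 0 := by simp [logLift]
  simp only [h0, neg_zero, Complex.exp_zero, mul_one] at h
  rw [← h, mul_assoc, ← Complex.exp_add]
  simp

/-- A continuous choice of the angle along a component. -/
noncomputable def angleLift (t : ℝ) : ℝ := Complex.arg (K.component j 0) + (K.logLift j t).im

theorem radialProj_component (t : ℝ) :
    radialProj (K.component j t) = Circle.exp (K.angleLift j t) := by
  have h : K.component j t = ((‖K.component j 0‖ * Real.exp (K.logLift j t).re : ℝ) : ℂ) *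
      Circle.exp (K.angleLift j t) := by
    rw [component_eq]
    conv_lhs => rw [← Complex.norm_mul_exp_arg_mul_I (K.component j 0),
      ← Complex.re_add_im (K.logLift j t), Complex.exp_add]
    rw [Circle.coe_exp, angleLift]
    push_cast
    rw [add_mul, Complex.exp_add]
    ring
  rw [h, radialProj_mul_circle]
  exact mul_pos (norm_pos_iff.2 (K.component_ne_zero j 0)) (Real.exp_pos _)

theorem norm_component (t : ℝ) :
    ‖K.component j t‖ = ‖K.component j 0‖ * Real.exp (K.logLift j t).re := by
  rw [component_eq, norm_mul, Complex.norm_exp]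

theorem hasDerivAt_angleLift (t : ℝ) :
    HasDerivAt (K.angleLift j) (K.logVelocity j t).im t :=
  (Complex.imCLM.hasFDerivAt.comp_hasDerivAt t (K.hasDerivAt_logLift j t)).const_add _

theorem continuous_angleLift : Continuous (K.angleLift j) :=
  continuous_iff_continuousAt.2 fun t => (K.hasDerivAt_angleLift j t).continuousAt

theorem strictMono_angleLift : StrictMono (K.angleLift j) :=
  strictMono_of_deriv_pos fun t => by
    rw [(K.hasDerivAt_angleLift j t).deriv]; exact K.logVelocity_im_pos j t

theorem angleLift_add_one (t : ℝ) :
    K.angleLift j (t + 1) = K.angleLift j t + (K.angleLift j 1 - K.angleLift j 0) := by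
  have hg : ∀ t, K.logVelocity j (t + 1) = K.logVelocity j t := by
    intro t
    have h : (fun t => K.component j (t + 1)) = K.component j :=
      funext fun t => K.component_add_one j t
    rw [logVelocity, logVelocity, component_add_one, ← deriv_comp_add_const, h]
  have hd : ∀ t, HasDerivAt (fun t => K.angleLift j (t + 1) - K.angleLift j t) 0 t := by
    intro t
    refine (((K.hasDerivAt_angleLift j (t + 1)).comp_add_const t 1).sub
      (K.hasDerivAt_angleLift j t)).congr_deriv ?_
    rw [hg, sub_self]
  have h := is_const_of_deriv_eq_zero (fun t => (hd t).differentiableAt) (fun t => (hd t).deriv) t 0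
  simp only [zero_add] at h
  linarith

theorem angleLift_add_natCast (t : ℝ) (m : ℕ) :
    K.angleLift j (t + m) = K.angleLift j t + m * (K.angleLift j 1 - K.angleLift j 0) := by
  induction m with
  | zero => simp
  | succ m ih =>
    push_cast
    rw [← add_assoc, angleLift_add_one, ih]
    ring

theorem surjective_angleLift : Function.Surjective (K.angleLift j) := by
  have hc : 0 < K.angleLift j 1 - K.angleLift j 0 :=
    sub_pos.2 (K.strictMono_angleLift j zero_lt_one)
  intro y
  obtain ⟨m, hm⟩ := exists_nat_gt (|y - K.angleLift j 0| / (K.angleLift j 1 - K.angleLift j 0))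
  rw [div_lt_iff₀ hc] at hm
  have h1 := K.angleLift_add_natCast j 0 m
  have h2 := K.angleLift_add_natCast j (-m) m
  rw [neg_add_cancel] at h2
  rw [zero_add] at h1
  have h3 := abs_lt.1 hm
  exact mem_range_of_exists_le_of_exists_ge (K.continuous_angleLift j)
    ⟨-m, by linarith⟩ ⟨m, by linarith⟩

/-- The angle along a component as an order isomorphism. -/
noncomputable def angleIso : ℝ ≃o ℝ :=
  (K.strictMono_angleLift j).orderIsoOfSurjective _ (K.surjective_angleLift j)

theorem angleIso_apply (t : ℝ) : K.angleIso j t = K.angleLift j t := rfl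

/-- The increase of the angle over one period does not depend on the starting point, so that moving
on by the angle `θ` is well defined on the circle. -/
theorem periodic_flow (θ : ℝ) : Function.Periodic (fun t : ℝ =>
    (((K.angleIso j).symm (K.angleIso j t + θ) : ℝ) : AddCircle (1 : ℝ))) 1 := by
  intro t
  have h : (K.angleIso j).symm (K.angleIso j (t + 1) + θ) =
      (K.angleIso j).symm (K.angleIso j t + θ) + 1 := by
    rw [OrderIso.symm_apply_eq, angleIso_apply, angleIso_apply, angleIso_apply, angleLift_add_one,
      angleLift_add_one, ← angleIso_apply K j ((K.angleIso j).symm _), OrderIso.apply_symm_apply]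
    ring
  change (((K.angleIso j).symm (K.angleIso j (t + 1) + θ) : ℝ) : AddCircle (1 : ℝ)) = _
  rw [h, AddCircle.coe_add, AddCircle.coe_period, add_zero]

/-- The point that is reached from `x` along the orientation after the polar angle has increased
by `θ`. -/
noncomputable def flow (θ : ℝ) (x : Fin K.numComponents × AddCircle (1 : ℝ)) :
    Fin K.numComponents × AddCircle (1 : ℝ) :=
  (x.1, (K.periodic_flow x.1 θ).lift x.2)

theorem flow_coe (θ t : ℝ) : K.flow θ (j, (t : AddCircle (1 : ℝ))) =
    (j, (((K.angleIso j).symm (K.angleIso j t + θ) : ℝ) : AddCircle (1 : ℝ))) := rfl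

theorem exists_eq_coe (x : Fin K.numComponents × AddCircle (1 : ℝ)) :
    ∃ t : ℝ, x = (x.1, (t : AddCircle (1 : ℝ))) := by
  obtain ⟨t, ht⟩ := QuotientAddGroup.mk_surjective x.2
  exact ⟨t, Prod.ext rfl ht.symm⟩

variable {K}

theorem flow_fst (θ : ℝ) (x) : (K.flow θ x).1 = x.1 := rfl

theorem flow_zero (x) : K.flow 0 x = x := by
  obtain ⟨t, h⟩ := K.exists_eq_coe x
  rw [h, flow_coe, add_zero, OrderIso.symm_apply_apply]

theorem flow_flow (a b : ℝ) (x) : K.flow a (K.flow b x) = K.flow (a + b) x := by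
  obtain ⟨t, h⟩ := K.exists_eq_coe x
  rw [h, flow_coe, flow_coe, flow_coe, OrderIso.apply_symm_apply, add_assoc, add_comm b a]

theorem radialProj_map_flow (θ : ℝ) (x) :
    radialProj (K.map (K.flow θ x)) = radialProj (K.map x) * Circle.exp θ := by
  obtain ⟨t, h⟩ := K.exists_eq_coe x
  rw [h, flow_coe, ← component, ← component, radialProj_component, radialProj_component,
    ← Circle.exp_add, ← angleIso_apply, ← angleIso_apply, OrderIso.apply_symm_apply]

theorem exists_flow_eq {x y : Fin K.numComponents × AddCircle (1 : ℝ)} (h : x.1 = y.1) :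
    ∃ θ, K.flow θ x = y := by
  obtain ⟨j, a⟩ := x
  obtain ⟨j', b⟩ := y
  obtain rfl : j = j' := h
  obtain ⟨t, rfl⟩ := QuotientAddGroup.mk_surjective a
  obtain ⟨t', rfl⟩ := QuotientAddGroup.mk_surjective b
  refine ⟨K.angleIso j t' - K.angleIso j t, ?_⟩
  change K.flow _ (j, ((t : ℝ) : AddCircle (1 : ℝ))) = (j, ((t' : ℝ) : AddCircle (1 : ℝ)))
  rw [flow_coe, add_sub_cancel, OrderIso.symm_apply_apply]

/-- Translation of the parameter is a monotone reparametrization of the flow. -/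
theorem exists_flow_eq_add (j : Fin K.numComponents) (a : AddCircle (1 : ℝ)) :
    ∃ τ : ℝ ≃o ℝ, τ 0 = 0 ∧ ∀ s : ℝ, (j, a + (s : AddCircle (1 : ℝ))) = K.flow (τ s) (j, a) := by
  obtain ⟨t, rfl⟩ := QuotientAddGroup.mk_surjective a
  refine ⟨(OrderIso.addLeft t).trans ((K.angleIso j).trans (OrderIso.addRight (-K.angleIso j t))),
    ?_, fun s => ?_⟩
  · change K.angleIso j (t + 0) + -K.angleIso j t = 0
    rw [add_zero, add_neg_cancel]
  · have e : K.angleIso j t + (K.angleIso j (t + s) + -K.angleIso j t) = K.angleIso j (t + s) := by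
      ring
    change (j, ((t : ℝ) : AddCircle (1 : ℝ)) + (s : AddCircle (1 : ℝ))) =
      K.flow (K.angleIso j (t + s) + -K.angleIso j t) (j, ((t : ℝ) : AddCircle (1 : ℝ)))
    rw [flow_coe, ← AddCircle.coe_add, e, OrderIso.symm_apply_apply]

/-- The derivative of the logarithm of the distance to the origin by the angle, at a point of a
diagram. -/
noncomputable def slope (K : ClosedVirtualTwinDiagram)
    (x : Fin K.numComponents × AddCircle (1 : ℝ)) : ℝ :=
  (circleVelocity K.map x / K.map x).re / (circleVelocity K.map x / K.map x).im

theorem hasDerivAt_log_norm_flow (x) (θ : ℝ) :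
    HasDerivAt (fun θ => Real.log ‖K.map (K.flow θ x)‖) (K.slope (K.flow θ x)) θ := by
  obtain ⟨t, h⟩ := K.exists_eq_coe x
  set j := x.1
  have hn : ∀ t, Real.log ‖K.component j t‖ =
      Real.log ‖K.component j 0‖ + (K.logLift j t).re := fun t => by
    rw [norm_component, Real.log_mul (norm_ne_zero_iff.2 (K.component_ne_zero j 0))
      (Real.exp_ne_zero _), Real.log_exp]
  have h1 : ∀ t, HasDerivAt (fun t => Real.log ‖K.component j t‖) (K.logVelocity j t).re t := by
    intro t
    rw [show (fun t => Real.log ‖K.component j t‖) = _ from funext hn]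
    exact (Complex.reCLM.hasFDerivAt.comp_hasDerivAt t (K.hasDerivAt_logLift j t)).const_add _
  have h2 : ∀ s, HasDerivAt (K.angleIso j).symm
      (K.logVelocity j ((K.angleIso j).symm s)).im⁻¹ s := fun s =>
    (K.hasDerivAt_angleLift j _).of_local_left_inverse
      (K.angleIso j).symm.continuous.continuousAt (K.logVelocity_im_pos j _).ne'
      (Filter.Eventually.of_forall fun s => (K.angleIso j).apply_symm_apply s)
  rw [h]
  simp only [flow_coe, slope, circleVelocity_coe]
  have h3 := ((h1 _).comp _ (h2 (K.angleIso j t + θ))).comp_const_add (K.angleIso j t) θ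
  rw [div_eq_mul_inv (Complex.re _)]
  exact h3

theorem continuous_log_norm_flow (x) : Continuous fun θ => Real.log ‖K.map (K.flow θ x)‖ :=
  continuous_iff_continuousAt.2 fun θ => (hasDerivAt_log_norm_flow x θ).continuousAt

/-- At a crossing, the orientation of the two velocities is given by comparing the slopes. -/
theorem planeDet_pos_iff {x y : Fin K.numComponents × AddCircle (1 : ℝ)} (h : K.map x = K.map y) :
    0 < planeDet (circleVelocity K.map x) (circleVelocity K.map y) ↔ K.slope y < K.slope x := by
  have him : ∀ x, 0 < (circleVelocity K.map x / K.map x).im := by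
    intro x
    obtain ⟨t, hx⟩ := K.exists_eq_coe x
    rw [hx, circleVelocity_coe]
    exact K.logVelocity_im_pos _ t
  have hne : K.map y ≠ 0 := by
    obtain ⟨t, hx⟩ := K.exists_eq_coe y
    rw [hx]
    exact K.component_ne_zero _ t
  have hx := him x
  have hy := him y
  rw [slope, slope, div_lt_div_iff₀ hy hx]
  rw [h] at hx ⊢
  set a := circleVelocity K.map x / K.map y
  set b := circleVelocity K.map y / K.map y
  have ha : circleVelocity K.map x = a * K.map y := (div_mul_cancel₀ _ hne).symm
  have hb : circleVelocity K.map y = b * K.map y := (div_mul_cancel₀ _ hne).symm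
  have hdet : planeDet (circleVelocity K.map x) (circleVelocity K.map y) =
      Complex.normSq (K.map y) * (a.re * b.im - b.re * a.im) := by
    rw [ha, hb, Complex.normSq_apply]
    simp only [planeDet, Complex.mul_re, Complex.mul_im]
    ring
  rw [hdet, mul_pos_iff_of_pos_left (Complex.normSq_pos.2 hne), sub_pos]

end ClosedVirtualTwinDiagram

/-! ### Ranks of real numbers -/

section Rank

variable {S : Type*}

/-- The number of points of `S` at which `f` is larger than at `x`. -/
noncomputable def rank (f : S → ℝ) (x : S) : ℕ := {y | f x < f y}.ncard

theorem rank_congr {f g : S → ℝ} (h : ∀ x y, f x < f y ↔ g x < g y) : rank f = rank g := by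
  funext x
  simp only [rank, h]

variable [Finite S]

theorem rank_lt (f : S → ℝ) (x : S) : rank f x < Nat.card S :=
  Set.ncard_lt_card (by simpa [Set.ne_univ_iff_exists_notMem] using ⟨x, le_refl (f x)⟩)

theorem rank_lt_rank {f : S → ℝ} {x y : S} (h : f x < f y) : rank f y < rank f x :=
  Set.ncard_lt_ncard ⟨fun _ hz => lt_trans h hz, fun h2 => lt_irrefl (f y) (h2 h)⟩ (Set.toFinite _)

theorem rank_injective {f : S → ℝ} (hf : Function.Injective f) : Function.Injective (rank f) := by
  intro x y h
  by_contra hne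
  rcases lt_or_gt_of_ne (hf.ne hne) with h1 | h1
  · exact (rank_lt_rank h1).ne h.symm
  · exact (rank_lt_rank h1).ne h

/-- The order of the points of `S` by decreasing values of `f`. -/
noncomputable def rankEquiv {n : ℕ} (hn : Nat.card S = n) (f : S → ℝ) (hf : Function.Injective f) :
    S ≃ Fin n :=
  Equiv.ofBijective (fun x => ⟨rank f x, hn ▸ rank_lt f x⟩) <| by
    refine (Nat.bijective_iff_injective_and_card _).2
      ⟨fun x y h => rank_injective hf ?_, by simp [hn]⟩
    simpa using h

theorem rankEquiv_apply {n : ℕ} (hn : Nat.card S = n) (f : S → ℝ) (hf : Function.Injective f)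
    (x : S) : (rankEquiv hn f hf x : ℕ) = rank f x := rfl

theorem rankEquiv_congr {n : ℕ} (hn : Nat.card S = n) {f g : S → ℝ} (hf : Function.Injective f)
    (hg : Function.Injective g) (h : ∀ x y, f x < f y ↔ g x < g y) :
    rankEquiv hn f hf = rankEquiv hn g hg := by
  ext x
  rw [rankEquiv_apply, rankEquiv_apply, rank_congr h]

/-- If the values at `a` and `b` change their order and no other pair does, then `a` and `b` have
adjacent ranks, and they swap them. -/
theorem rankEquiv_swap {n : ℕ} (hn : Nat.card S = n) {f g : S → ℝ} (hf : Function.Injective f)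
    (hg : Function.Injective g) {a b : S} (hab : a ≠ b) (hfab : f b < f a) (hgab : g a < g b)
    (h : ∀ x y, ¬ (x = a ∧ y = b) → ¬ (x = b ∧ y = a) → (f x < f y ↔ g x < g y)) :
    (rankEquiv hn f hf b : ℕ) = rank f a + 1 ∧
      rankEquiv hn g hg = (rankEquiv hn f hf).trans (adjSwap n (rank f a)) := by
  have ha : ∀ y, y ≠ b → (f a < f y ↔ g a < g y) := fun y hy =>
    h a y (by tauto) (by tauto)
  have hb : ∀ y, y ≠ a → (f b < f y ↔ g b < g y) := fun y hy =>
    h b y (by tauto) (by tauto)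
  have hab' : ∀ y, y ≠ a → y ≠ b → (f a < f y ↔ f b < f y) := fun y hya hyb => by
    refine ⟨fun h1 => hfab.trans h1, fun h1 => ?_⟩
    by_contra h2
    have h3 : f y < f a := lt_of_le_of_ne (not_lt.1 h2) (hf.ne hya)
    have h4 := (h y a (by tauto) (by tauto)).1 h3
    have h5 := (hb y hya).1 h1
    exact lt_asymm hgab (h5.trans h4)
  have e1 : {y | f b < f y} = insert a {y | f a < f y} := by
    ext y
    simp only [Set.mem_ofPred_eq, Set.mem_insert_iff]
    by_cases hya : y = a
    · subst hya; simp [hfab]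
    · by_cases hyb : y = b
      · subst hyb; simp [hya, hfab.le]
      · simp [hya, hab' y hya hyb]
  have e2 : {y | g b < g y} = {y | f a < f y} := by
    ext y
    simp only [Set.mem_ofPred_eq]
    by_cases hya : y = a
    · subst hya; simp [hgab.le]
    · by_cases hyb : y = b
      · subst hyb; simp [hfab.le]
      · rw [hab' y hya hyb, hb y hya]
  have e3 : {y | g a < g y} = insert b {y | f a < f y} := by
    ext y
    simp only [Set.mem_ofPred_eq, Set.mem_insert_iff]
    by_cases hyb : y = b
    · subst hyb; simp [hgab]
    · simp [hyb, ha y hyb]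
  have r1 : rank f b = rank f a + 1 := by
    rw [rank, e1, Set.ncard_insert_of_notMem (by simp), rank]
  have r2 : rank g b = rank f a := by rw [rank, e2, rank]
  have r3 : rank g a = rank f a + 1 := by
    rw [rank, e3, Set.ncard_insert_of_notMem (by simpa using hfab.le), rank]
  refine ⟨r1, Equiv.ext fun x => Fin.ext ?_⟩
  have hlt : rank f a + 1 < n := by rw [← r1, ← hn]; exact rank_lt f b
  rw [trans_apply, adjSwap_apply, dif_pos hlt, rankEquiv_apply, rankEquiv_apply]
  by_cases hxa : x = a
  · subst hxa; simp [r3]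
  by_cases hxb : x = b
  · subst hxb; simp [r1, r2]
  have h1 : rank f x ≠ rank f a := (rank_injective hf).ne hxa
  have h2 : rank f x ≠ rank f a + 1 := by rw [← r1]; exact (rank_injective hf).ne hxb
  rw [if_neg h1, if_neg h2, rankEquiv_apply, rank, rank]
  congr 1
  ext y
  exact (h x y (by tauto) (by tauto)).symm

end Rank

/-! ### Sign changes -/

/-- A continuous function without zeros has a constant sign. -/
theorem pos_iff_pos_of_ne_zero {D : ℝ → ℝ} (hD : Continuous D) {s t : ℝ} (hst : s ≤ t)
    (h : ∀ u ∈ Set.Icc s t, D u ≠ 0) : 0 < D s ↔ 0 < D t := by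
  have hs := h s ⟨le_rfl, hst⟩
  have ht := h t ⟨hst, le_rfl⟩
  constructor
  · intro h1
    by_contra h2
    obtain ⟨u, hu, h0⟩ := intermediate_value_Icc' hst hD.continuousOn ⟨not_lt.1 h2, h1.le⟩
    exact h u hu h0
  · intro h1
    by_contra h2
    obtain ⟨u, hu, h0⟩ := intermediate_value_Icc hst hD.continuousOn ⟨not_lt.1 h2, h1.le⟩
    exact h u hu h0

/-- A function whose only zero in an interval is a zero with negative derivative changes its sign
there from positive to negative. -/
theorem sign_change_of_deriv_neg {D : ℝ → ℝ} (hD : Continuous D) {s t u d : ℝ} (hst : s < t)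
    (htu : t < u) (h0 : D t = 0) (hd : HasDerivAt D d t) (hneg : d < 0)
    (h : ∀ v ∈ Set.Icc s u, v ≠ t → D v ≠ 0) : 0 < D s ∧ D u < 0 := by
  have hslope := (hasDerivAt_iff_tendsto_slope.1 hd).eventually (gt_mem_nhds hneg)
  rw [eventually_nhdsWithin_iff] at hslope
  obtain ⟨ε, hε, hball⟩ := Metric.eventually_nhds_iff.1 hslope
  have key : ∀ v, v ≠ t → |v - t| < ε → (v - t) * D v < 0 := by
    intro v hv hvε
    have h1 := hball (by rwa [Real.dist_eq]) hv
    rw [slope_def_field, h0, sub_zero] at h1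
    have h2 : (v - t) * D v = D v / (v - t) * (v - t) ^ 2 := by
      field_simp [sub_ne_zero.2 hv]
    rw [h2]
    exact mul_neg_of_neg_of_pos h1 (by have := sub_ne_zero.2 hv; positivity)
  constructor
  · set v := max s (t - ε / 2)
    have hvt : v < t := max_lt hst (by linarith)
    have hsv : s ≤ v := le_max_left _ _
    have h1 := key v hvt.ne (by
      rw [abs_lt]; constructor <;> linarith [le_max_right s (t - ε / 2)])
    have h2 : 0 < D v := by nlinarith
    exact (pos_iff_pos_of_ne_zero hD hsv fun w hw =>
      h w ⟨hw.1, by linarith [hw.2]⟩ (by linarith [hw.2] : w < t).ne).2 h2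
  · set v := min u (t + ε / 2)
    have hvt : t < v := lt_min htu (by linarith)
    have hvu : v ≤ u := min_le_left _ _
    have h1 := key v hvt.ne' (by
      rw [abs_lt]; constructor <;> linarith [min_le_right u (t + ε / 2)])
    have h2 : ¬ 0 < D v := by nlinarith
    rw [pos_iff_pos_of_ne_zero hD hvu fun w hw =>
      h w ⟨by linarith [hw.1], hw.2⟩ (by linarith [hw.1] : t < w).ne'] at h2
    exact lt_of_le_of_ne (not_lt.1 h2) (h u ⟨by linarith, le_rfl⟩ htu.ne')

/-! ### The two branches of a crossing -/

namespace VirtualDoodleDiagram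

variable {K : VirtualDoodleDiagram}

theorem eq_or_eq_of_map_eq {x y z : Fin K.numComponents × AddCircle (1 : ℝ)} (hxy : x ≠ y)
    (h : K.map x = K.map y) (hz : K.map z = K.map x) : z = x ∨ z = y := by
  by_contra hne
  push Not at hne
  exact K.noTriple z x y hne.1 hxy hne.2 ⟨hz, h⟩

theorem isLeftToRight_or_isRightToLeft {c : ℂ} (hc : c ∈ crossingSet K.map)
    {x : Fin K.numComponents × AddCircle (1 : ℝ)} (hx : K.map x = c) :
    K.IsLeftToRight c x ∨ K.IsRightToLeft c x := by
  have key : ∃ y, y ≠ x ∧ K.map y = c := by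
    obtain ⟨u, v, huv, hu, hv⟩ := hc
    by_cases h : u = x
    · exact ⟨v, by rintro rfl; exact huv h, hv⟩
    · exact ⟨u, h, hu⟩
  obtain ⟨y, hne, hy⟩ := key
  rcases lt_or_gt_of_ne (K.transverse x y hne.symm (hx.trans hy.symm)) with h | h
  · exact Or.inr ⟨hx, y, hne, hy, h⟩
  · exact Or.inl ⟨hx, y, hne, hy, h⟩

theorem exists_branches {c : ℂ} (hc : c ∈ crossingSet K.map) :
    ∃ x y, K.IsRightToLeft c x ∧ K.IsLeftToRight c y := by
  obtain ⟨x, y, hxy, hx, hy⟩ := hc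
  rcases lt_or_gt_of_ne (K.transverse x y hxy (hx.trans hy.symm)) with h | h
  · exact ⟨x, y, ⟨hx, y, hxy.symm, hy, h⟩, hy, x, hxy, hx, by rw [planeDet_swap]; linarith⟩
  · exact ⟨y, x, ⟨hy, x, hxy, hx, by rw [planeDet_swap]; linarith⟩, hx, y, hxy.symm, hy, h⟩

theorem planeDet_neg_of_branches {c : ℂ} {x y : Fin K.numComponents × AddCircle (1 : ℝ)}
    (hx : K.IsRightToLeft c x) (hy : K.IsLeftToRight c y) :
    x ≠ y ∧ planeDet (circleVelocity K.map x) (circleVelocity K.map y) < 0 := by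
  obtain ⟨hx, x', hx', hmx, hdx⟩ := hx
  obtain ⟨hy, y', hy', hmy, hdy⟩ := hy
  have hne : x ≠ y := by
    rintro rfl
    rcases eq_or_eq_of_map_eq hx'.symm (hx.trans hmx.symm) (hmy.trans hx.symm) with h | h
    · exact hy' h
    · rw [h] at hdy; exact lt_asymm hdx hdy
  refine ⟨hne, ?_⟩
  rcases eq_or_eq_of_map_eq hx'.symm (hx.trans hmx.symm) (hy.trans hx.symm) with h | h
  · exact absurd h.symm hne
  · rwa [h]

theorem IsRightToLeft.unique {c : ℂ} {x y : Fin K.numComponents × AddCircle (1 : ℝ)}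
    (hx : K.IsRightToLeft c x) (hy : K.IsRightToLeft c y) : x = y := by
  by_contra hne
  obtain ⟨hx, x', hx', hmx, hdx⟩ := hx
  obtain ⟨hy, y', hy', hmy, hdy⟩ := hy
  have h1 : x' = y :=
    (eq_or_eq_of_map_eq hne (hx.trans hy.symm) (hmx.trans hx.symm)).resolve_left hx'
  have h2 : y' = x :=
    (eq_or_eq_of_map_eq hne (hx.trans hy.symm) (hmy.trans hx.symm)).resolve_right hy'
  rw [h1] at hdx
  rw [h2, planeDet_swap] at hdy
  linarith

theorem IsLeftToRight.unique {c : ℂ} {x y : Fin K.numComponents × AddCircle (1 : ℝ)}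
    (hx : K.IsLeftToRight c x) (hy : K.IsLeftToRight c y) : x = y := by
  by_contra hne
  obtain ⟨hx, x', hx', hmx, hdx⟩ := hx
  obtain ⟨hy, y', hy', hmy, hdy⟩ := hy
  have h1 : x' = y :=
    (eq_or_eq_of_map_eq hne (hx.trans hy.symm) (hmx.trans hx.symm)).resolve_left hx'
  have h2 : y' = x :=
    (eq_or_eq_of_map_eq hne (hx.trans hy.symm) (hmy.trans hx.symm)).resolve_right hy'
  rw [h1] at hdx
  rw [h2, planeDet_swap] at hdy
  linarith

end VirtualDoodleDiagram

/-! ### The word of a closed diagram -/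

namespace ClosedVirtualTwinDiagram

/-- The points of the diagram on the ray through `p`. -/
abbrev Fiber (K : ClosedVirtualTwinDiagram) (p : Circle) : Type :=
  {x : Fin K.numComponents × AddCircle (1 : ℝ) // radialProj (K.map x) = p}

variable {K : ClosedVirtualTwinDiagram} {p : Circle}

instance : Finite (K.Fiber p) := by
  have h := K.fold p
  exact Set.finite_of_encard_eq_coe h

theorem card_fiber : Nat.card (K.Fiber p) = K.degree := by
  have h := K.fold p
  change Set.ncard {x | radialProj (K.map x) = p} = _
  rw [Set.ncard, h]
  rfl

theorem map_ne_zero (x) : K.map x ≠ 0 := by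
  intro h
  have := K.outside x
  rw [h, norm_zero] at this
  norm_num at this

theorem flow_injective (θ : ℝ) : Function.Injective (K.flow θ) := by
  intro x y h
  have := congrArg (K.flow (-θ)) h
  simpa [flow_flow, flow_zero] using this

/-- The logarithm of the distance to the origin of a strand that starts on the ray through `p`,
after the angle `θ`. -/
noncomputable def logHeight (θ : ℝ) (x : K.Fiber p) : ℝ := Real.log ‖K.map (K.flow θ x)‖

theorem log_norm_eq_iff {x y : Fin K.numComponents × AddCircle (1 : ℝ)} :
    Real.log ‖K.map x‖ = Real.log ‖K.map y‖ ↔ ‖K.map x‖ = ‖K.map y‖ :=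
  ⟨fun h => Real.log_injOn_pos (norm_pos_iff.2 (map_ne_zero x)) (norm_pos_iff.2 (map_ne_zero y)) h,
    fun h => by rw [h]⟩

theorem logHeight_lt_iff (θ : ℝ) (x y : K.Fiber p) :
    logHeight θ x < logHeight θ y ↔ ‖K.map (K.flow θ x)‖ < ‖K.map (K.flow θ y)‖ :=
  Real.log_lt_log_iff (norm_pos_iff.2 (map_ne_zero _)) (norm_pos_iff.2 (map_ne_zero _))

/-- After the same angle, two strands lie on the same ray, so they meet when their distances to the
origin agree. -/
theorem logHeight_eq_iff (θ : ℝ) (x y : K.Fiber p) :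
    logHeight θ x = logHeight θ y ↔ K.map (K.flow θ x) = K.map (K.flow θ y) := by
  rw [logHeight, logHeight, log_norm_eq_iff]
  refine ⟨fun h => eq_of_radialProj_eq ?_ h, fun h => by rw [h]⟩
  rw [radialProj_map_flow, radialProj_map_flow, x.2, y.2]

theorem continuous_logHeight (x : K.Fiber p) : Continuous fun θ => logHeight θ x :=
  continuous_log_norm_flow x.1

theorem exists_fiber_flow_eq {z : Fin K.numComponents × AddCircle (1 : ℝ)} {θ : ℝ}
    (h : radialProj (K.map z) = p * Circle.exp θ) : ∃ x : K.Fiber p, K.flow θ x = z := by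
  refine ⟨⟨K.flow (-θ) z, ?_⟩, ?_⟩
  · rw [radialProj_map_flow, h, mul_assoc, ← Circle.exp_add, add_neg_cancel, Circle.exp_zero,
      mul_one]
  · simp [flow_flow, flow_zero]

/-- The position of a point of the diagram is the rank of its strand at its angle. -/
theorem position_map_flow (θ : ℝ) (x : K.Fiber p) :
    K.position (K.map (K.flow θ x)) = rank (logHeight θ) x := by
  have h : {z | radialProj (K.map z) = radialProj (K.map (K.flow θ x)) ∧
      ‖K.map (K.flow θ x)‖ < ‖K.map z‖} =
      (fun y : K.Fiber p => K.flow θ y) '' {y | logHeight θ x < logHeight θ y} := by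
    ext z
    rw [radialProj_map_flow, x.2]
    constructor
    · rintro ⟨h1, h2⟩
      obtain ⟨y, rfl⟩ := exists_fiber_flow_eq h1
      exact ⟨y, (logHeight_lt_iff θ x y).2 h2, rfl⟩
    · rintro ⟨y, hy, rfl⟩
      exact ⟨by rw [radialProj_map_flow, y.2], (logHeight_lt_iff θ x y).1 hy⟩
  rw [position, h]
  exact Set.ncard_image_of_injective _ (f := fun y : K.Fiber p => K.flow θ y)
    ((flow_injective θ).comp Subtype.val_injective)

/-- The permutation of the points on a ray by one turn around the origin. -/
noncomputable def turn (K : ClosedVirtualTwinDiagram) (p : Circle) : Perm (K.Fiber p) where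
  toFun x := ⟨K.flow (2 * Real.pi) x, by
    rw [radialProj_map_flow, x.2, Circle.exp_two_pi, mul_one]⟩
  invFun x := ⟨K.flow (-(2 * Real.pi)) x, by
    rw [radialProj_map_flow, x.2, Circle.exp_neg, Circle.exp_two_pi, inv_one, mul_one]⟩
  left_inv x := Subtype.ext (by simp [flow_flow, flow_zero])
  right_inv x := Subtype.ext (by simp [flow_flow, flow_zero])

theorem coe_turn (x : K.Fiber p) : (K.turn p x : Fin K.numComponents × AddCircle (1 : ℝ)) =
    K.flow (2 * Real.pi) x := rfl

theorem coe_turn_zpow (x : K.Fiber p) (q : ℤ) :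
    ((K.turn p ^ q) x : Fin K.numComponents × AddCircle (1 : ℝ)) =
      K.flow (q * (2 * Real.pi)) x := by
  induction q with
  | zero => simp [flow_zero]
  | succ i ih =>
    rw [add_comm, zpow_one_add, Perm.mul_apply, coe_turn, ih, flow_flow]
    push_cast; congr 1; ring
  | pred i ih =>
    rw [sub_eq_neg_add, zpow_add, zpow_neg_one, Perm.mul_apply]
    change K.flow (-(2 * Real.pi)) _ = _
    rw [ih, flow_flow]
    push_cast; congr 1; ring

theorem logHeight_two_pi (x : K.Fiber p) :
    logHeight (2 * Real.pi) x = logHeight 0 (K.turn p x) := by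
  rw [logHeight, logHeight, flow_zero, coe_turn]

theorem mem_crossingSet_of_logHeight_eq {θ : ℝ} {x y : K.Fiber p} (hxy : x ≠ y)
    (h : logHeight θ x = logHeight θ y) : K.map (K.flow θ x) ∈ crossingSet K.map :=
  ⟨K.flow θ x, K.flow θ y, fun e => hxy (Subtype.ext (flow_injective θ e)), rfl,
    ((logHeight_eq_iff θ x y).1 h).symm⟩

theorem crossing_ne_zero {c : ℂ} (hc : c ∈ crossingSet K.map) : c ≠ 0 := by
  obtain ⟨x, -, -, rfl, -⟩ := hc
  exact map_ne_zero x

theorem angleFrom_map_flow {θ : ℝ} (hθ : θ ∈ Set.Ico 0 (2 * Real.pi)) (x : K.Fiber p) :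
    angleFrom p (K.map (K.flow θ x)) = θ :=
  angleFrom_eq (map_ne_zero _) hθ (by rw [radialProj_map_flow, x.2])

/-- `a` and `b` are the strands, starting on the ray through `p`, that cross in `c`; before the
crossing, `a` is farther away from the origin. -/
def CrossIn (c : ℂ) (a b : K.Fiber p) : Prop :=
  K.IsRightToLeft c (K.flow (angleFrom p c) a) ∧ K.IsLeftToRight c (K.flow (angleFrom p c) b)

theorem exists_crossIn {c : ℂ} (hc : c ∈ crossingSet K.map) :
    ∃ a b : K.Fiber p, CrossIn c a b := by
  obtain ⟨x, y, hx, hy⟩ := K.exists_branches hc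
  have h := radialProj_eq_mul_exp_angleFrom p (crossing_ne_zero hc)
  obtain ⟨a, rfl⟩ := exists_fiber_flow_eq (z := x) (p := p) (θ := angleFrom p c) (by rw [hx.1, h])
  obtain ⟨b, rfl⟩ := exists_fiber_flow_eq (z := y) (p := p) (θ := angleFrom p c) (by rw [hy.1, h])
  exact ⟨a, b, hx, hy⟩

theorem CrossIn.ne {c : ℂ} {a b : K.Fiber p} (h : CrossIn c a b) : a ≠ b := by
  rintro rfl
  exact (K.planeDet_neg_of_branches h.1 h.2).1 rfl

theorem CrossIn.eq_or_eq {c : ℂ} {a b : K.Fiber p} (h : CrossIn c a b) {x y : K.Fiber p}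
    (hxy : x ≠ y) (hx : K.map (K.flow (angleFrom p c) x) = c)
    (hy : K.map (K.flow (angleFrom p c) y) = c) : (x = a ∧ y = b) ∨ (x = b ∧ y = a) := by
  have hne := (K.planeDet_neg_of_branches h.1 h.2).1
  have key : ∀ z : K.Fiber p, K.map (K.flow (angleFrom p c) z) = c → z = a ∨ z = b := by
    intro z hz
    rcases K.eq_or_eq_of_map_eq hne (h.1.1.trans h.2.1.symm) (hz.trans h.1.1.symm) with e | e
    · exact Or.inl (Subtype.ext (flow_injective _ e))
    · exact Or.inr (Subtype.ext (flow_injective _ e))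
  rcases key x hx with rfl | rfl <;> rcases key y hy with rfl | rfl <;> tauto

/-- Passing a single crossing, its two strands swap their ranks. -/
theorem CrossIn.rankEquiv_eq {n : ℕ} (hn : Nat.card (K.Fiber p) = n) {c : ℂ} {a b : K.Fiber p}
    (h : CrossIn c a b) {s u : ℝ} (hs : 0 ≤ s) (hsc : s < angleFrom p c)
    (hcu : angleFrom p c < u) (hu : u < 2 * Real.pi)
    (hfs : Function.Injective (logHeight (K := K) (p := p) s))
    (hfu : Function.Injective (logHeight (K := K) (p := p) u))
    (hc : ∀ d ∈ crossingSet K.map, s ≤ angleFrom p d → angleFrom p d ≤ u → d = c) :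
    (rankEquiv hn _ hfs a : ℕ) = K.position c ∧ (rankEquiv hn _ hfs b : ℕ) = K.position c + 1 ∧
      rankEquiv hn _ hfu = (rankEquiv hn _ hfs).trans (adjSwap n (K.position c)) := by
  set t := angleFrom p c
  have hmem : ∀ v ∈ Set.Icc s u, v ∈ Set.Ico 0 (2 * Real.pi) := fun v hv =>
    ⟨hs.trans hv.1, hv.2.trans_lt hu⟩
  -- two strands meet at no angle other than `t`, and there only `a` and `b` do
  have hcross : ∀ v ∈ Set.Icc s u, ∀ x y : K.Fiber p, x ≠ y → logHeight v x = logHeight v y →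
      v = t ∧ ((x = a ∧ y = b) ∨ (x = b ∧ y = a)) := by
    intro v hv x y hxy e
    have h1 := mem_crossingSet_of_logHeight_eq hxy e
    have h2 := angleFrom_map_flow (hmem v hv) x
    have h3 := hc _ h1 (by rw [h2]; exact hv.1) (by rw [h2]; exact hv.2)
    have h4 : v = t := by rw [← h2, h3]
    refine ⟨h4, h.eq_or_eq hxy (by rw [← h3, h2]) ?_⟩
    rw [← h3, h2]
    exact ((logHeight_eq_iff v x y).1 e).symm
  have hD : ∀ x y : K.Fiber p, Continuous fun v => logHeight v x - logHeight v y := fun x y =>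
    (continuous_logHeight x).sub (continuous_logHeight y)
  have hpair : ∀ v ∈ Set.Icc s u, ∀ w ∈ Set.Icc s u, v ≤ w → ∀ x y : K.Fiber p,
      ¬ (x = a ∧ y = b) → ¬ (x = b ∧ y = a) →
      (logHeight v x < logHeight v y ↔ logHeight w x < logHeight w y) := by
    intro v hv w hw hvw x y h1 h2
    by_cases hxy : x = y
    · subst hxy; simp
    rw [← sub_pos, ← sub_pos (b := logHeight w x)]
    refine pos_iff_pos_of_ne_zero (hD y x) hvw fun z hz e => ?_
    have := (hcross z ⟨hv.1.trans hz.1, hz.2.trans hw.2⟩ x y hxy (by linarith)).2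
    tauto
  have hmap : K.map (K.flow t a) = K.map (K.flow t b) := h.1.1.trans h.2.1.symm
  have hsl : K.slope (K.flow t a) < K.slope (K.flow t b) := by
    rw [← planeDet_pos_iff hmap.symm, planeDet_swap]
    linarith [(K.planeDet_neg_of_branches h.1 h.2).2]
  have hsign := sign_change_of_deriv_neg (hD a b) hsc hcu
    (sub_eq_zero.2 ((logHeight_eq_iff t a b).2 hmap))
    ((hasDerivAt_log_norm_flow a.1 t).sub (hasDerivAt_log_norm_flow b.1 t)) (sub_neg.2 hsl)
    fun v hv hvt e => hvt (hcross v hv a b h.ne (sub_eq_zero.1 e)).1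
  have hs' : s ∈ Set.Icc s u := ⟨le_rfl, (hsc.trans hcu).le⟩
  have hu' : u ∈ Set.Icc s u := ⟨(hsc.trans hcu).le, le_rfl⟩
  have ht' : t ∈ Set.Icc s u := ⟨hsc.le, hcu.le⟩
  obtain ⟨r1, r2⟩ := rankEquiv_swap hn hfs hfu h.ne (sub_pos.1 hsign.1) (sub_neg.1 hsign.2)
    fun x y h1 h2 => hpair s hs' u hu' (hsc.trans hcu).le x y h1 h2
  have r3 : rank (logHeight s) a = K.position c := by
    rw [← h.1.1, position_map_flow]
    rw [rank, rank]
    congr 1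
    ext y
    by_cases hy : y = b
    · subst hy
      have h1 := (sub_pos.1 hsign.1).not_gt
      have h2 := ((logHeight_eq_iff t a y).2 hmap).not_lt
      simp only [Set.mem_ofPred_eq]
      tauto
    · by_cases hya : y = a
      · subst hya; simp
      · exact hpair s hs' t ht' hsc.le a y (by tauto) (by tauto)
  rw [r3] at r1 r2
  exact ⟨r3, r1, r2⟩

end ClosedVirtualTwinDiagram

namespace ClosedVirtualTwinDiagram

variable {K : ClosedVirtualTwinDiagram} {p : Circle}

/-- The virtual twin that is read off from the ray at the angle `θ` from `p` onwards, one turn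
around the origin being completed at `p`, is a product of crossings between the strands that
start on the ray through `p`, followed by the permutation of the ranks from one ray to the other.
The list `R` holds the real crossings with their two strands. -/
theorem exists_prod_eq_prod_cross {n : ℕ} (hn : Nat.card (K.Fiber p) = n)
    (hlast : Function.Injective (logHeight (K := K) (p := p) (2 * Real.pi))) (L : List ℂ)
    (w : List (VTGen n)) (hLw : List.Forall₂ K.IsLetter L w)
    (hL : L.Pairwise fun c d => angleFrom p c < angleFrom p d) {θ : ℝ} (hθ0 : 0 ≤ θ)
    (hθ : θ < 2 * Real.pi) (hf : Function.Injective (logHeight (K := K) (p := p) θ))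
    (hmem : ∀ c ∈ L, c ∈ crossingSet K.map ∧ θ < angleFrom p c)
    (hall : ∀ c ∈ crossingSet K.map, θ ≤ angleFrom p c → c ∈ L) :
    ∃ R : List (ℂ × (K.Fiber p × K.Fiber p)),
      (R.map Prod.fst).Sublist L ∧ (∀ r ∈ R, r.1 ∈ K.real ∧ CrossIn r.1 r.2.1 r.2.2) ∧
      (∀ c ∈ L, c ∈ K.real → c ∈ R.map Prod.fst) ∧
      (w.map PresentedGroup.of).prod =
        ((R.map Prod.snd).map fun q => VT.cross n (rankEquiv hn _ hf q.1)
          (rankEquiv hn _ hf q.2)).prod *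
        VT.perm n ((rankEquiv hn _ hlast).symm.trans (rankEquiv hn _ hf)) := by
  induction hLw generalizing θ with
  | nil =>
    refine ⟨[], by simp, by simp, by simp, ?_⟩
    have h : rankEquiv hn _ hf = rankEquiv hn _ hlast := by
      refine rankEquiv_congr hn _ _ fun x y => ?_
      by_cases hxy : x = y
      · subst hxy; simp
      rw [← sub_pos, ← sub_pos (b := logHeight (2 * Real.pi) x)]
      refine pos_iff_pos_of_ne_zero ((continuous_logHeight y).sub (continuous_logHeight x)) hθ.le
        fun v hv e => ?_
      rcases hv.2.eq_or_lt with rfl | hlt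
      · exact hxy (hlast (sub_eq_zero.1 e)).symm
      · have h1 := mem_crossingSet_of_logHeight_eq (Ne.symm hxy) (sub_eq_zero.1 e)
        have := hall _ h1 (by rw [angleFrom_map_flow ⟨hθ0.trans hv.1, hlt⟩]; exact hv.1)
        simp at this
    rw [h, symm_trans_self]
    exact (map_one (VT.perm n)).symm.trans (by simp [Perm.one_def])
  | @cons c g L w hg hLw ih =>
    obtain ⟨hcL, hL⟩ := List.pairwise_cons.1 hL
    obtain ⟨hc, hθc⟩ := hmem c (by simp)
    -- a ray between `c` and the next crossing
    obtain ⟨θ', hcθ', hθ', hnext⟩ : ∃ θ', angleFrom p c < θ' ∧ θ' < 2 * Real.pi ∧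
        ∀ d ∈ L, θ' < angleFrom p d := by
      cases L with
      | nil =>
        obtain ⟨θ', h1, h2⟩ := exists_between (angleFrom_mem p c).2
        exact ⟨θ', h1, h2, by simp⟩
      | cons d L =>
        obtain ⟨θ', h1, h2⟩ := exists_between (hcL d (by simp))
        refine ⟨θ', h1, h2.trans (angleFrom_mem p d).2, fun d' hd' => ?_⟩
        rcases List.mem_cons.1 hd' with rfl | hd'
        · exact h2
        · exact h2.trans ((List.pairwise_cons.1 hL).1 d' hd')
    have hall' : ∀ d ∈ crossingSet K.map, θ' ≤ angleFrom p d → d ∈ L := by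
      intro d hd h
      rcases List.mem_cons.1 (hall d hd ((hθc.trans hcθ').le.trans h)) with rfl | h'
      · exact absurd hcθ' h.not_gt
      · exact h'
    have hf' : Function.Injective (logHeight (K := K) (p := p) θ') := by
      intro x y e
      by_contra hxy
      have h1 := mem_crossingSet_of_logHeight_eq hxy e
      have h2 := angleFrom_map_flow ⟨hθ0.trans (hθc.trans hcθ').le, hθ'⟩ x
      exact (hnext _ (hall' _ h1 h2.ge)).ne' h2
    obtain ⟨R, hRL, hR, hR', hprod⟩ := ih hL (hθ0.trans (hθc.trans hcθ').le) hθ' hf'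
      (fun d hd => ⟨(hmem d (by simp [hd])).1, hnext d hd⟩) hall'
    obtain ⟨a, b, hab⟩ := exists_crossIn (p := p) hc
    obtain ⟨ha, hb, he⟩ := hab.rankEquiv_eq hn hθ0 hθc hcθ' hθ' hf hf' fun d hd h1 h2 => by
      rcases List.mem_cons.1 (hall d hd h1) with rfl | h'
      · rfl
      · exact absurd (hnext d h') h2.not_gt
    set i := K.position c with hi
    have hin : i + 1 < n := by rw [← hb]; exact (rankEquiv hn _ hf b).2
    -- the swap of the two strands is moved to the end of the product, which turns the ranks at `θ'`
    -- into those at `θ`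
    have key : VT.rho n i * (w.map PresentedGroup.of).prod =
        ((R.map Prod.snd).map fun q => VT.cross n (rankEquiv hn _ hf q.1)
          (rankEquiv hn _ hf q.2)).prod *
        VT.perm n ((rankEquiv hn _ hlast).symm.trans (rankEquiv hn _ hf)) := by
      have hswap : ∀ j, adjSwap n i (adjSwap n i j) = j := fun j => by
        rw [← Perm.mul_apply, adjSwap_mul_self, Perm.one_apply]
      have h1 := VT.perm_mul_prod_cross (adjSwap n i) (fun x => rankEquiv hn _ hf' x)
        (R.map Prod.snd)
      rw [hprod, ← VT.perm_adjSwap, ← mul_assoc, h1, mul_assoc, ← map_mul, he]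
      simp only [trans_apply, hswap]
      congr 2
      ext j
      simp [hswap]
    rcases g with g | g
    · obtain ⟨hreal, hg⟩ := hg
      refine ⟨(c, a, b) :: R, by simpa using hRL, ?_, ?_, ?_⟩
      · rintro r hr
        rcases List.mem_cons.1 hr with rfl | hr
        · exact ⟨hreal, hab⟩
        · exact hR r hr
      · intro d hd hdr
        rcases List.mem_cons.1 hd with rfl | hd
        · simp
        · simpa using Or.inr (by simpa using hR' d hd hdr)
      · have ha' : rankEquiv hn _ hf a = ⟨i, by omega⟩ := Fin.ext ha
        have hb' : rankEquiv hn _ hf b = ⟨i + 1, hin⟩ := Fin.ext hb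
        have hof : (PresentedGroup.of (VTGen.s g) : VT n) = VT.sig n i := by
          have : i < n - 1 := by omega
          rw [VT.sig, dif_pos this]
          congr 2
          exact Fin.ext hg.symm
        rw [List.map_cons, List.prod_cons, List.map_cons, List.map_cons, List.prod_cons, hof,
          mul_assoc, ← key, ha', hb', VT.cross_adj, mul_assoc, ← mul_assoc (VT.rho n i),
          VT.rho_mul_self, one_mul]
    · obtain ⟨hreal, hg⟩ := hg
      refine ⟨R, hRL.cons c, hR, ?_, ?_⟩
      · intro d hd hdr
        rcases List.mem_cons.1 hd with rfl | hd
        · exact absurd hdr hreal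
        · exact hR' d hd hdr
      · have hof : (PresentedGroup.of (VTGen.ρ g) : VT n) = VT.rho n i := by
          have : i < n - 1 := by omega
          rw [VT.rho, dif_pos this]
          congr 2
          exact Fin.ext hg.symm
        rw [List.map_cons, List.prod_cons, hof, key]

/-- The virtual twin of a closed diagram is the strand twin of its real crossings, taken in the
order of the angles, and of the permutation by one turn. -/
theorem IsClosureOf.exists_strandClass {n : ℕ} {β : VT n} (h : K.IsClosureOf n β) :
    ∃ (p : Circle) (R : List (ℂ × (K.Fiber p × K.Fiber p))),
      (R.Pairwise fun r s => angleFrom p r.1 < angleFrom p s.1) ∧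
      (∀ r ∈ R, r.1 ∈ K.real ∧ CrossIn r.1 r.2.1 r.2.2 ∧ 0 < angleFrom p r.1) ∧
      (∀ c ∈ K.real, c ∈ R.map Prod.fst) ∧
      markovClass n β = strandClass (K.Fiber p) (R.map Prod.snd) (K.turn p) := by
  obtain ⟨hdeg, p, L, w, hp, hmem, hL, hLw, rfl⟩ := h
  have hn : Nat.card (K.Fiber p) = n := card_fiber.trans hdeg
  have h0 : Function.Injective (logHeight (K := K) (p := p) 0) := by
    intro x y e
    by_contra hxy
    refine hp ⟨_, mem_crossingSet_of_logHeight_eq hxy e, ?_⟩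
    rw [flow_zero, x.2]
  have hlast : Function.Injective (logHeight (K := K) (p := p) (2 * Real.pi)) := by
    intro x y e
    rw [logHeight_two_pi, logHeight_two_pi] at e
    exact (K.turn p).injective (h0 e)
  have hpos : ∀ c ∈ crossingSet K.map, 0 < angleFrom p c := by
    intro c hc
    refine lt_of_le_of_ne (angleFrom_mem p c).1 fun e => hp ⟨c, hc, ?_⟩
    rw [radialProj_eq_mul_exp_angleFrom p (crossing_ne_zero hc), ← e, Circle.exp_zero, mul_one]
  obtain ⟨R, hRL, hR, hR', hprod⟩ := exists_prod_eq_prod_cross hn hlast L w hLw hL le_rfl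
    Real.two_pi_pos h0 (fun c hc => ⟨(hmem c).1 hc, hpos c ((hmem c).1 hc)⟩)
    fun c hc _ => (hmem c).2 hc
  have hpair := hL.sublist hRL
  rw [List.pairwise_map] at hpair
  refine ⟨p, R, hpair,
    fun r hr => ⟨(hR r hr).1, (hR r hr).2, hpos _ (K.real_subset (hR r hr).1)⟩,
    fun c hc => hR' c ((hmem c).2 (K.real_subset hc)) hc, ?_⟩
  have he : rankEquiv hn _ hlast = (K.turn p).trans (rankEquiv hn _ h0) := by
    ext x
    rw [trans_apply, rankEquiv_apply, rankEquiv_apply, ← position_map_flow, ← position_map_flow,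
      flow_zero, coe_turn]
  rw [hprod, ← markovClass_strandTwin (rankEquiv hn _ h0), strandTwin]
  congr 3
  rw [he]
  ext i
  simp [permCongr_apply, Perm.inv_def]

end ClosedVirtualTwinDiagram

/-! ### Detaching the real crossings -/

namespace ClosedVirtualTwinDiagram

variable {K : ClosedVirtualTwinDiagram}

/-- A family `pt` of points of the diagram, indexed by `X`, that meets every component. The flow
leads from the point `x` to the point `φ x`, it takes the angle `dur x`, and no other point of the
family is met on the way. -/
structure IsFlowSection (K : ClosedVirtualTwinDiagram) {X : Type} (φ : Perm X)
    (pt : X → Fin K.numComponents × AddCircle (1 : ℝ)) (dur : X → ℝ) : Prop where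
  dur_pos : ∀ x, 0 < dur x
  flow_dur : ∀ x, K.flow (dur x) (pt x) = pt (φ x)
  flow_ne : ∀ x y θ, 0 < θ → θ < dur x → K.flow θ (pt x) ≠ pt y
  injective : Function.Injective pt
  fst_eq_iff : ∀ x y, (pt x).1 = (pt y).1 ↔ φ.SameCycle x y
  fst_surjective : ∀ j, ∃ x, (pt x).1 = j

/-- The points on a ray form a flow section, with one turn around the origin as return map. -/
theorem isFlowSection_turn (K : ClosedVirtualTwinDiagram) (p : Circle) :
    IsFlowSection K (K.turn p) Subtype.val fun _ => 2 * Real.pi where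
  dur_pos _ := Real.two_pi_pos
  flow_dur _ := rfl
  flow_ne x y θ h0 h1 e := by
    have h := radialProj_map_flow θ x.1
    rw [e, x.2, y.2, left_eq_mul, ← Circle.exp_zero] at h
    refine h0.ne' (Circle.exp_eq_exp_iff_of_lt ?_ h)
    rw [sub_zero, abs_of_pos h0]
    exact h1
  injective := Subtype.val_injective
  fst_eq_iff x y := by
    constructor
    · intro h
      obtain ⟨θ, hθ⟩ := exists_flow_eq h
      have h := radialProj_map_flow θ x.1
      rw [hθ, x.2, y.2, left_eq_mul, ← Circle.exp_zero, Circle.exp_eq_exp] at h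
      obtain ⟨q, hq⟩ := h
      refine ⟨q, Subtype.ext ?_⟩
      rw [coe_turn_zpow, ← hθ, hq, zero_add]
    · rintro ⟨q, rfl⟩
      rw [coe_turn_zpow, flow_fst]
  fst_surjective j := by
    obtain ⟨x, hx⟩ := exists_fiber_flow_eq (p := p) (z := (j, (0 : AddCircle (1 : ℝ))))
      (radialProj_eq_mul_exp_angleFrom p (map_ne_zero _))
    exact ⟨x, congrArg Prod.fst hx⟩

section

variable {X : Type} {φ : Perm X} {pt : X → Fin K.numComponents × AddCircle (1 : ℝ)} {dur : X → ℝ}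

/-- The open arcs between the points of a flow section are disjoint. -/
theorem IsFlowSection.eq_of_flow_eq (h : IsFlowSection K φ pt dur) {x y : X} {s t : ℝ}
    (hs : 0 < s) (hsx : s < dur x) (ht : 0 < t) (hty : t < dur y)
    (e : K.flow s (pt x) = K.flow t (pt y)) : x = y ∧ s = t := by
  have e' := congrArg (K.flow (-t)) e
  rw [flow_flow, flow_flow, neg_add_cancel, flow_zero] at e'
  rcases lt_trichotomy s t with hst | rfl | hst
  · refine absurd ?_ (h.flow_ne y x (t - s) (by linarith) (by linarith))
    rw [← e', flow_flow, sub_add_add_cancel, add_neg_cancel, flow_zero]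
  · rw [neg_add_cancel, flow_zero] at e'
    exact ⟨h.injective e', rfl⟩
  · exact absurd e' (h.flow_ne x y _ (by linarith) (by linarith))

open Classical in
/-- A new point can be added to a flow section on the open arc that starts at `a`. -/
theorem IsFlowSection.insertAfter (h : IsFlowSection K φ pt dur) (a : X) {t : ℝ} (h0 : 0 < t)
    (ht : t < dur a) :
    IsFlowSection K (insertAfter φ a) (fun z => z.elim (K.flow t (pt a)) pt)
      (fun z => z.elim (dur a - t) (Function.update dur a t)) where
  dur_pos z := by
    rcases z with _ | x
    · exact sub_pos.2 ht
    · rcases eq_or_ne x a with rfl | hx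
      · simpa
      · simpa [hx] using h.dur_pos x
  flow_dur z := by
    rcases z with _ | x
    · simp [flow_flow, h.flow_dur]
    · rcases eq_or_ne x a with rfl | hx
      · simp
      · simp [hx, h.flow_dur, insertAfter_of_ne φ a hx]
  flow_ne z w θ hθ hz e := by
    have hle : ∀ x, Function.update dur a t x ≤ dur x := fun x => by
      rcases eq_or_ne x a with rfl | hx
      · simpa using ht.le
      · simp [hx]
    rcases z with _ | x <;> rcases w with _ | y <;> simp only [Option.elim] at e hz
    · rw [flow_flow] at e
      have := (h.eq_of_flow_eq (by linarith) (by linarith) h0 ht e).2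
      linarith
    · rw [flow_flow] at e
      exact h.flow_ne _ _ _ (by linarith) (by linarith) e
    · obtain ⟨rfl, h2⟩ := h.eq_of_flow_eq hθ (hz.trans_le (hle x)) h0 ht e
      simp [h2] at hz
    · exact h.flow_ne _ _ _ hθ (hz.trans_le (hle x)) e
  injective z w e := by
    rcases z with _ | x <;> rcases w with _ | y <;> simp only [Option.elim] at e
    · rfl
    · exact absurd e (h.flow_ne _ _ _ h0 ht)
    · exact absurd e.symm (h.flow_ne _ _ _ h0 ht)
    · rw [h.injective e]
  fst_eq_iff z w := by
    have key : ∀ z : Option X, (z.elim (K.flow t (pt a)) pt).1 = (pt (z.getD a)).1 := by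
      rintro (_ | x) <;> rfl
    rw [sameCycle_insertAfter, ← h.fst_eq_iff, key, key]
  fst_surjective j := by
    obtain ⟨x, hx⟩ := h.fst_surjective j
    exact ⟨some x, hx⟩

end

/-- Going through the crossings of `R` from the last to the first, the strand twin of a flow section
is transformed to one in which each of these crossings is the starting point of both its strands.
The crossings of `Q` have been treated before. -/
theorem IsFlowSection.exists_detached {p : Circle} (R : List (ℂ × (K.Fiber p × K.Fiber p)))
    (hR : R.Pairwise fun r s => angleFrom p r.1 < angleFrom p s.1)
    (hR' : ∀ r ∈ R, CrossIn r.1 r.2.1 r.2.2 ∧ 0 < angleFrom p r.1)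
    {X : Type} [Finite X] {φ : Perm X} {pt : X → Fin K.numComponents × AddCircle (1 : ℝ)}
    {dur : X → ℝ} (h : IsFlowSection K φ pt dur) (base : K.Fiber p → X)
    (hbase : ∀ s, pt (base s) = s) (hdur : ∀ r ∈ R, ∀ s, angleFrom p r.1 < dur (base s))
    (Q : List (ℂ × (X × X)))
    (hQ : ∀ q ∈ Q, K.IsRightToLeft q.1 (pt q.2.1) ∧ K.IsLeftToRight q.1 (pt q.2.2)) :
    ∃ (Y : Type) (_ : Finite Y) (ψ : Perm Y) (pt' : Y → Fin K.numComponents × AddCircle (1 : ℝ))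
      (dur' : Y → ℝ) (Q' : List (ℂ × (Y × Y))), IsFlowSection K ψ pt' dur' ∧
      (∀ q ∈ Q', K.IsRightToLeft q.1 (pt' q.2.1) ∧ K.IsLeftToRight q.1 (pt' q.2.2)) ∧
      Q'.map Prod.fst = R.map Prod.fst ++ Q.map Prod.fst ∧
      strandClass Y (Q'.map Prod.snd) ψ =
        strandClass X (Q.map Prod.snd ++ R.map fun r => (base r.2.1, base r.2.2)) φ := by
  classical
  induction R using List.reverseRecOn generalizing X with
  | nil => exact ⟨X, ‹_›, φ, pt, dur, Q, h, hQ, by simp, by simp⟩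
  | append_singleton R r ih =>
    obtain ⟨c, a, b⟩ := r
    obtain ⟨hR1, -, hR2⟩ := List.pairwise_append.1 hR
    obtain ⟨hab, ht⟩ := hR' (c, a, b) (by simp)
    simp only at hab ht
    -- a new point on the strand of `a` and one on the strand of `b`, at the angle of the crossing
    have hne : base a ≠ base b := fun e => hab.ne (Subtype.ext (by rw [← hbase, ← hbase, e]))
    have h1 := h.insertAfter (base a) ht (hdur (c, a, b) (by simp) a)
    have h2 := h1.insertAfter (some (base b)) ht
      (by simpa [hne.symm] using hdur (c, a, b) (by simp) b)
    have key := ih hR1 (fun r hr => hR' r (by simp [hr])) h2 (some ∘ some ∘ base)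
      (fun s => hbase s) (fun r hr s => by
        have h4 := hR2 r hr (c, a, b) (by simp)
        have h5 := hdur r (by simp [hr]) s
        simp only at h4
        simp only [Function.comp_apply, Option.elim, Function.update_apply]
        split_ifs <;> assumption)
      ((c, (some none, none)) :: Q.map (Prod.map id (Prod.map (some ∘ some) (some ∘ some))))
      (fun q hq => by
        rcases List.mem_cons.1 hq with rfl | hq
        · exact ⟨by simpa [hbase] using hab.1, by simpa [hbase] using hab.2⟩
        · obtain ⟨q', hq', rfl⟩ := List.mem_map.1 hq
          exact hQ q' hq')
    obtain ⟨Y, hY, ψ, pt', dur', Q', h3, h4, h5, h6⟩ := key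
    refine ⟨Y, hY, ψ, pt', dur', Q', h3, h4, by simp [h5], h6.trans ?_⟩
    rw [List.map_append, ← List.append_assoc, List.map_singleton, ← strandClass_detach _ _ _ hne]
    simp [Function.comp_def]

end ClosedVirtualTwinDiagram

/-! ### Gauss data of a flow section -/

/-- The end at which an arc leaves a crossing on the strand that crosses from left to right
(`true`) or from right to left (`false`). -/
def CrossingEnd.outgoing : Bool → CrossingEnd
  | false => CrossingEnd.outLeft
  | true => CrossingEnd.outRight

/-- The end at which an arc reaches a crossing on the strand that crosses from left to right
(`true`) or from right to left (`false`). -/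
def CrossingEnd.incoming : Bool → CrossingEnd
  | false => CrossingEnd.inRight
  | true => CrossingEnd.inLeft

namespace VirtualDoodleDiagram

variable (K : VirtualDoodleDiagram)

/-- `x` is the preimage of `c` on the strand that crosses from left to right (`true`) or from right
to left (`false`). -/
def IsBranch (c : ℂ) (x : Fin K.numComponents × AddCircle (1 : ℝ)) : Bool → Prop
  | false => K.IsRightToLeft c x
  | true => K.IsLeftToRight c x

variable {K}

theorem IsBranch.map_eq {c : ℂ} {x : Fin K.numComponents × AddCircle (1 : ℝ)} {i : Bool}
    (h : K.IsBranch c x i) : K.map x = c := by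
  cases i <;> exact h.1

theorem IsBranch.unique {c : ℂ} {x y : Fin K.numComponents × AddCircle (1 : ℝ)} {i : Bool}
    (hx : K.IsBranch c x i) (hy : K.IsBranch c y i) : x = y := by
  cases i
  · exact IsRightToLeft.unique hx hy
  · exact IsLeftToRight.unique hx hy

theorem IsBranch.eq_of_eq {c : ℂ} {x : Fin K.numComponents × AddCircle (1 : ℝ)} {i i' : Bool}
    (h : K.IsBranch c x i) (h' : K.IsBranch c x i') : i = i' := by
  cases i <;> cases i'
  · rfl
  · exact absurd rfl (planeDet_neg_of_branches h h').1
  · exact absurd rfl (planeDet_neg_of_branches h' h).1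
  · rfl

theorem exists_isBranch {c : ℂ} (hc : c ∈ crossingSet K.map) (i : Bool) :
    ∃ x, K.IsBranch c x i := by
  obtain ⟨x, y, hx, hy⟩ := exists_branches hc
  cases i
  · exact ⟨x, hx⟩
  · exact ⟨y, hy⟩

theorem startsAt_outgoing {c : K.RealCrossing} {i : Bool}
    {x : Fin K.numComponents × AddCircle (1 : ℝ)} :
    K.StartsAt (c, CrossingEnd.outgoing i) x ↔ K.IsBranch c.1 x i := by
  cases i <;> simp [StartsAt, CrossingEnd.outgoing, IsBranch]

theorem endsAt_incoming {c : K.RealCrossing} {i : Bool}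
    {x : Fin K.numComponents × AddCircle (1 : ℝ)} :
    K.EndsAt (c, CrossingEnd.incoming i) x ↔ K.IsBranch c.1 x i := by
  cases i <;> simp [EndsAt, CrossingEnd.incoming, IsBranch]

theorem finite_preimage_real : (K.map ⁻¹' K.real).Finite := by
  refine Set.Finite.preimage' (K.finite_crossings.subset K.real_subset) fun c hc => ?_
  obtain ⟨x, y, hxy, hx, hy⟩ := K.real_subset hc
  refine (Set.toFinite {x, y}).subset fun z hz => ?_
  exact eq_or_eq_of_map_eq hxy (hx.trans hy.symm) (Eq.trans hz hx.symm)

/-- From every outgoing end of a real crossing an arc runs to some end of a real crossing. -/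
theorem exists_gaussArc (c : K.RealCrossing) (i : Bool) : ∃ (d : K.RealCrossing) (i' : Bool),
    (((c, CrossingEnd.outgoing i) : K.Boundary), ((d, CrossingEnd.incoming i') : K.Boundary)) ∈
      K.gaussArcs := by
  obtain ⟨⟨j, a⟩, hx⟩ := exists_isBranch (K.real_subset c.2) i
  -- the times of the visits at real crossings within one period; the first of them ends the arc
  set U : Set ℝ := {u | u ∈ Set.Ioc (0 : ℝ) (0 + 1) ∧
    K.map (j, a + (u : AddCircle (1 : ℝ))) ∈ K.real}
  have hU : U.Finite := by
    refine Set.Finite.of_finite_image (f := fun u : ℝ => (j, a + (u : AddCircle (1 : ℝ))))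
      (finite_preimage_real.subset ?_) ?_
    · rintro _ ⟨u, hu, rfl⟩
      exact hu.2
    · intro u hu v hv e
      have e' : (u : AddCircle (1 : ℝ)) = v := add_left_cancel (congrArg Prod.snd e)
      exact congrArg Subtype.val ((AddCircle.equivIoc (1 : ℝ) 0).symm.injective
        (a₁ := ⟨u, hu.1⟩) (a₂ := ⟨v, hv.1⟩) e')
  obtain ⟨s, hs, hmin⟩ := U.exists_min_image id hU ⟨1, by simp, by
    rw [AddCircle.coe_period, add_zero, hx.map_eq]; exact c.2⟩
  have key : ∀ i', K.IsBranch (K.map (j, a + (s : AddCircle (1 : ℝ))))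
      (j, a + (s : AddCircle (1 : ℝ))) i' → ∃ (d : K.RealCrossing) (i' : Bool),
      (((c, CrossingEnd.outgoing i) : K.Boundary), ((d, CrossingEnd.incoming i') : K.Boundary)) ∈
        K.gaussArcs := fun i' hb =>
    ⟨⟨_, hs.2⟩, i', j, a, s, hs.1.1, by simpa using hs.1.2, startsAt_outgoing.2 hx,
      endsAt_incoming.2 hb,
      fun u h0 hus hu => hus.not_ge (hmin u ⟨⟨h0, hus.le.trans hs.1.2⟩, hu⟩)⟩
  rcases isLeftToRight_or_isRightToLeft (K.real_subset hs.2) rfl with h | h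
  · exact key true h
  · exact key false h

end VirtualDoodleDiagram

namespace ClosedVirtualTwinDiagram

variable {K : ClosedVirtualTwinDiagram}

/-- A piece of a flow line between points of a section that meets no point of `A` in between is an
arc of the return map. -/
theorem IsFlowSection.arc_of_flow_eq {X : Type} [Finite X] {φ : Perm X}
    {pt : X → Fin K.numComponents × AddCircle (1 : ℝ)} {dur : X → ℝ}
    (h : IsFlowSection K φ pt dur) {A : Set X} {x y : X} {s : ℝ} (hs : 0 < s)
    (e : K.flow s (pt x) = pt y) (hy : y ∈ A)
    (hA : ∀ u, 0 < u → u < s → ∀ z ∈ A, K.flow u (pt x) ≠ pt z) : Arc φ A x y := by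
  have : Nonempty X := ⟨x⟩
  -- every step takes at least the angle `dur x₀`, so finitely many steps suffice
  obtain ⟨x₀, hx₀⟩ := Finite.exists_min dur
  obtain ⟨N, hN⟩ := Archimedean.arch s (h.dur_pos x₀)
  induction N generalizing x s with
  | zero => simp at hN; linarith
  | succ N ih =>
    rcases lt_trichotomy s (dur x) with hlt | rfl | hlt
    · exact absurd e (h.flow_ne _ _ _ hs hlt)
    · rw [h.flow_dur] at e
      rw [← h.injective e] at hy ⊢
      exact Arc.last _ hy
    · refine Arc.step _ _ (fun hm => hA _ (h.dur_pos x) hlt _ hm (h.flow_dur x))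
        (ih (s := s - dur x) (sub_pos.2 hlt) ?_ ?_ ?_)
      · rw [← h.flow_dur, flow_flow, sub_add_cancel, e]
      · intro u h0 hu z hz
        rw [← h.flow_dur, flow_flow]
        exact hA _ (by linarith [h.dur_pos x]) (by linarith) z hz
      · rw [succ_nsmul] at hN
        linarith [hx₀ x]

/-- The arcs of a diagram between its real crossings are arcs of the strand system of a flow
section that contains the preimages of the real crossings. -/
theorem IsFlowSection.hasGaussData {X C : Type} [Finite X] {φ : Perm X}
    {pt : X → Fin K.numComponents × AddCircle (1 : ℝ)} {dur : X → ℝ}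
    (h : IsFlowSection K φ pt dur) (σ : C ≃ K.RealCrossing) {c : C × Bool → X}
    (hc : ∀ a, K.IsBranch (σ a.1).1 (pt (c a)) a.2) {g : C × Bool → C × Bool}
    (hg : ∀ a, (((σ a.1, CrossingEnd.outgoing a.2) : K.Boundary),
      ((σ (g a).1, CrossingEnd.incoming (g a).2) : K.Boundary)) ∈ K.gaussArcs) :
    HasGaussData g K.numComponents φ c fun x => (pt x).1 where
  injective a b hab := by
    have ha := hc a
    have hb := hc b
    rw [← hab] at hb
    have h1 : a.1 = b.1 := σ.injective (Subtype.ext (ha.map_eq.symm.trans hb.map_eq))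
    rw [← h1] at hb
    exact Prod.ext h1 (ha.eq_of_eq hb)
  arc a := by
    obtain ⟨j, x, s, hs, -, hx, hy, hu⟩ := hg a
    have hx := (hc a).unique (K.startsAt_outgoing.1 hx)
    have hy := (hc (g a)).unique (K.endsAt_incoming.1 hy)
    -- the parameter `s` of the circle corresponds to the angle `τ s`
    obtain ⟨τ, h0, hτ⟩ := exists_flow_eq_add j x
    refine h.arc_of_flow_eq (s := τ s) (by rw [← h0]; exact τ.strictMono hs) ?_ ⟨_, rfl⟩ ?_
    · rw [hx, ← hτ, hy]
    · rintro u hu0 hus _ ⟨b, rfl⟩ e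
      have h1 : u = τ (τ.symm u) := (τ.apply_symm_apply u).symm
      rw [h1, ← h0] at hu0
      rw [h1] at hus
      refine hu (τ.symm u) (τ.lt_iff_lt.1 hu0) (τ.lt_iff_lt.1 hus) ?_
      rw [hτ, τ.apply_symm_apply, ← hx, e, (hc b).map_eq]
      exact (σ b.1).2
  surjective := h.fst_surjective
  comp_eq_iff := h.fst_eq_iff

/-- The Markov class of a closed diagram is that of a strand system in which the ends of the real
crossings lie on strands of their own; `L` is the order in which the crossings are met. -/
theorem IsClosureOf.exists_detached {n : ℕ} {β : VT n} (h : K.IsClosureOf n β) {C : Type}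
    (σ : C ≃ K.RealCrossing) :
    ∃ (X : Type) (_ : Finite X) (φ : Perm X) (pt : X → Fin K.numComponents × AddCircle (1 : ℝ))
      (dur : X → ℝ) (c : C × Bool → X) (L : List C), IsFlowSection K φ pt dur ∧
      (∀ a, K.IsBranch (σ a.1).1 (pt (c a)) a.2) ∧ L.Nodup ∧ (∀ r, r ∈ L) ∧
      markovClass n β = strandClass X (endPairs c L) φ := by
  obtain ⟨p, R, hR, hR', hreal, e⟩ := h.exists_strandClass
  obtain ⟨X, hX, φ, pt, dur, Q, hsec, hQ, hQR, e'⟩ :=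
    (isFlowSection_turn K p).exists_detached R hR (fun r hr => (hR' r hr).2) id (fun _ => rfl)
      (fun r _ _ => (angleFrom_mem p r.1).2) [] (by simp)
  simp only [List.map_nil, List.append_nil, List.nil_append, id] at hQR e'
  have hc : ∀ a : C × Bool, ∃ x, K.IsBranch (σ a.1).1 (pt x) a.2 := by
    rintro ⟨r, i⟩
    have h1 := hreal _ (σ r).2
    rw [← hQR] at h1
    obtain ⟨q, hq, hqr⟩ := List.mem_map.1 h1
    have h2 := hQ q hq
    rw [hqr] at h2
    cases i
    · exact ⟨_, h2.1⟩
    · exact ⟨_, h2.2⟩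
  choose c hc using hc
  have hL : Q.map Prod.fst ∈ Set.range (List.map fun r => (σ r).1) := by
    rw [Set.range_list_map, hQR]
    intro z hz
    obtain ⟨r, hr, rfl⟩ := List.mem_map.1 hz
    exact ⟨σ.symm ⟨r.1, (hR' r hr).1⟩, congrArg Subtype.val (σ.apply_symm_apply _)⟩
  obtain ⟨L, hL⟩ := hL
  refine ⟨X, hX, φ, pt, dur, c, L, hsec, hc, ?_, fun r => ?_, ?_⟩
  · refine List.Nodup.of_map (fun r => (σ r).1) ?_
    rw [hL, hQR, List.Nodup, List.pairwise_map]
    exact hR.imp fun hlt e => hlt.ne (by rw [e])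
  · have h1 := hreal _ (σ r).2
    rw [← hQR, ← hL] at h1
    obtain ⟨r', hr', e⟩ := List.mem_map.1 h1
    rwa [← σ.injective (Subtype.ext e)]
  · have key : Q.map Prod.snd = endPairs c L := by
      clear hQR e'
      induction L generalizing Q with
      | nil => simp_all [endPairs]
      | cons r L ih =>
        obtain ⟨q, Q, rfl⟩ : ∃ q Q', Q = q :: Q' := by
          cases Q with
          | nil => simp at hL
          | cons q Q => exact ⟨q, Q, rfl⟩
        simp only [List.map_cons, List.cons.injEq] at hL
        have h1 := hQ q (by simp)
        rw [← hL.1] at h1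
        have h2 := ih Q (fun q hq => hQ q (by simp [hq])) hL.2
        rw [List.map_cons, h2, endPairs, endPairs, List.map_cons]
        congr 1
        exact Prod.ext (hsec.injective (h1.1.unique (hc (r, false))))
          (hsec.injective (h1.2.unique (hc (r, true))))
    rw [e, ← key, e']

end ClosedVirtualTwinDiagram

/-! ### Comparison of two closed diagrams -/

namespace ClosedVirtualTwinDiagram

/-- A virtual twin whose closure is a diagram for `D` has the Markov class of a strand system
whose Gauss data is that of `D`. -/
theorem IsFor.exists_hasGaussData {D : VirtualDoodleDiagram} {K : ClosedVirtualTwinDiagram}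
    (hK : K.IsFor D) {g : D.RealCrossing × Bool → D.RealCrossing × Bool}
    (hg : ∀ a, (((a.1, CrossingEnd.outgoing a.2) : D.Boundary),
      (((g a).1, CrossingEnd.incoming (g a).2) : D.Boundary)) ∈ D.gaussArcs)
    {n : ℕ} {β : VT n} (h : K.IsClosureOf n β) :
    ∃ (X : Type) (_ : Finite X) (φ : Perm X) (c : D.RealCrossing × Bool → X)
      (comp : X → Fin D.numComponents) (L : List D.RealCrossing),
      HasGaussData g D.numComponents φ c comp ∧ L.Nodup ∧ (∀ r, r ∈ L) ∧
      markovClass n β = strandClass X (endPairs c L) φ := by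
  obtain ⟨⟨σ, hσ⟩, hm⟩ := hK
  obtain ⟨X, hX, φ, pt, dur, c, L, hsec, hc, hL, hL', e⟩ := h.exists_detached σ
  have hdata := hsec.hasGaussData σ hc (g := g) fun a => hσ _ _ (hg a)
  rw [hm]
  exact ⟨X, hX, φ, c, _, L, hdata, hL, hL', e⟩

/-- A finite set can be listed by increasing values of an injective function. -/
theorem exists_list_pairwise_lt {S : Type*} {s : Set S} (hs : s.Finite) {f : S → ℝ}
    (hf : Set.InjOn f s) :
    ∃ L : List S, (∀ x, x ∈ L ↔ x ∈ s) ∧ L.Pairwise fun x y => f x < f y := by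
  classical
  rcases isEmpty_or_nonempty S with hS | hS
  · exact ⟨[], fun x => hS.elim x, List.Pairwise.nil⟩
  have hinv : ∀ x ∈ s, Function.invFunOn f s (f x) = x := fun x hx =>
    hf (Function.invFunOn_apply_mem hx) hx (Function.invFunOn_eq ⟨x, hx, rfl⟩)
  have hmem : ∀ t, t ∈ (hs.toFinset.image f).sort (· ≤ ·) ↔ ∃ x ∈ s, f x = t := by simp
  refine ⟨((hs.toFinset.image f).sort (· ≤ ·)).map (Function.invFunOn f s), fun x => ?_, ?_⟩
  · rw [List.mem_map]
    constructor
    · rintro ⟨t, ht, rfl⟩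
      obtain ⟨y, hy, rfl⟩ := (hmem t).1 ht
      rwa [hinv y hy]
    · exact fun hx => ⟨f x, (hmem _).2 ⟨x, hx, rfl⟩, hinv x hx⟩
  · rw [List.pairwise_map]
    refine (Finset.sortedLT_sort _).pairwise.imp_of_mem fun {t u} ht hu htu => ?_
    obtain ⟨x, hx, rfl⟩ := (hmem t).1 ht
    obtain ⟨y, hy, rfl⟩ := (hmem u).1 hu
    rwa [hinv x hx, hinv y hy]

/-- A crossing lies on two strands, so at most `degree - 2` strands pass on the outer side of it. -/
theorem position_add_one_lt (K : ClosedVirtualTwinDiagram) {c : ℂ} (hc : c ∈ crossingSet K.map) :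
    K.position c + 1 < K.degree := by
  obtain ⟨a, b, hab⟩ := exists_crossIn (p := 1) hc
  have hba := ((logHeight_eq_iff (angleFrom 1 c) a b).2 (hab.1.1.trans hab.2.1.symm))
  rw [← hab.1.1, position_map_flow, rank, ← card_fiber (p := 1), ← Set.ncard_univ,
    ← Set.ncard_insert_of_notMem (a := a) (by simp)]
  refine Set.ncard_lt_ncard (Set.ssubset_univ_iff.2 fun h => ?_) (Set.toFinite _)
  have hb : b ∈ insert a {y | logHeight (angleFrom 1 c) a < logHeight (angleFrom 1 c) y} :=
    h ▸ Set.mem_univ b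
  rcases hb with hb | hb
  · exact hab.ne hb.symm
  · exact hb.ne hba

/-- Every closed diagram can be cut. -/
theorem isClosureOf_degree (K : ClosedVirtualTwinDiagram) : ∃ β : VT K.degree,
    K.IsClosureOf K.degree β := by
  have : Infinite (Set.Ioo (0 : ℝ) 1) := Set.Ioo.infinite zero_lt_one
  have : Infinite Circle := Infinite.of_injective (fun t : Set.Ioo (0 : ℝ) 1 => Circle.exp t)
    fun t u e => Subtype.ext (Circle.exp_eq_exp_iff_of_lt (by
      rw [abs_lt]; constructor <;> linarith [t.2.1, t.2.2, u.2.1, u.2.2, Real.pi_gt_three]) e)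
  obtain ⟨p, hp⟩ := (K.finite_crossings.image radialProj).exists_notMem
  have hinj : Set.InjOn (angleFrom p) (crossingSet K.map) := fun c hc d hd e =>
    K.crossings_injOn hc hd (by
      rw [radialProj_eq_mul_exp_angleFrom p (crossing_ne_zero hc), e,
        ← radialProj_eq_mul_exp_angleFrom p (crossing_ne_zero hd)])
  obtain ⟨L, hL, hL'⟩ := exists_list_pairwise_lt K.finite_crossings hinj
  have hletter : ∀ c ∈ L, ∃ l : VTGen K.degree, K.IsLetter c l := fun c hc => by
    have hpos := K.position_add_one_lt ((hL c).1 hc)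
    by_cases hr : c ∈ K.real
    · exact ⟨VTGen.s ⟨K.position c, by omega⟩, hr, rfl⟩
    · exact ⟨VTGen.ρ ⟨K.position c, by omega⟩, hr, rfl⟩
  have hword : ∀ L : List ℂ, (∀ c ∈ L, ∃ l : VTGen K.degree, K.IsLetter c l) →
      ∃ w : List (VTGen K.degree), List.Forall₂ K.IsLetter L w := by
    intro L hL
    induction L with
    | nil => exact ⟨[], List.Forall₂.nil⟩
    | cons c L ih =>
      obtain ⟨w, hw⟩ := ih fun d hd => hL d (by simp [hd])
      obtain ⟨l, hl⟩ := hL c (by simp)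
      exact ⟨l :: w, List.Forall₂.cons hl hw⟩
  obtain ⟨w, hw⟩ := hword L hletter
  exact ⟨_, rfl, p, L, w, hp, hL, hL', hw, rfl⟩

end ClosedVirtualTwinDiagram

theorem mainTheorem3 (D : VirtualDoodleDiagram) (K K' : ClosedVirtualTwinDiagram)
    (hK : K.IsFor D) (hK' : K'.IsFor D) :
    ClosedVirtualTwinDiagram.RelatedByM0M2 K K' := by
  obtain ⟨β, hβ⟩ := K.isClosureOf_degree
  obtain ⟨β', hβ'⟩ := K'.isClosureOf_degree
  have hfin : Finite D.RealCrossing := (D.finite_crossings.subset D.real_subset).to_subtype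
  choose d i hdi using fun a : D.RealCrossing × Bool => D.exists_gaussArc a.1 a.2
  obtain ⟨X, _, φ, c, comp, L, h, hL, hL', e⟩ :=
    hK.exists_hasGaussData (g := fun a => (d a, i a)) hdi hβ
  obtain ⟨X', _, φ', c', comp', L', h', hN, hN', e'⟩ :=
    hK'.exists_hasGaussData (g := fun a => (d a, i a)) hdi hβ'
  refine ClosedVirtualTwinDiagram.relatedByM0M2_of_markovClass_eq hβ hβ' ?_
  rw [e, e', h.strandClass_eq L h']
  have hperm : L.Perm L' := (List.perm_ext_iff_of_nodup hL hN).2 fun r => by simp [hL', hN']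
  refine strandClass_perm φ' (hperm.map _) (List.pairwise_map.2 (hL.imp fun {r s} hrs => ?_))
  simp [h'.injective.eq_iff, hrs]
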